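/- Let $D>4$ and let $\eta=\mathrm{diag}(-1,1,\dots,1)$ be the Minkowski metric on $\mathbb R^D$. Let $\mathcal K$ be a real algebra of smooth functions on $\mathbb R^D$ (containing the constants) that is stable under the partial derivatives; for instance $\mathcal K=\mathbb R$ (no explicit $x$-dependence) or $\mathcal K=C^\infty(\mathbb R^D)$. Consider the graded-commutative algebra of local forms generated by $\mathcal K$, the differentials $dx^\mu$ (odd), and the variables $T_{\alpha\beta\gamma}$ (even), $S_{\alpha\beta}$, $A_{\alpha\beta}$ (odd), $C_\alpha$ (even), of antighost number $0$; $T^{*\alpha\beta\gamma}$ (odd) of antighost number $1$; $S^{*\alpha\beta}$, $A^{*\alpha\beta}$ (even) of antighost number $2$; $C^{*\alpha}$ (odd) of antighost number $3$; and all their formal derivatives $\partial_{\mu_1}\cdots\partial_{\mu_k}z$, which have the parity and the antighost number of $z$. Here $T_{\alpha\beta\gamma}=-T_{\beta\alpha\gamma}$, $T_{\alpha\beta\gamma}+T_{\beta\gamma\alpha}+T_{\gamma\alpha\beta}=0$, $S_{\alpha\beta}=S_{\beta\alpha}$, $A_{\alpha\beta}=-A_{\beta\alpha}$, and the starred variables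 have the same symmetries. Let $d=dx^\mu\partial_\mu$ with $\partial_\mu$ the total derivative, and let $\delta$ be the odd derivation that commutes with $\partial_\mu$, vanishes on $\mathcal K$, $dx^\mu$, $T$, $S$, $A$, $C$, and satisfies $$\delta T^{*\alpha\beta\gamma}=3\left(E^{\alpha\beta\gamma}+\tfrac12(\eta^{\gamma\alpha}E^\beta-\eta^{\gamma\beta}E^\alpha)\right),\qquad \delta S^{*\alpha\beta}=-\partial_\gamma(T^{*\gamma\alpha\beta}+T^{*\gamma\beta\alpha}),$$ $$\delta A^{*\alpha\beta}=-3\,\partial_\gamma(T^{*\gamma\alpha\beta}-T^{*\gamma\beta\alpha}),\qquad \delta C^{*\alpha}=6\,\partial_\mu S^{*\mu\alpha}+2\,\partial_\mu A^{*\mu\alpha},$$ where $F_{\alpha\beta\gamma\delta}=\partial_\alpha T_{\beta\gamma\delta}+\partial_\beta T_{\gamma\alpha\delta}+\partial_\gamma T_{\alpha\beta\delta}$, $E_{\alpha\beta\delta\varepsilon\gamma}=\tfrac12(\partial_\varepsilon F_{\alpha\beta\delta\gamma}-\partial_\gamma F_{\alpha\beta\delta\varepsilon})$, $E_{\alpha\beta\gamma}=\eta^{\varepsilon\delta}E_{\alpha\beta\delta\varepsilon\gamma}$,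 $E_\alpha=\eta^{\beta\gamma}E_{\alpha\beta\gamma}$. Write $a^p_k$ for a local form of form degree $p$ and antighost number $k$, and $d^Dx=dx^0\wedge\dots\wedge dx^{D-1}$. Then a complete set of representatives of $H^D_3(\delta|d)$ is given by the antifields $C^{*\mu}$ with constant coefficients: for all constants $\lambda_\mu\in\mathbb R$ there is $a^{D-1}_2$ with $\delta(\lambda_\mu C^{*\mu}d^Dx)+d a^{D-1}_2=0$; and whenever $\delta a^D_3+d a^{D-1}_2=0$, there are unique constants $\lambda_\mu\in\mathbb R$ such that $$a^D_3=\lambda_\mu C^{*\mu}\,d^Dx+\delta b^D_4+d b^{D-1}_3$$ for some local forms $b^D_4$ and $b^{D-1}_3$. -/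

import Mathlib

open scoped ContDiff

noncomputable section

namespace DualGravity

/-! ### Explicit dependence on the spacetime coordinates -/

/-- The partial derivative `∂f/∂x^μ` of a function on `ℝ^D`. -/
def pd {D : ℕ} (μ : Fin D) (f : (Fin D → ℝ) → ℝ) : (Fin D → ℝ) → ℝ :=
  fun x => fderiv ℝ f x (Pi.single μ 1)

/-- An admissible algebra of coefficient functions `f(x)`: any real algebra of smooth functions on
`ℝ^D` stable under partial derivatives. The two extreme cases, `CoeffAlgebra.constants` (no explicit
`x`-dependence) and `CoeffAlgebra.smooth` (arbitrary smooth explicit `x`-dependence), are below. -/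
structure CoeffAlgebra (D : ℕ) where
  carrier : Subalgebra ℝ ((Fin D → ℝ) → ℝ)
  contDiff : ∀ f ∈ carrier, ContDiff ℝ ∞ f
  pd_mem : ∀ f ∈ carrier, ∀ μ, pd μ f ∈ carrier

/-- Coefficients without explicit `x`-dependence. -/
def CoeffAlgebra.constants (D : ℕ) : CoeffAlgebra D where
  carrier := ⊥
  contDiff := by
    intro f hf
    obtain ⟨r, rfl⟩ := Algebra.mem_bot.1 hf
    exact contDiff_const
  pd_mem := by
    intro f hf μ
    obtain ⟨r, rfl⟩ := Algebra.mem_bot.1 hf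
    have h : pd μ (algebraMap ℝ ((Fin D → ℝ) → ℝ) r) = 0 := by
      funext x
      change fderiv ℝ (fun _ : Fin D → ℝ => r) x (Pi.single μ 1) = 0
      simp
    rw [h]
    exact zero_mem _

/-- Coefficients with arbitrary smooth `x`-dependence. -/
def CoeffAlgebra.smooth (D : ℕ) : CoeffAlgebra D where
  carrier :=
    { carrier := {f | ContDiff ℝ ∞ f}
      mul_mem' := by
        intro f g (hf : ContDiff ℝ ∞ f) (hg : ContDiff ℝ ∞ g)
        exact hf.mul hg
      add_mem' := by
        intro f g (hf : ContDiff ℝ ∞ f) (hg : ContDiff ℝ ∞ g)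
        exact hf.add hg
      algebraMap_mem' := by
        intro r
        exact (contDiff_const : ContDiff ℝ ∞ fun _ : Fin D → ℝ => r) }
  contDiff := fun _ hf => hf
  pd_mem := fun f hf _ =>
    ContDiff.clm_apply (ContDiff.fderiv_right (m := ∞) (n := ∞) hf (by simp)) contDiff_const

section Coeff

variable {D : ℕ} (K : CoeffAlgebra D)

/-- `∂/∂x^μ` as an operation on the coefficient algebra. -/
def CoeffAlgebra.deriv (μ : Fin D) (f : K.carrier) : K.carrier :=
  ⟨pd μ f, K.pd_mem f f.2 μ⟩

theorem CoeffAlgebra.differentiableAt (f : K.carrier) (x : Fin D → ℝ) :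
    DifferentiableAt ℝ (f : (Fin D → ℝ) → ℝ) x :=
  ((K.contDiff f f.2).differentiable (by simp)).differentiableAt

theorem CoeffAlgebra.deriv_add (μ : Fin D) (f g : K.carrier) :
    K.deriv μ (f + g) = K.deriv μ f + K.deriv μ g := by
  apply Subtype.ext
  funext x
  change fderiv ℝ ((f : (Fin D → ℝ) → ℝ) + (g : (Fin D → ℝ) → ℝ)) x (Pi.single μ 1) = _
  rw [fderiv_add (K.differentiableAt f x) (K.differentiableAt g x)]
  rfl

theorem CoeffAlgebra.deriv_mul (μ : Fin D) (f g : K.carrier) :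
    K.deriv μ (f * g) = K.deriv μ f * g + f * K.deriv μ g := by
  apply Subtype.ext
  funext x
  change fderiv ℝ ((f : (Fin D → ℝ) → ℝ) * (g : (Fin D → ℝ) → ℝ)) x (Pi.single μ 1)
    = fderiv ℝ f x (Pi.single μ 1) * (g : (Fin D → ℝ) → ℝ) x
      + (f : (Fin D → ℝ) → ℝ) x * fderiv ℝ g x (Pi.single μ 1)
  rw [fderiv_mul (K.differentiableAt f x) (K.differentiableAt g x)]
  simp
  ring

theorem CoeffAlgebra.deriv_algebraMap (μ : Fin D) (r : ℝ) :
    K.deriv μ (algebraMap ℝ K.carrier r) = 0 := by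
  apply Subtype.ext
  funext x
  change fderiv ℝ (fun _ : Fin D → ℝ => r) x (Pi.single μ 1) = 0
  simp

end Coeff

/-! ### Fields, ghosts and antifields -/

/-- The field variables: the gauge field `T_{αβγ}`, the ghosts `S_{αβ}`, `A_{αβ}`, the ghosts of
ghosts `C_α`, and the antifields `T^{*αβγ}`, `S^{*αβ}`, `A^{*αβ}`, `C^{*α}`. -/
inductive FieldVar (D : ℕ) : Type
  | T (α β γ : Fin D)
  | S (α β : Fin D)
  | A (α β : Fin D)
  | C (α : Fin D)
  | Tst (α β γ : Fin D)
  | Sst (α β : Fin D)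
  | Ast (α β : Fin D)
  | Cst (α : Fin D)

/-- Grassmann parity (`true` means odd). -/
def FieldVar.parity {D : ℕ} : FieldVar D → Bool
  | T _ _ _ => false
  | S _ _ => true
  | A _ _ => true
  | C _ => false
  | Tst _ _ _ => true
  | Sst _ _ => false
  | Ast _ _ => false
  | Cst _ => true

/-- Antighost (antifield) number. -/
def FieldVar.antigh {D : ℕ} : FieldVar D → ℕ
  | T _ _ _ => 0
  | S _ _ => 0
  | A _ _ => 0
  | C _ => 0
  | Tst _ _ _ => 1
  | Sst _ _ => 2
  | Ast _ _ => 2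
  | Cst _ => 3

/-! ### The algebra of local forms -/

/-- Generators of the algebra of local forms: coefficient functions `f(x)`, the differentials
`dx^μ`, and the derivatives `∂_I z` of the field variables `z`, where the multi-index `I` records
how often each `∂_μ` occurs. -/
inductive Gen {D : ℕ} (K : CoeffAlgebra D) : Type
  | coef (f : K.carrier)
  | dx (μ : Fin D)
  | jet (z : FieldVar D) (I : Fin D →₀ ℕ)

section Algebra

variable {D : ℕ} (K : CoeffAlgebra D)

/-- Total parity of a generator; the `dx^μ` are odd and anticommute with the odd fields. -/
def Gen.parity {K : CoeffAlgebra D} : Gen K → Bool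
  | coef _ => false
  | dx _ => true
  | jet z _ => z.parity

/-- Form degree of a generator. -/
def Gen.formDeg {K : CoeffAlgebra D} : Gen K → ℕ
  | coef _ => 0
  | dx _ => 1
  | jet _ _ => 0

/-- Antighost number of a generator. -/
def Gen.antigh {K : CoeffAlgebra D} : Gen K → ℕ
  | coef _ => 0
  | dx _ => 0
  | jet z _ => z.antigh

/-- The sign `(-1)^{pq}`. -/
def sgn (p q : Bool) : ℝ := if p && q then -1 else 1

local notation "ι" => FreeAlgebra.ι ℝ

/-- The relations: coefficient functions multiply as functions, generators supercommute, and the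
field variables (with all their derivatives) have the symmetries `T_{αβγ} = -T_{βαγ}`,
`T_{αβγ} + T_{βγα} + T_{γαβ} = 0`, `S_{αβ} = S_{βα}`, `A_{αβ} = -A_{βα}`, and likewise for the
antifields. -/
inductive Rel : FreeAlgebra ℝ (Gen K) → FreeAlgebra ℝ (Gen K) → Prop
  | coef_add (f g : K.carrier) : Rel (ι (.coef (f + g))) (ι (.coef f) + ι (.coef g))
  | coef_mul (f g : K.carrier) : Rel (ι (.coef (f * g))) (ι (.coef f) * ι (.coef g))
  | coef_const (r : ℝ) : Rel (ι (.coef (algebraMap ℝ K.carrier r))) (algebraMap ℝ _ r)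
  | supercomm (g h : Gen K) : Rel (ι g * ι h) (sgn g.parity h.parity • (ι h * ι g))
  | T_antisymm (α β γ : Fin D) (I : Fin D →₀ ℕ) :
      Rel (ι (.jet (.T α β γ) I)) (-ι (.jet (.T β α γ) I))
  | T_cyclic (α β γ : Fin D) (I : Fin D →₀ ℕ) :
      Rel (ι (.jet (.T α β γ) I) + ι (.jet (.T β γ α) I) + ι (.jet (.T γ α β) I)) 0
  | S_symm (α β : Fin D) (I : Fin D →₀ ℕ) :
      Rel (ι (.jet (.S α β) I)) (ι (.jet (.S β α) I))
  | A_antisymm (α β : Fin D) (I : Fin D →₀ ℕ) :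
      Rel (ι (.jet (.A α β) I)) (-ι (.jet (.A β α) I))
  | Tst_antisymm (α β γ : Fin D) (I : Fin D →₀ ℕ) :
      Rel (ι (.jet (.Tst α β γ) I)) (-ι (.jet (.Tst β α γ) I))
  | Tst_cyclic (α β γ : Fin D) (I : Fin D →₀ ℕ) :
      Rel (ι (.jet (.Tst α β γ) I) + ι (.jet (.Tst β γ α) I) + ι (.jet (.Tst γ α β) I)) 0
  | Sst_symm (α β : Fin D) (I : Fin D →₀ ℕ) :
      Rel (ι (.jet (.Sst α β) I)) (ι (.jet (.Sst β α) I))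
  | Ast_antisymm (α β : Fin D) (I : Fin D →₀ ℕ) :
      Rel (ι (.jet (.Ast α β) I)) (-ι (.jet (.Ast β α) I))

/-- The algebra of local forms: polynomials in the `dx^μ`, the field variables, ghosts, antifields
and their derivatives of finite order, with coefficients in `K`. -/
def LocalForms : Type := RingQuot (Rel K)

instance : Ring (LocalForms K) := inferInstanceAs (Ring (RingQuot (Rel K)))

instance : Algebra ℝ (LocalForms K) := inferInstanceAs (Algebra ℝ (RingQuot (Rel K)))

/-- The quotient map from the free algebra. -/
def LocalForms.mk : FreeAlgebra ℝ (Gen K) →ₐ[ℝ] LocalForms K := RingQuot.mkAlgHom ℝ (Rel K)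

variable {K}

/-- The class of a generator. -/
def gen (g : Gen K) : LocalForms K := LocalForms.mk K (FreeAlgebra.ι ℝ g)

/-- The variable `∂_I z`. -/
def jet (z : FieldVar D) (I : Fin D →₀ ℕ) : LocalForms K := gen (.jet z I)

theorem LocalForms.mk_rel {x y : FreeAlgebra ℝ (Gen K)} (h : Rel K x y) :
    LocalForms.mk K x = LocalForms.mk K y := RingQuot.mkAlgHom_rel ℝ h

theorem gen_supercomm (g h : Gen K) :
    gen g * gen h = sgn g.parity h.parity • (gen h * gen g) := by
  simpa [gen] using LocalForms.mk_rel (Rel.supercomm g h)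

theorem jet_T_antisymm (α β γ : Fin D) (I : Fin D →₀ ℕ) :
    (jet (.T α β γ) I : LocalForms K) = -jet (.T β α γ) I := by
  simpa [gen, jet] using LocalForms.mk_rel (Rel.T_antisymm (K := K) α β γ I)

theorem jet_T_cyclic (α β γ : Fin D) (I : Fin D →₀ ℕ) :
    (jet (.T α β γ) I + jet (.T β γ α) I + jet (.T γ α β) I : LocalForms K) = 0 := by
  simpa [gen, jet] using LocalForms.mk_rel (Rel.T_cyclic (K := K) α β γ I)

/-! ### Superderivations determined by their values on generators -/

/-- Elements that supercommute with all generators as elements of parity `p` do. -/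
def superCentral (p : Bool) : Submodule ℝ (LocalForms K) where
  carrier := {x | ∀ h : Gen K, gen h * x = sgn h.parity p • (x * gen h)}
  add_mem' := by
    intro a b ha hb h
    rw [mul_add, add_mul, smul_add, ha h, hb h]
  zero_mem' := by intro h; simp
  smul_mem' := by
    intro c x hx h
    rw [mul_smul_comm, smul_mul_assoc, hx h, smul_comm]

theorem gen_mem (g : Gen K) : gen g ∈ superCentral (K := K) g.parity :=
  fun h => gen_supercomm h g

/-- Conditions under which values `v` on generators extend to a superderivation of parity `ε`. -/
structure IsDerData (ε : Bool) (v : Gen K → LocalForms K) : Prop where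
  mem : ∀ g, v g ∈ superCentral (K := K) (xor g.parity ε)
  coef_add : ∀ f g, v (.coef (f + g)) = v (.coef f) + v (.coef g)
  coef_mul : ∀ f g, v (.coef (f * g)) = v (.coef f) * gen (.coef g) + gen (.coef f) * v (.coef g)
  coef_const : ∀ r, v (.coef (algebraMap ℝ K.carrier r)) = 0
  T_antisymm : ∀ α β γ I, v (.jet (.T α β γ) I) = -v (.jet (.T β α γ) I)
  T_cyclic : ∀ α β γ I,
    v (.jet (.T α β γ) I) + v (.jet (.T β γ α) I) + v (.jet (.T γ α β) I) = 0
  S_symm : ∀ α β I, v (.jet (.S α β) I) = v (.jet (.S β α) I)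
  A_antisymm : ∀ α β I, v (.jet (.A α β) I) = -v (.jet (.A β α) I)
  Tst_antisymm : ∀ α β γ I, v (.jet (.Tst α β γ) I) = -v (.jet (.Tst β α γ) I)
  Tst_cyclic : ∀ α β γ I,
    v (.jet (.Tst α β γ) I) + v (.jet (.Tst β γ α) I) + v (.jet (.Tst γ α β) I) = 0
  Sst_symm : ∀ α β I, v (.jet (.Sst α β) I) = v (.jet (.Sst β α) I)
  Ast_antisymm : ∀ α β I, v (.jet (.Ast α β) I) = -v (.jet (.Ast β α) I)

/-- The upper triangular matrix with diagonal `(σ g, g)` and corner `v g`, where `σ g = ± g` is the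
parity twist: a superderivation `X` is the corner of an algebra homomorphism
`a ↦ !![σ a, X a; 0, a]`. -/
def derMat (ε : Bool) (v : Gen K → LocalForms K) (g : Gen K) :
    Matrix (Fin 2) (Fin 2) (LocalForms K) :=
  !![sgn ε g.parity • gen g, v g; 0, gen g]

theorem derMat_rel {ε : Bool} {v : Gen K → LocalForms K} (hv : IsDerData ε v)
    ⦃x y : FreeAlgebra ℝ (Gen K)⦄ (h : Rel K x y) :
    FreeAlgebra.lift ℝ (derMat ε v) x = FreeAlgebra.lift ℝ (derMat ε v) y := by
  have h' := LocalForms.mk_rel h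
  have hε : sgn ε false = 1 := by cases ε <;> simp [sgn]
  cases h with
  | supercomm g h =>
    have e1 : v g * gen h = sgn h.parity (xor g.parity ε) • (gen h * v g) := by
      rw [hv.mem g h, smul_smul]
      cases h.parity <;> cases g.parity <;> cases ε <;> simp [sgn]
    have e2 := hv.mem h g
    have e3 := gen_supercomm g h
    simp only [map_mul, map_smul, FreeAlgebra.lift_ι_apply, derMat]
    ext i j
    fin_cases i <;> fin_cases j <;>
      simp [Matrix.mul_apply, Fin.sum_univ_two]
    · rw [e3]
      simp only [smul_smul]
      congr 1
      ring
    · rw [e1, e2]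
      simp only [smul_smul]
      rw [add_comm]
      congr 2 <;> cases h.parity <;> cases g.parity <;> cases ε <;> simp [sgn]
    · rw [e3]
  | coef_add f g =>
    simp only [map_add] at h'
    change gen _ = gen _ + gen _ at h'
    simp only [map_add, FreeAlgebra.lift_ι_apply, derMat, h', hv.coef_add]
    ext i j
    fin_cases i <;> fin_cases j <;> simp [Gen.parity]
  | coef_mul f g =>
    simp only [map_mul] at h'
    change gen _ = gen _ * gen _ at h'
    simp only [map_mul, FreeAlgebra.lift_ι_apply, derMat, h', hv.coef_mul]
    ext i j
    fin_cases i <;> fin_cases j <;> simp [Matrix.mul_apply, Fin.sum_univ_two, Gen.parity, hε, add_comm]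
  | coef_const r =>
    simp only [AlgHom.commutes] at h'
    change gen _ = _ at h'
    simp only [AlgHom.commutes, FreeAlgebra.lift_ι_apply, derMat, h', hv.coef_const]
    ext i j
    fin_cases i <;> fin_cases j <;> simp [Gen.parity, hε, Matrix.algebraMap_matrix_apply]
  | T_antisymm α β γ I =>
    simp only [map_neg] at h'
    change gen _ = -gen _ at h'
    simp only [map_neg, FreeAlgebra.lift_ι_apply, derMat, h', hv.T_antisymm α β γ I]
    ext i j
    fin_cases i <;> fin_cases j <;> simp [Gen.parity, FieldVar.parity]
  | T_cyclic α β γ I =>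
    simp only [map_add, map_zero] at h'
    change gen _ + gen _ + gen _ = 0 at h'
    simp only [map_add, map_zero, FreeAlgebra.lift_ι_apply, derMat]
    ext i j
    fin_cases i <;> fin_cases j <;>
      simp [Gen.parity, FieldVar.parity, ← smul_add, h', hv.T_cyclic α β γ I]
  | S_symm α β I =>
    change gen _ = gen _ at h'
    simp only [FreeAlgebra.lift_ι_apply, derMat, h', hv.S_symm α β I]
    rfl
  | A_antisymm α β I =>
    simp only [map_neg] at h'
    change gen _ = -gen _ at h'
    simp only [map_neg, FreeAlgebra.lift_ι_apply, derMat, h', hv.A_antisymm α β I]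
    ext i j
    fin_cases i <;> fin_cases j <;> simp [Gen.parity, FieldVar.parity]
  | Tst_antisymm α β γ I =>
    simp only [map_neg] at h'
    change gen _ = -gen _ at h'
    simp only [map_neg, FreeAlgebra.lift_ι_apply, derMat, h', hv.Tst_antisymm α β γ I]
    ext i j
    fin_cases i <;> fin_cases j <;> simp [Gen.parity, FieldVar.parity]
  | Tst_cyclic α β γ I =>
    simp only [map_add, map_zero] at h'
    change gen _ + gen _ + gen _ = 0 at h'
    simp only [map_add, map_zero, FreeAlgebra.lift_ι_apply, derMat]
    ext i j
    fin_cases i <;> fin_cases j <;>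
      simp [Gen.parity, FieldVar.parity, ← smul_add, h', hv.Tst_cyclic α β γ I]
  | Sst_symm α β I =>
    change gen _ = gen _ at h'
    simp only [FreeAlgebra.lift_ι_apply, derMat, h', hv.Sst_symm α β I]
    rfl
  | Ast_antisymm α β I =>
    simp only [map_neg] at h'
    change gen _ = -gen _ at h'
    simp only [map_neg, FreeAlgebra.lift_ι_apply, derMat, h', hv.Ast_antisymm α β I]
    ext i j
    fin_cases i <;> fin_cases j <;> simp [Gen.parity, FieldVar.parity]

/-- The homomorphism `a ↦ !![σ a, X a; 0, a]`. -/
def derHom {ε : Bool} {v : Gen K → LocalForms K} (hv : IsDerData ε v) :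
    LocalForms K →ₐ[ℝ] Matrix (Fin 2) (Fin 2) (LocalForms K) :=
  RingQuot.liftAlgHom ℝ ⟨FreeAlgebra.lift ℝ (derMat ε v), derMat_rel hv⟩

/-- The superderivation `X` of parity `ε` with `X g = v g` on generators. -/
def superDer {ε : Bool} {v : Gen K → LocalForms K} (hv : IsDerData ε v) :
    LocalForms K →ₗ[ℝ] LocalForms K where
  toFun a := derHom hv a 0 1
  map_add' a b := by simp
  map_smul' c a := by simp

theorem derHom_gen {ε : Bool} {v : Gen K → LocalForms K} (hv : IsDerData ε v) (g : Gen K) :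
    derHom hv (gen g) = derMat ε v g := by
  have h := RingQuot.liftAlgHom_mkAlgHom_apply (S := ℝ) (FreeAlgebra.lift ℝ (derMat ε v))
    (derMat_rel hv) (FreeAlgebra.ι ℝ g)
  rw [FreeAlgebra.lift_ι_apply] at h
  exact h

theorem superDer_gen {ε : Bool} {v : Gen K → LocalForms K} (hv : IsDerData ε v) (g : Gen K) :
    superDer hv (gen g) = v g := by
  change derHom hv (gen g) 0 1 = v g
  rw [derHom_gen]
  simp [derMat]

theorem superDer_one {ε : Bool} {v : Gen K → LocalForms K} (hv : IsDerData ε v) :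
    superDer hv 1 = 0 := by
  change derHom hv 1 0 1 = 0
  simp

/-- The graded Leibniz rule `X(g a) = (X g) a + (-1)^{ε|g|} g (X a)`, which together with
linearity, `superDer_one` and `superDer_gen` determines `X`. -/
theorem superDer_gen_mul {ε : Bool} {v : Gen K → LocalForms K} (hv : IsDerData ε v) (g : Gen K)
    (a : LocalForms K) :
    superDer hv (gen g * a) = v g * a + sgn ε g.parity • (gen g * superDer hv a) := by
  have key : derHom hv a 1 1 = a := by
    have h2 : ∀ x : FreeAlgebra ℝ (Gen K),
        derHom hv (LocalForms.mk K x) 1 0 = 0 ∧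
          derHom hv (LocalForms.mk K x) 1 1 = LocalForms.mk K x := by
      intro x
      induction x using FreeAlgebra.induction with
      | grade0 r => simp [Matrix.algebraMap_matrix_apply]
      | grade1 g =>
        change derHom hv (gen g) 1 0 = 0 ∧ derHom hv (gen g) 1 1 = gen g
        rw [derHom_gen]
        simp [derMat]
      | mul a b ha hb => simp [Matrix.mul_apply, Fin.sum_univ_two, ha, hb]
      | add a b ha hb => simp [ha, hb]
    obtain ⟨x, rfl⟩ := RingQuot.mkAlgHom_surjective ℝ (Rel K) a
    exact (h2 x).2
  change derHom hv (gen g * a) 0 1 = _ + _ • (gen g * derHom hv a 0 1)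
  rw [map_mul, derHom_gen]
  simp [Matrix.mul_apply, Fin.sum_univ_two, derMat, key, add_comm]

/-! ### The total derivatives and the exterior derivative -/

/-- The multi-index of the single derivative `∂_μ`. -/
def e (μ : Fin D) : Fin D →₀ ℕ := Finsupp.single μ 1

/-- Values of the total derivative `∂_μ` on generators. -/
def totalVal (μ : Fin D) : Gen K → LocalForms K
  | .coef f => gen (.coef (K.deriv μ f))
  | .dx _ => 0
  | .jet z I => jet z (I + e μ)

theorem gen_coef_add (f g : K.carrier) :
    gen (.coef (f + g)) = gen (.coef f) + (gen (.coef g) : LocalForms K) := by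
  simpa [gen] using LocalForms.mk_rel (Rel.coef_add (K := K) f g)

theorem gen_coef_mul (f g : K.carrier) :
    gen (.coef (f * g)) = gen (.coef f) * (gen (.coef g) : LocalForms K) := by
  simpa [gen] using LocalForms.mk_rel (Rel.coef_mul (K := K) f g)

theorem gen_coef_zero : gen (.coef 0) = (0 : LocalForms K) := by
  have h := LocalForms.mk_rel (Rel.coef_const (K := K) 0)
  simpa [gen] using h

theorem totalVal_isDerData (μ : Fin D) : IsDerData false (totalVal (K := K) μ) where
  mem := by
    intro g
    cases g with
    | coef f => simpa [totalVal, Gen.parity] using gen_mem (Gen.coef (K.deriv μ f))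
    | dx ν => simp [totalVal]
    | jet z I => simpa [totalVal, Gen.parity, jet] using gen_mem (K := K) (Gen.jet z (I + e μ))
  coef_add f g := by simp only [totalVal, K.deriv_add, gen_coef_add]
  coef_mul f g := by simp only [totalVal, K.deriv_mul, gen_coef_add, gen_coef_mul]
  coef_const r := by simp only [totalVal, K.deriv_algebraMap, gen_coef_zero]
  T_antisymm α β γ I := jet_T_antisymm α β γ (I + e μ)
  T_cyclic α β γ I := jet_T_cyclic α β γ (I + e μ)
  S_symm α β I := by
    simpa [totalVal, gen, jet] using LocalForms.mk_rel (Rel.S_symm (K := K) α β (I + e μ))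
  A_antisymm α β I := by
    simpa [totalVal, gen, jet] using LocalForms.mk_rel (Rel.A_antisymm (K := K) α β (I + e μ))
  Tst_antisymm α β γ I := by
    simpa [totalVal, gen, jet] using LocalForms.mk_rel (Rel.Tst_antisymm (K := K) α β γ (I + e μ))
  Tst_cyclic α β γ I := by
    simpa [totalVal, gen, jet] using LocalForms.mk_rel (Rel.Tst_cyclic (K := K) α β γ (I + e μ))
  Sst_symm α β I := by
    simpa [totalVal, gen, jet] using LocalForms.mk_rel (Rel.Sst_symm (K := K) α β (I + e μ))
  Ast_antisymm α β I := by
    simpa [totalVal, gen, jet] using LocalForms.mk_rel (Rel.Ast_antisymm (K := K) α β (I + e μ))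

/-- The total derivative `∂_μ`: the even derivation with `∂_μ f = ∂f/∂x^μ`, `∂_μ dx^ν = 0`,
`∂_μ (∂_I z) = ∂_{I+μ} z`. -/
def total (μ : Fin D) : LocalForms K →ₗ[ℝ] LocalForms K := superDer (totalVal_isDerData μ)

/-- The spacetime exterior derivative `d = dx^μ ∂_μ`. -/
def extd : LocalForms K →ₗ[ℝ] LocalForms K :=
  ∑ μ : Fin D, (LinearMap.mulLeft ℝ (gen (.dx μ))).comp (total μ)

/-! ### The Koszul-Tate differential -/

/-- The Minkowski metric `diag(-1, 1, …, 1)`; its inverse has the same components. -/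
def η (μ ν : Fin D) : ℝ := if μ = ν then (if (μ : ℕ) = 0 then -1 else 1) else 0

/-- `∂_I F_{αβγδ}` with `F_{αβγδ} = ∂_α T_{βγδ} + ∂_β T_{γαδ} + ∂_γ T_{αβδ}`. -/
def F (I : Fin D →₀ ℕ) (α β γ δ : Fin D) : LocalForms K :=
  jet (.T β γ δ) (I + e α) + jet (.T γ α δ) (I + e β) + jet (.T α β δ) (I + e γ)

/-- `∂_I E_{αβδεγ}` with the curvature `E_{αβδεγ} = ½ (∂_ε F_{αβδγ} - ∂_γ F_{αβδε})`. -/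
def curv (I : Fin D →₀ ℕ) (α β δ ε γ : Fin D) : LocalForms K :=
  (1 / 2 : ℝ) • (F (I + e ε) α β δ γ - F (I + e γ) α β δ ε)

/-- `∂_I E_{αβγ}` with `E_{αβγ} = η^{εδ} E_{αβδεγ}` (the metric is diagonal). -/
def ric (I : Fin D →₀ ℕ) (α β γ : Fin D) : LocalForms K :=
  ∑ δ, η δ δ • curv I α β δ δ γ

/-- `∂_I E_α` with `E_α = η^{βγ} E_{αβγ}` (the metric is diagonal). -/
def ricTr (I : Fin D →₀ ℕ) (α : Fin D) : LocalForms K :=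
  ∑ β, η β β • ric I α β β

/-- `∂_I` of the left-hand side of the equations of motion,
`3 (E^{αβγ} + ½ (η^{γα} E^β - η^{γβ} E^α))`, indices being raised with the diagonal metric. -/
def eom (I : Fin D →₀ ℕ) (α β γ : Fin D) : LocalForms K :=
  (3 : ℝ) • ((η α α * η β β * η γ γ) • ric I α β γ
    + (1 / 2 : ℝ) • ((η γ α * η β β) • ricTr I β - (η γ β * η α α) • ricTr I α))

/-- Values of the Koszul-Tate differential `δ` on generators:
`δ T^{*αβγ} = 3 (E^{αβγ} + η^{γ[α} E^{β]})`, `δ S^{*αβ} = -∂_γ (T^{*γαβ} + T^{*γβα})`,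
`δ A^{*αβ} = -3 ∂_γ (T^{*γαβ} - T^{*γβα})`, `δ C^{*α} = 6 ∂_μ S^{*μα} + 2 ∂_μ A^{*μα}`, together
with their derivatives, and zero on everything else. -/
def deltaVal : Gen K → LocalForms K
  | .coef _ => 0
  | .dx _ => 0
  | .jet (.T _ _ _) _ => 0
  | .jet (.S _ _) _ => 0
  | .jet (.A _ _) _ => 0
  | .jet (.C _) _ => 0
  | .jet (.Tst α β γ) I => eom I α β γ
  | .jet (.Sst α β) I => -∑ γ, (jet (.Tst γ α β) (I + e γ) + jet (.Tst γ β α) (I + e γ))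
  | .jet (.Ast α β) I =>
      -(3 : ℝ) • ∑ γ, (jet (.Tst γ α β) (I + e γ) - jet (.Tst γ β α) (I + e γ))
  | .jet (.Cst α) I =>
      (6 : ℝ) • ∑ μ, jet (.Sst μ α) (I + e μ) + (2 : ℝ) • ∑ μ, jet (.Ast μ α) (I + e μ)

theorem jet_mem (z : FieldVar D) (I : Fin D →₀ ℕ) :
    (jet z I : LocalForms K) ∈ superCentral (K := K) z.parity := gen_mem (Gen.jet z I)

theorem F_mem (I : Fin D →₀ ℕ) (α β γ δ : Fin D) :
    (F I α β γ δ : LocalForms K) ∈ superCentral (K := K) false :=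
  add_mem (add_mem (jet_mem _ _) (jet_mem _ _)) (jet_mem _ _)

theorem ric_mem (I : Fin D →₀ ℕ) (α β γ : Fin D) :
    (ric I α β γ : LocalForms K) ∈ superCentral (K := K) false :=
  Submodule.sum_mem _ fun _ _ => Submodule.smul_mem _ _ <|
    Submodule.smul_mem _ _ <| sub_mem (F_mem _ _ _ _ _) (F_mem _ _ _ _ _)

theorem ricTr_mem (I : Fin D →₀ ℕ) (α : Fin D) :
    (ricTr I α : LocalForms K) ∈ superCentral (K := K) false :=
  Submodule.sum_mem _ fun _ _ => Submodule.smul_mem _ _ (ric_mem _ _ _ _)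

theorem F_antisymm (I : Fin D →₀ ℕ) (α β γ δ : Fin D) :
    (F I α β γ δ : LocalForms K) = -F I β α γ δ := by
  unfold F
  rw [jet_T_antisymm β γ δ, jet_T_antisymm γ α δ, jet_T_antisymm α β δ]
  abel

theorem ric_antisymm (I : Fin D →₀ ℕ) (α β γ : Fin D) :
    (ric I α β γ : LocalForms K) = -ric I β α γ := by
  unfold ric curv
  rw [← Finset.sum_neg_distrib]
  refine Finset.sum_congr rfl fun δ _ => ?_
  rw [F_antisymm _ α β δ γ, F_antisymm _ α β δ δ]
  module

theorem ric_cyclic (I : Fin D →₀ ℕ) (α β γ : Fin D) :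
    (ric I α β γ + ric I β γ α + ric I γ α β : LocalForms K) = 0 := by
  unfold ric
  rw [← Finset.sum_add_distrib, ← Finset.sum_add_distrib]
  refine Finset.sum_eq_zero fun δ _ => ?_
  rw [← smul_add, ← smul_add]
  refine smul_eq_zero_of_right _ ?_
  unfold curv F
  rw [add_right_comm I (e α) (e δ), add_right_comm I (e β) (e δ), add_right_comm I (e γ) (e δ),
    add_right_comm I (e β) (e α), add_right_comm I (e γ) (e α), add_right_comm I (e γ) (e β)]
  have h := jet_T_cyclic (K := K) α β γ (I + e δ + e δ)
  have a1 := jet_T_cyclic (K := K) β δ γ (I + e δ + e α)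
  have a2 := jet_T_cyclic (K := K) γ δ α (I + e δ + e β)
  have a3 := jet_T_cyclic (K := K) α δ β (I + e δ + e γ)
  have b1 := jet_T_antisymm (K := K) γ β δ (I + e δ + e α)
  have b2 := jet_T_antisymm (K := K) α γ δ (I + e δ + e β)
  have b3 := jet_T_antisymm (K := K) β α δ (I + e δ + e γ)
  have c1 := jet_T_antisymm (K := K) β δ δ (I + e α + e γ)
  have c2 := jet_T_antisymm (K := K) γ δ δ (I + e α + e β)
  have c3 := jet_T_antisymm (K := K) α δ δ (I + e β + e γ)
  linear_combination (norm := module) (1 / 2 : ℝ) • (h + a1 + a2 + a3 - b1 - b2 - b3 - c1 - c2 - c3)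

theorem η_comm (μ ν : Fin D) : η μ ν = η ν μ := by
  unfold η
  by_cases h : μ = ν
  · subst h; rfl
  · rw [if_neg h, if_neg (Ne.symm h)]

theorem eom_antisymm (I : Fin D →₀ ℕ) (α β γ : Fin D) :
    (eom I α β γ : LocalForms K) = -eom I β α γ := by
  unfold eom
  rw [ric_antisymm I α β γ]
  module

theorem eom_cyclic (I : Fin D →₀ ℕ) (α β γ : Fin D) :
    (eom I α β γ + eom I β γ α + eom I γ α β : LocalForms K) = 0 := by
  unfold eom
  rw [η_comm γ α, η_comm γ β, η_comm β α]
  linear_combination (norm := module) (3 * (η α α * η β β * η γ γ)) • ric_cyclic (K := K) I α β γ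

theorem eom_mem (I : Fin D →₀ ℕ) (α β γ : Fin D) :
    (eom I α β γ : LocalForms K) ∈ superCentral (K := K) false := by
  unfold eom
  exact Submodule.smul_mem _ _ (add_mem (Submodule.smul_mem _ _ (ric_mem _ _ _ _))
    (Submodule.smul_mem _ _ (sub_mem (Submodule.smul_mem _ _ (ricTr_mem _ _))
      (Submodule.smul_mem _ _ (ricTr_mem _ _)))))

theorem jet_Tst_mem (α β γ : Fin D) (I : Fin D →₀ ℕ) :
    (jet (.Tst α β γ) I : LocalForms K) ∈ superCentral (K := K) true := jet_mem _ _

theorem deltaVal_Sst_mem (α β : Fin D) (I : Fin D →₀ ℕ) :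
    deltaVal (.jet (.Sst α β) I) ∈ superCentral (K := K) true := by
  simp only [deltaVal]
  exact Submodule.neg_mem _ (Submodule.sum_mem _ fun _ _ =>
    Submodule.add_mem _ (jet_Tst_mem _ _ _ _) (jet_Tst_mem _ _ _ _))

theorem deltaVal_Ast_mem (α β : Fin D) (I : Fin D →₀ ℕ) :
    deltaVal (.jet (.Ast α β) I) ∈ superCentral (K := K) true := by
  simp only [deltaVal]
  exact Submodule.smul_mem _ _ (Submodule.sum_mem _ fun _ _ =>
    Submodule.sub_mem _ (jet_Tst_mem _ _ _ _) (jet_Tst_mem _ _ _ _))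

theorem deltaVal_Cst_mem (α : Fin D) (I : Fin D →₀ ℕ) :
    deltaVal (.jet (.Cst α) I) ∈ superCentral (K := K) false := by
  simp only [deltaVal]
  exact Submodule.add_mem _
    (Submodule.smul_mem _ _ (Submodule.sum_mem _ fun μ _ => jet_mem (.Sst μ α) _))
    (Submodule.smul_mem _ _ (Submodule.sum_mem _ fun μ _ => jet_mem (.Ast μ α) _))

theorem deltaVal_isDerData : IsDerData true (deltaVal (K := K)) where
  mem := by
    intro g
    cases g with
    | coef f => exact zero_mem _
    | dx ν => exact zero_mem _
    | jet z I =>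
      cases z with
      | T α β γ => exact zero_mem _
      | S α β => exact zero_mem _
      | A α β => exact zero_mem _
      | C α => exact zero_mem _
      | Tst α β γ => exact eom_mem I α β γ
      | Sst α β => exact deltaVal_Sst_mem α β I
      | Ast α β => exact deltaVal_Ast_mem α β I
      | Cst α => exact deltaVal_Cst_mem α I
  coef_add f g := by simp [deltaVal]
  coef_mul f g := by simp [deltaVal]
  coef_const r := rfl
  T_antisymm α β γ I := by simp [deltaVal]
  T_cyclic α β γ I := by simp [deltaVal]
  S_symm α β I := rfl
  A_antisymm α β I := by simp [deltaVal]
  Tst_antisymm α β γ I := eom_antisymm I α β γ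
  Tst_cyclic α β γ I := eom_cyclic I α β γ
  Sst_symm α β I := by simp only [deltaVal, add_comm]
  Ast_antisymm α β I := by
    simp only [deltaVal]
    rw [← smul_neg, ← Finset.sum_neg_distrib]
    simp only [neg_sub]

/-- The Koszul-Tate differential `δ`: the odd derivation with the values `deltaVal`. -/
def delta : LocalForms K →ₗ[ℝ] LocalForms K := superDer deltaVal_isDerData

/-! ### The cohomology of `δ` modulo `d` -/

variable (K)

/-- Local forms of form degree `p` and antighost number `k`. -/
def Forms (p k : ℕ) : Submodule ℝ (LocalForms K) :=
  Submodule.span ℝ {a | ∃ l : List (Gen K),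
    (l.map Gen.formDeg).sum = p ∧ (l.map Gen.antigh).sum = k ∧ a = (l.map gen).prod}

/-- `a` is a `δ`-cocycle modulo `d` in top form degree `D` and antighost number `k ≥ 1`:
`δ a + d b = 0` for some `b` of form degree `D - 1` and antighost number `k - 1`. -/
def IsCocycle (k : ℕ) (a : LocalForms K) : Prop :=
  a ∈ Forms K D k ∧ ∃ b ∈ Forms K (D - 1) (k - 1), delta a + extd b = 0

/-- `a` is trivial in top form degree `D` and antighost number `k`: `a = δ m + d n` with `m` of form
degree `D` and antighost number `k + 1` and `n` of form degree `D - 1` and antighost number `k`. -/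
def IsTrivial (k : ℕ) (a : LocalForms K) : Prop :=
  ∃ m ∈ Forms K D (k + 1), ∃ n ∈ Forms K (D - 1) k, a = delta m + extd n

/-- The volume form `dx^0 ∧ dx^1 ∧ ⋯ ∧ dx^{D-1}`. -/
def vol : LocalForms K := (List.ofFn fun μ : Fin D => (gen (.dx μ) : LocalForms K)).prod

/-- The undifferentiated antifield `C^{*μ}` conjugate to the ghost of ghosts `C_μ`. -/
def Cstar (μ : Fin D) : LocalForms K := jet (.Cst μ) 0

end Algebra

end DualGravity

end

open scoped ContDiff

noncomputable section
namespace DualGravity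

/-! ### Homogeneous elements and superderivations -/

section Calculus

variable {D : ℕ} {K : CoeffAlgebra D}

/-! The nonlinear problem is reduced to linear algebra over the polynomial ring in the commuting
symbols `X μ` of the total derivatives. On linear combinations of jets, `delta` becomes a matrix
`kt` of polynomials acting on coefficient families (`delta_lin`); for the gauge field this uses that
the operator of the equations of motion is self-adjoint (`eomOp_adjoint`).

The complex C* → (S*, A*) → T* → T is exact except at T. A hook tensor killed by the equations of
motion has vanishing Ricci tensor because D ≠ 3. The Bianchi identity then forces its curl to be `p
γ` times a three-form, and exactness of the Koszul complex, applied several times, makes the tensor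
pure gauge (`exists_gauge`). A gauge parameter without effect is a gradient (`exists_grad`). Both
facts need only four variables, so for D > 4 they survive setting one variable to zero. Hence a
single `X i` acts injectively on the cokernel of the equations of motion (`eomOp_range_of_X_smul`),
and a projector onto representatives of the homology can be chosen to commute with `X i`
(`exists_eom_projector`).

The contracting homotopy of the linear complex extends to an odd derivation σ. The even derivation Δ
= δσ + σδ counts the contractible variables: its eigenvalues are natural numbers, and they are
positive in positive antighost number. Inverting Δ there gives `delta_acyclic`. Since Δ commutes
with ∂_i, a form whose derivative ∂_i is δ-exact differs by a δ-exact form from one with ∂_i f₀ = 0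
(`weakly_constant`).

The passage modulo d is made by Euler-Lagrange derivatives, which annihilate d-exact forms and
intertwine δ with the adjoint of `kt` (`EL_delta`). For a cocycle, all derivatives of the component
along C*_α are δ-exact. Weak constancy in the direction x^0 leaves a coefficient function times the
volume form; evaluation at vanishing fields, which kills every δ-exact form, shows that the other
derivatives of this function vanish as well (`exists_const`). The resulting constants are the λ_μ.

Once they are subtracted, the equations for the remaining Euler-Lagrange derivatives are solved from
C* downwards by acyclicity (`ELCocycle.exists_solution`). Up to a divergence, the sum of the
variables times their Euler-Lagrange derivatives is the number operator applied to the form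
(`num_sub_EL`), so this image is δ-exact modulo divergences (`sum_jet_mul_EL`). The number operator
is invertible in positive antighost number and commutes with δ and ∂_μ, and in top degree
divergences are d-exact by Cartan's formula; this proves triviality (`exists_delta_add_extd`).
Uniqueness holds since no variable is mapped by δ to an expression containing C*: the Euler-Lagrange
derivative of a trivial form along C* is δ-exact, hence zero at vanishing fields. -/

theorem LocalForms.induction {motive : LocalForms K → Prop} (one : motive 1)
    (add : ∀ a b, motive a → motive b → motive (a + b))
    (smul : ∀ (c : ℝ) a, motive a → motive (c • a))
    (gen_mul : ∀ g a, motive a → motive (gen g * a)) (a : LocalForms K) : motive a := by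
  obtain ⟨x, rfl⟩ := RingQuot.mkAlgHom_surjective ℝ (Rel K) a
  change motive (LocalForms.mk K x)
  suffices h : ∀ b, motive b → motive (LocalForms.mk K x * b) by simpa using h 1 one
  induction x using FreeAlgebra.induction with
  | grade0 r =>
    intro b hb
    rw [AlgHom.commutes, ← Algebra.smul_def]
    exact smul r b hb
  | grade1 g => exact fun b hb => gen_mul g b hb
  | mul x y hx hy =>
    intro b hb
    rw [map_mul, mul_assoc]
    exact hx _ (hy b hb)
  | add x y hx hy =>
    intro b hb
    rw [map_add, add_mul]
    exact add _ _ (hx b hb) (hy b hb)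

/-- The span of the products of generators of total degree `a`. -/
def Homog {A : Type*} [AddCommMonoid A] (deg : Gen K → A) (a : A) : Submodule ℝ (LocalForms K) :=
  Submodule.span ℝ {x | ∃ l : List (Gen K), (l.map deg).sum = a ∧ x = (l.map gen).prod}

section Homog

variable {A : Type*} [AddCommMonoid A] {deg : Gen K → A}

theorem Homog.prod_mem (l : List (Gen K)) : (l.map gen).prod ∈ Homog deg (l.map deg).sum :=
  Submodule.subset_span ⟨l, rfl, rfl⟩

theorem Homog.one_mem : (1 : LocalForms K) ∈ Homog deg 0 := by
  simpa using Homog.prod_mem (deg := deg) []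

theorem Homog.gen_mem (g : Gen K) : gen g ∈ Homog deg (deg g) := by
  simpa using Homog.prod_mem (deg := deg) [g]

theorem Homog.induction {a : A} {motive : (x : LocalForms K) → x ∈ Homog deg a → Prop}
    (zero : motive 0 (zero_mem _))
    (add : ∀ x y hx hy, motive x hx → motive y hy → motive (x + y) (add_mem hx hy))
    (smul : ∀ (c : ℝ) x hx, motive x hx → motive (c • x) (Submodule.smul_mem _ c hx))
    (prod : ∀ (l : List (Gen K)) (hl : (l.map deg).sum = a),
      motive (l.map gen).prod (Submodule.subset_span ⟨l, hl, rfl⟩))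
    {x : LocalForms K} (hx : x ∈ Homog deg a) : motive x hx := by
  induction hx using Submodule.span_induction with
  | mem x h => obtain ⟨l, hl, rfl⟩ := h; exact prod l hl
  | zero => exact zero
  | add x y h h' hx hy => exact add x y h h' hx hy
  | smul c x h hx => exact smul c x h hx

theorem Homog.mul_mem {a b : A} {x y : LocalForms K} (hx : x ∈ Homog deg a)
    (hy : y ∈ Homog deg b) : x * y ∈ Homog deg (a + b) := by
  induction hx using Homog.induction with
  | zero => simp
  | add x x' _ _ h h' => rw [add_mul]; exact add_mem h h'
  | smul c x _ h => rw [smul_mul_assoc]; exact Submodule.smul_mem _ _ h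
  | prod l hl =>
    induction hy using Homog.induction with
    | zero => simp
    | add x x' _ _ h h' => rw [mul_add]; exact add_mem h h'
    | smul c x _ h => rw [mul_smul_comm]; exact Submodule.smul_mem _ _ h
    | prod l' hl' =>
      have h := Homog.prod_mem (deg := deg) (l ++ l')
      simpa [hl, hl'] using h

end Homog

/-- The parity of a generator as an element of `ZMod 2`. -/
def parZ (b : Bool) : ZMod 2 := if b then 1 else 0

theorem parZ_xor (a b : Bool) : parZ (xor a b) = parZ a + parZ b := by
  cases a <;> cases b <;> decide

theorem parZ_injective : Function.Injective parZ := by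
  intro a b; cases a <;> cases b <;> decide

theorem parZ_surjective : Function.Surjective parZ := by
  intro a
  fin_cases a
  · exact ⟨false, rfl⟩
  · exact ⟨true, rfl⟩

/-- Elements of parity `p`. -/
def Par (K : CoeffAlgebra D) (p : Bool) : Submodule ℝ (LocalForms K) :=
  Homog (fun g : Gen K => parZ g.parity) (parZ p)

theorem Par.one_mem : (1 : LocalForms K) ∈ Par K false := Homog.one_mem

theorem Par.gen_mem (g : Gen K) : gen g ∈ Par K g.parity :=
  Homog.gen_mem (deg := fun g : Gen K => parZ g.parity) g

theorem sgn_comm (a b : Bool) : sgn a b = sgn b a := by cases a <;> cases b <;> rfl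

theorem sgn_xor (a b c : Bool) : sgn a (xor b c) = sgn a b * sgn a c := by
  cases a <;> cases b <;> cases c <;> simp [sgn]

theorem sgn_mul_self (a b : Bool) : sgn a b * sgn a b = 1 := by
  cases a <;> cases b <;> simp [sgn]

/-- The linear maps obeying the graded Leibniz rule of parity `ε`. -/
def sder (K : CoeffAlgebra D) (ε : Bool) : Submodule ℝ (LocalForms K →ₗ[ℝ] LocalForms K) where
  carrier := {F | F 1 = 0 ∧ ∀ g a,
    F (gen g * a) = F (gen g) * a + sgn ε g.parity • (gen g * F a)}
  add_mem' := by
    rintro F G ⟨hF, hF'⟩ ⟨hG, hG'⟩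
    refine ⟨by simp [hF, hG], fun g a => ?_⟩
    simp only [LinearMap.add_apply, hF', hG', add_mul, mul_add, smul_add]
    abel
  zero_mem' := by simp
  smul_mem' := by
    rintro c F ⟨hF, hF'⟩
    refine ⟨by simp [hF], fun g a => ?_⟩
    simp only [LinearMap.smul_apply, hF', smul_add, smul_mul_assoc, mul_smul_comm]
    rw [smul_comm]

theorem superDer_mem {ε : Bool} {v : Gen K → LocalForms K} (hv : IsDerData ε v) :
    superDer hv ∈ sder K ε :=
  ⟨superDer_one hv, fun g a => by rw [superDer_gen_mul, superDer_gen]⟩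

theorem sder_ext {ε : Bool} {F G : LocalForms K →ₗ[ℝ] LocalForms K} (hF : F ∈ sder K ε)
    (hG : G ∈ sder K ε) (h : ∀ g, F (gen g) = G (gen g)) : F = G := by
  ext a
  induction a using LocalForms.induction with
  | one => rw [hF.1, hG.1]
  | add a b ha hb => rw [map_add, map_add, ha, hb]
  | smul c a ha => rw [map_smul, map_smul, ha]
  | gen_mul g a ha => rw [hF.2, hG.2, ha, h]

/-- Membership in `sder` only prescribes the Leibniz rule for a generator on the left; induction on
monomials gives it for every homogeneous left factor. -/
theorem sder_mul {ε p : Bool} {F : LocalForms K →ₗ[ℝ] LocalForms K} (hF : F ∈ sder K ε)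
    {x : LocalForms K} (hx : x ∈ Par K p) (a : LocalForms K) :
    F (x * a) = F x * a + sgn ε p • (x * F a) := by
  induction hx using Homog.induction with
  | zero => simp
  | add x y _ _ hx hy => simp only [add_mul, map_add, hx, hy, smul_add]; abel
  | smul c x _ hx =>
    simp only [smul_mul_assoc, map_smul, hx, smul_add]
    rw [smul_comm]
  | prod l hl =>
    induction l generalizing p with
    | nil =>
      have : p = false := parZ_injective (by simpa [parZ] using hl.symm)
      subst this
      simp [hF.1, sgn]
    | cons g l ih =>
      obtain ⟨p', hp'⟩ := parZ_surjective ((l.map fun g : Gen K => parZ g.parity).sum)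
      have hp : p = xor g.parity p' := by
        apply parZ_injective
        rw [parZ_xor, hp', ← hl]
        simp
      simp only [List.map_cons, List.prod_cons, mul_assoc, hF.2, ih hp'.symm, hp, sgn_xor,
        add_mul, mul_add, smul_add, mul_smul_comm, smul_mul_assoc, smul_smul]
      abel

/-- In the second-order expansion the terms where each factor is hit once occur twice, with opposite
signs. The parity of the values on generators is needed to apply the Leibniz rule to `F (gen g) * a`
and `G (gen g) * a`. -/
theorem sder_bracket {ε ε' : Bool} {F G : LocalForms K →ₗ[ℝ] LocalForms K} (hF : F ∈ sder K ε)
    (hG : G ∈ sder K ε') (hF' : ∀ g, F (gen g) ∈ Par K (xor g.parity ε))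
    (hG' : ∀ g, G (gen g) ∈ Par K (xor g.parity ε')) :
    F ∘ₗ G - sgn ε ε' • G ∘ₗ F ∈ sder K (xor ε ε') := by
  refine ⟨by simp [hF.1, hG.1], fun g a => ?_⟩
  simp only [LinearMap.sub_apply, LinearMap.comp_apply, LinearMap.smul_apply, hG.2 g a, hF.2 g a,
    map_add, map_smul, sder_mul hF (hG' g), sder_mul hG (hF' g), hF.2 g, hG.2 g]
  have e1 : sgn ε (xor g.parity ε') = sgn ε ε' * sgn ε g.parity := by rw [sgn_xor, mul_comm]
  have e2 : sgn ε' g.parity = sgn ε ε' * sgn ε' (xor g.parity ε) := by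
    rw [sgn_xor, sgn_comm ε' ε, mul_left_comm, sgn_mul_self, mul_one]
  have e3 : sgn (xor ε ε') g.parity = sgn ε g.parity * sgn ε' g.parity := by
    rw [sgn_comm, sgn_xor, sgn_comm, sgn_comm ε']
  have e4 : sgn ε ε' * sgn ε ε' = 1 := sgn_mul_self _ _
  rw [e1, e3, e2]
  simp only [smul_add, smul_sub, sub_mul, mul_sub, smul_mul_assoc, mul_smul_comm]
  module

/-- Even derivations commuting on generators commute. -/
theorem sder_commute {ε ε' : Bool} {F G : LocalForms K →ₗ[ℝ] LocalForms K} (hF : F ∈ sder K ε)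
    (hG : G ∈ sder K ε') (hF' : ∀ g, F (gen g) ∈ Par K (xor g.parity ε))
    (hG' : ∀ g, G (gen g) ∈ Par K (xor g.parity ε'))
    (h : ∀ g, F (G (gen g)) = sgn ε ε' • G (F (gen g))) (a : LocalForms K) :
    F (G a) = sgn ε ε' • G (F a) := by
  have key := sder_ext (sder_bracket hF hG hF' hG') (zero_mem _) (fun g => by simp [h g])
  simpa [sub_eq_zero] using LinearMap.congr_fun key a

theorem sder_homog {A : Type*} [AddCommGroup A] {deg : Gen K → A} {c : A} {ε : Bool}
    {F : LocalForms K →ₗ[ℝ] LocalForms K} (hF : F ∈ sder K ε)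
    (h : ∀ g, F (gen g) ∈ Homog deg (deg g + c)) {a : A} {x : LocalForms K}
    (hx : x ∈ Homog deg a) : F x ∈ Homog deg (a + c) := by
  induction hx using Homog.induction with
  | zero => simp
  | add x y _ _ hx hy => rw [map_add]; exact add_mem hx hy
  | smul r x _ hx => rw [map_smul]; exact Submodule.smul_mem _ _ hx
  | prod l hl =>
    induction l generalizing a with
    | nil => simp [hF.1]
    | cons g l ih =>
      have hl' : deg g + (l.map deg).sum = a := by simpa using hl
      rw [List.map_cons, List.prod_cons, hF.2]
      refine add_mem ?_ (Submodule.smul_mem _ _ ?_)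
      · have := Homog.mul_mem (h g) (Homog.prod_mem (deg := deg) l)
        rwa [add_right_comm, hl'] at this
      · have := Homog.mul_mem (Homog.gen_mem (deg := deg) g) (ih rfl)
        rwa [← add_assoc, hl'] at this

/-! ### The bigrading by form degree and antighost number. -/

/-- The bidegree (form degree, antighost number) of a generator. -/
def bideg (g : Gen K) : ℤ × ℤ := (g.formDeg, g.antigh)

/-- Local forms of form degree `p` and antighost number `k`, with integer degrees. -/
def Bi (K : CoeffAlgebra D) (p k : ℤ) : Submodule ℝ (LocalForms K) := Homog bideg (p, k)

theorem sum_bideg (l : List (Gen K)) :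
    (l.map bideg).sum = (((l.map Gen.formDeg).sum : ℤ), ((l.map Gen.antigh).sum : ℤ)) := by
  induction l with
  | nil => rfl
  | cons g l ih => simp [ih, bideg]

theorem Forms_eq_Bi (p k : ℕ) : Forms K p k = Bi K p k := by
  unfold Forms Bi Homog
  congr 1
  ext x
  constructor
  · rintro ⟨l, h1, h2, rfl⟩
    exact ⟨l, by rw [sum_bideg, h1, h2], rfl⟩
  · rintro ⟨l, h, rfl⟩
    rw [sum_bideg, Prod.mk.injEq] at h
    exact ⟨l, by exact_mod_cast h.1, by exact_mod_cast h.2, rfl⟩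

theorem Bi.gen_mem (g : Gen K) : gen g ∈ Bi K g.formDeg g.antigh := by
  have h := Homog.gen_mem (deg := bideg) g
  rw [bideg] at h
  exact h

theorem Bi.jet_mem (z : FieldVar D) (I : Fin D →₀ ℕ) :
    (jet z I : LocalForms K) ∈ Bi K 0 z.antigh := by
  have h := Bi.gen_mem (K := K) (.jet z I)
  simp only [Gen.formDeg, Gen.antigh, Nat.cast_zero] at h
  exact h

theorem Bi.mul_mem {p k q l : ℤ} {x y : LocalForms K} (hx : x ∈ Bi K p k) (hy : y ∈ Bi K q l) :
    x * y ∈ Bi K (p + q) (k + l) := by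
  unfold Bi at *
  have h := Homog.mul_mem hx hy
  rwa [Prod.mk_add_mk] at h

theorem sder_Bi {c c' : ℤ} {ε : Bool} {F : LocalForms K →ₗ[ℝ] LocalForms K} (hF : F ∈ sder K ε)
    (h : ∀ g, F (gen g) ∈ Bi K (g.formDeg + c) (g.antigh + c')) {p k : ℤ} {x : LocalForms K}
    (hx : x ∈ Bi K p k) : F x ∈ Bi K (p + c) (k + c') := by
  unfold Bi at *
  rw [← Prod.mk_add_mk]
  refine sder_homog hF (fun g => ?_) hx
  rw [bideg, Prod.mk_add_mk]
  exact h g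

/-! ### Spectral decomposition under even derivations -/

/-- The vectors on which `T` acts invertibly and locally finitely. -/
def invertibleOn {V : Type*} [AddCommGroup V] [Module ℝ V] (T : V →ₗ[ℝ] V) : Submodule ℝ V where
  carrier := {x | ∃ P : Polynomial ℝ, P.coeff 0 = 1 ∧ Polynomial.aeval (R := ℝ) T P x = 0}
  add_mem' := by
    rintro x y ⟨P, hP, hx⟩ ⟨Q, hQ, hy⟩
    refine ⟨P * Q, by simp [Polynomial.mul_coeff_zero, hP, hQ], ?_⟩
    rw [map_add]
    nth_rewrite 1 [mul_comm P Q]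
    simp [map_mul, Module.End.mul_apply, hx, hy]
  zero_mem' := ⟨1, by simp, by simp⟩
  smul_mem' := by
    rintro c x ⟨P, hP, hx⟩
    exact ⟨P, hP, by simp [hx]⟩

section invertibleOn

variable {V : Type*} [AddCommGroup V] [Module ℝ V] {T : V →ₗ[ℝ] V}

/-- Writing `P = 1 + X * P.divX`, the relation `P(T) x = 0` exhibits `-P.divX(T)` as an inverse of
`T` on `x`. The inverse is a polynomial in `T`, so it commutes with everything that commutes with
`T`. -/
theorem invertibleOn.exists_eq {x : V} (hx : x ∈ invertibleOn T) :
    ∃ r : Polynomial ℝ, x = Polynomial.aeval (R := ℝ) T r (T x) := by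
  obtain ⟨P, hP, hx⟩ := hx
  refine ⟨-P.divX, ?_⟩
  have h := Polynomial.divX_mul_X_add P
  rw [hP] at h
  rw [← h, map_add, map_mul, LinearMap.add_apply, Module.End.mul_apply] at hx
  simp only [Polynomial.aeval_X, map_one, Module.End.one_apply] at hx
  rw [map_neg, LinearMap.neg_apply]
  exact (neg_eq_of_add_eq_zero_right hx).symm

theorem invertibleOn.eq_zero {x : V} (hx : x ∈ invertibleOn T) (h : T x = 0) : x = 0 := by
  obtain ⟨r, hr⟩ := exists_eq hx
  rw [hr, h, map_zero]

theorem aeval_commute {V : Type*} [AddCommGroup V] [Module ℝ V] {T : V →ₗ[ℝ] V} {F : V →ₗ[ℝ] V}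
    (hF : ∀ x, F (T x) = T (F x)) (P : Polynomial ℝ) (x : V) :
    F (Polynomial.aeval (R := ℝ) T P x) = Polynomial.aeval (R := ℝ) T P (F x) := by
  have h : Commute F (Polynomial.aeval (R := ℝ) T P) := by
    induction P using Polynomial.induction_on' with
    | add p q hp hq => rw [map_add]; exact hp.add_right hq
    | monomial n a =>
      rw [Polynomial.aeval_monomial]
      exact (show Commute F (algebraMap ℝ _ a) from (Algebra.commutes a F).symm).mul_right
        ((show Commute F T from LinearMap.ext hF).pow_right n)
  exact LinearMap.congr_fun h x

theorem aeval_mem {V : Type*} [AddCommGroup V] [Module ℝ V] {T : V →ₗ[ℝ] V} {W : Submodule ℝ V}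
    (hW : ∀ x ∈ W, T x ∈ W) (P : Polynomial ℝ) {x : V} (hx : x ∈ W) :
    Polynomial.aeval (R := ℝ) T P x ∈ W := by
  induction P using Polynomial.induction_on' with
  | add p q hp hq => rw [map_add]; exact add_mem hp hq
  | monomial n a =>
    rw [Polynomial.aeval_monomial, ← Algebra.smul_def, LinearMap.smul_apply]
    refine Submodule.smul_mem _ _ ?_
    induction n with
    | zero => simpa using hx
    | succ n ih => rw [pow_succ', Module.End.mul_apply]; exact hW _ ih

theorem invertibleOn.map {F : V →ₗ[ℝ] V} (hF : ∀ x, F (T x) = T (F x)) {x : V}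
    (hx : x ∈ invertibleOn T) : F x ∈ invertibleOn T := by
  obtain ⟨P, hP, hx⟩ := hx
  exact ⟨P, hP, by rw [← aeval_commute hF, hx, map_zero]⟩

theorem invertibleOn.of_eigen {x : V} {j : ℕ} (hj : 1 ≤ j) (hx : T x = (j : ℝ) • x) :
    x ∈ invertibleOn T := by
  refine ⟨1 - Polynomial.C (j : ℝ)⁻¹ * Polynomial.X, by simp, ?_⟩
  have : (j : ℝ) ≠ 0 := by positivity
  simp [hx, smul_smul, this]

end invertibleOn

theorem sder_even_mul {F : LocalForms K →ₗ[ℝ] LocalForms K} (hF : F ∈ sder K false)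
    (x y : LocalForms K) : F (x * y) = F x * y + x * F y := by
  induction x using LocalForms.induction with
  | one => simp [hF.1]
  | add a b ha hb => simp only [add_mul, map_add, ha, hb]; abel
  | smul c a ha => simp only [smul_mul_assoc, map_smul, ha, smul_add]
  | gen_mul g a ha =>
    have h1 : sgn false g.parity = 1 := by simp [sgn]
    rw [mul_assoc, hF.2, hF.2, ha, h1, one_smul, one_smul, mul_add, add_mul]
    simp only [mul_assoc, add_assoc]

/-- The span of the eigenvectors of `T` with natural eigenvalues `≥ n` in the subspace `W`. -/
def eigSpan {V : Type*} [AddCommGroup V] [Module ℝ V] (T : V →ₗ[ℝ] V) (n : ℕ) : Submodule ℝ V :=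
  Submodule.span ℝ {x | ∃ j : ℕ, n ≤ j ∧ T x = (j : ℝ) • x}

theorem eigSpan_mono {V : Type*} [AddCommGroup V] [Module ℝ V] (T : V →ₗ[ℝ] V) {m n : ℕ}
    (h : m ≤ n) : eigSpan T n ≤ eigSpan T m :=
  Submodule.span_mono fun _ ⟨j, hj, hx⟩ => ⟨j, h.trans hj, hx⟩

theorem eigSpan_one_le {V : Type*} [AddCommGroup V] [Module ℝ V] (T : V →ₗ[ℝ] V) :
    eigSpan T 1 ≤ invertibleOn T :=
  Submodule.span_le.2 fun _ ⟨_, hj, hx⟩ => invertibleOn.of_eigen hj hx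

theorem eigSpan_mul {T : LocalForms K →ₗ[ℝ] LocalForms K} (hT : T ∈ sder K false) {m n : ℕ}
    {x y : LocalForms K} (hx : x ∈ eigSpan T m) (hy : y ∈ eigSpan T n) :
    x * y ∈ eigSpan T (m + n) := by
  induction hx using Submodule.span_induction with
  | zero => simp
  | add x x' _ _ h h' => rw [add_mul]; exact add_mem h h'
  | smul c x _ h => rw [smul_mul_assoc]; exact Submodule.smul_mem _ _ h
  | mem x hx =>
    obtain ⟨i, hi, hx⟩ := hx
    induction hy using Submodule.span_induction with
    | zero => simp
    | add x x' _ _ h h' => rw [mul_add]; exact add_mem h h'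
    | smul c x _ h => rw [mul_smul_comm]; exact Submodule.smul_mem _ _ h
    | mem y hy =>
      obtain ⟨j, hj, hy⟩ := hy
      refine Submodule.subset_span ⟨i + j, add_le_add hi hj, ?_⟩
      rw [sder_even_mul hT, hx, hy]
      push_cast
      rw [add_smul, smul_mul_assoc, mul_smul_comm]

theorem eigSpan_prod {T : LocalForms K →ₗ[ℝ] LocalForms K} (hT : T ∈ sder K false)
    (h : ∀ g, gen g ∈ eigSpan T 0) (l : List (Gen K)) : (l.map gen).prod ∈ eigSpan T 0 := by
  induction l with
  | nil => exact Submodule.subset_span ⟨0, le_rfl, by simp [hT.1]⟩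
  | cons g l ih => simpa using eigSpan_mul hT (h g) ih

theorem eigSpan_prod_one {T : LocalForms K →ₗ[ℝ] LocalForms K} (hT : T ∈ sder K false)
    (h : ∀ g, gen g ∈ eigSpan T 0) {l : List (Gen K)}
    (hl : ∃ g ∈ l, gen g ∈ eigSpan T 1) : (l.map gen).prod ∈ eigSpan T 1 := by
  induction l with
  | nil => simp at hl
  | cons g l ih =>
    obtain ⟨g', hg', h1⟩ := hl
    rw [List.map_cons, List.prod_cons]
    rcases List.mem_cons.1 hg' with rfl | hg'
    · simpa using eigSpan_mul hT h1 (eigSpan_prod hT h l)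
    · simpa using eigSpan_mul hT (h g) (ih ⟨g', hg', h1⟩)

/-- Eigenvalues of an even derivation add under multiplication, and a monomial of positive antighost
number contains at least one generator of positive antighost number. -/
theorem Bi_le_eigSpan {T : LocalForms K →ₗ[ℝ] LocalForms K} (hT : T ∈ sder K false)
    (h : ∀ g, gen g ∈ eigSpan T 0) (h1 : ∀ g : Gen K, 1 ≤ g.antigh → gen g ∈ eigSpan T 1)
    {p k : ℤ} (hk : 1 ≤ k) : Bi K p k ≤ eigSpan T 1 := by
  intro x hx
  induction hx using Homog.induction with
  | zero => simp
  | add x y _ _ hx hy => exact add_mem hx hy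
  | smul c x _ hx => exact Submodule.smul_mem _ _ hx
  | prod l hl =>
    apply eigSpan_prod_one hT h
    by_contra! hcon
    have h0 : ∀ g ∈ l, g.antigh = 0 := fun g hg => by
      by_contra h'
      exact hcon g hg (h1 g (Nat.one_le_iff_ne_zero.2 h'))
    rw [sum_bideg, Prod.mk.injEq] at hl
    have : (l.map Gen.antigh).sum = 0 := List.sum_eq_zero (by
      intro x hx
      obtain ⟨g, hg, rfl⟩ := List.mem_map.1 hx
      exact h0 g hg)
    omega

end Calculus
end DualGravity
end

noncomputable section
namespace DualGravity

/-! ### Differential forms: contraction, top degree, volume form -/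

section DiffForms

variable {D : ℕ} {K : CoeffAlgebra D}

/-- Values of the contraction with `∂/∂x^μ` on generators. -/
def contrVal (μ : Fin D) : Gen K → LocalForms K
  | .dx ν => if ν = μ then 1 else 0
  | _ => 0

theorem one_mem_superCentral : (1 : LocalForms K) ∈ superCentral (K := K) false := by
  intro h
  cases h.parity <;> simp [sgn]

theorem contrVal_isDerData (μ : Fin D) : IsDerData true (contrVal (K := K) μ) where
  mem := by
    intro g
    cases g with
    | dx ν =>
      simp only [contrVal]
      split_ifs
      · exact one_mem_superCentral
      · exact zero_mem _
    | _ => exact zero_mem _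
  coef_add f g := by simp [contrVal]
  coef_mul f g := by simp [contrVal]
  coef_const r := rfl
  T_antisymm α β γ I := by simp [contrVal]
  T_cyclic α β γ I := by simp [contrVal]
  S_symm α β I := rfl
  A_antisymm α β I := by simp [contrVal]
  Tst_antisymm α β γ I := by simp [contrVal]
  Tst_cyclic α β γ I := by simp [contrVal]
  Sst_symm α β I := rfl
  Ast_antisymm α β I := by simp [contrVal]

/-- Contraction of local forms with the vector field `∂/∂x^μ`. -/
def contr (μ : Fin D) : LocalForms K →ₗ[ℝ] LocalForms K := superDer (contrVal_isDerData μ)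

theorem contr_mem (μ : Fin D) : contr μ ∈ sder K true := superDer_mem _

theorem total_mem (μ : Fin D) : total μ ∈ sder K false := superDer_mem _

theorem delta_mem : delta ∈ sder K true := superDer_mem _

theorem contr_gen (μ : Fin D) (g : Gen K) : contr μ (gen g) = contrVal μ g := superDer_gen _ g

theorem total_gen (μ : Fin D) (g : Gen K) : total μ (gen g) = totalVal μ g := superDer_gen _ g

theorem total_jet (μ : Fin D) (z : FieldVar D) (I : Fin D →₀ ℕ) :
    total μ (jet z I : LocalForms K) = jet z (I + e μ) := total_gen μ (.jet z I)

theorem delta_gen (g : Gen K) : delta (gen g) = deltaVal g := superDer_gen _ g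

theorem contr_gen_par (μ : Fin D) (g : Gen K) : contr μ (gen g) ∈ Par K (xor g.parity true) := by
  rw [contr_gen]
  cases g with
  | dx ν =>
    simp only [contrVal]
    split_ifs
    · exact Par.one_mem
    · exact zero_mem _
  | _ => exact zero_mem _

theorem total_gen_par (μ : Fin D) (g : Gen K) : total μ (gen g) ∈ Par K (xor g.parity false) := by
  rw [total_gen, Bool.xor_false]
  cases g with
  | coef f => exact Par.gen_mem (.coef (K.deriv μ f))
  | dx ν => exact zero_mem _
  | jet z I => exact Par.gen_mem (.jet z (I + e μ))

theorem contr_total (μ ν : Fin D) (a : LocalForms K) :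
    contr μ (total ν a) = total ν (contr μ a) := by
  have h := sder_commute (contr_mem (K := K) μ) (total_mem ν) (contr_gen_par μ) (total_gen_par ν)
    (fun g => ?_) a
  · simpa [sgn] using h
  · rw [total_gen, contr_gen]
    cases g with
    | coef f => simp [totalVal, contrVal, contr_gen]
    | dx ρ =>
      simp only [totalVal, contrVal, map_zero]
      split_ifs <;> simp [(total_mem (K := K) ν).1]
    | jet z I => simp [totalVal, contrVal, contr_gen, jet]

theorem extd_apply (a : LocalForms K) : extd a = ∑ μ, gen (.dx μ) * total μ a := by
  simp [extd]

/-- Cartan's formula, with `total μ` in the role of the Lie derivative along `∂/∂x^μ`. -/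
theorem contr_extd (μ : Fin D) (a : LocalForms K) :
    contr μ (extd a) + extd (contr μ a) = total μ a := by
  simp only [extd_apply, map_sum, (contr_mem (K := K) μ).2, contr_gen, contrVal, Gen.parity,
    ← Finset.sum_add_distrib, contr_total]
  have h : sgn true true = -1 := rfl
  simp only [h, ite_mul, one_mul, zero_mul, neg_smul, one_smul, neg_add_cancel_right]
  simp

theorem total_Bi (μ : Fin D) {p k : ℤ} {x : LocalForms K} (hx : x ∈ Bi K p k) :
    total μ x ∈ Bi K p k := by
  have h := sder_Bi (c := 0) (c' := 0) (total_mem (K := K) μ) (fun g => ?_) hx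
  · simpa only [add_zero] using h
  · rw [total_gen, add_zero, add_zero]
    cases g with
    | coef f => exact Bi.gen_mem (.coef (K.deriv μ f))
    | dx ν => exact zero_mem _
    | jet z I => exact Bi.gen_mem (.jet z (I + e μ))

theorem Bi.one_mem : (1 : LocalForms K) ∈ Bi K 0 0 := Homog.one_mem (deg := bideg)

theorem contr_Bi (μ : Fin D) {p k : ℤ} {x : LocalForms K} (hx : x ∈ Bi K p k) :
    contr μ x ∈ Bi K (p - 1) k := by
  have h := sder_Bi (c := -1) (c' := 0) (contr_mem (K := K) μ) (fun g => ?_) hx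
  · rw [add_zero, ← sub_eq_add_neg] at h
    exact h
  · rw [contr_gen]
    cases g with
    | dx ν =>
      simp only [contrVal]
      split_ifs
      · simpa [Gen.formDeg, Gen.antigh] using Bi.one_mem
      · exact zero_mem _
    | _ => exact zero_mem _

theorem extd_Bi {p k : ℤ} {x : LocalForms K} (hx : x ∈ Bi K p k) : extd x ∈ Bi K (p + 1) k := by
  rw [extd_apply]
  refine Submodule.sum_mem _ fun μ _ => ?_
  have h := Bi.mul_mem (Bi.gen_mem (K := K) (.dx μ)) (total_Bi μ hx)
  simp only [Gen.formDeg, Gen.antigh, Nat.cast_one, Nat.cast_zero, zero_add] at h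
  rwa [add_comm] at h

/-! ### Products of differentials and the top form degree. -/

/-- A product of differentials. -/
def dxProd (K : CoeffAlgebra D) (s : List (Fin D)) : LocalForms K :=
  (s.map fun μ => gen (.dx μ)).prod

theorem dx_mul_dx (μ ν : Fin D) :
    (gen (.dx μ) * gen (.dx ν) : LocalForms K) = -(gen (.dx ν) * gen (.dx μ)) := by
  rw [gen_supercomm]
  simp [Gen.parity, sgn]

theorem dx_mul_self (μ : Fin D) : (gen (.dx μ) * gen (.dx μ) : LocalForms K) = 0 := by
  have h := dx_mul_dx (K := K) μ μ
  have h2 : (2 : ℝ) • (gen (.dx μ) * gen (.dx μ) : LocalForms K) = 0 := by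
    rw [two_smul]
    nth_rewrite 1 [h]
    exact neg_add_cancel _
  simpa using h2

theorem dx_mul_dxProd_of_mem {μ : Fin D} {s : List (Fin D)} (h : μ ∈ s) :
    gen (.dx μ) * dxProd K s = 0 := by
  induction s with
  | nil => simp at h
  | cons ν s ih =>
    simp only [dxProd, List.map_cons, List.prod_cons] at ih ⊢
    rcases List.mem_cons.1 h with rfl | h
    · rw [← mul_assoc, dx_mul_self, zero_mul]
    · rw [← mul_assoc, dx_mul_dx, neg_mul, mul_assoc, ih h, mul_zero, neg_zero]

theorem dxProd_eq_zero {s : List (Fin D)} (h : ¬ s.Nodup) : dxProd K s = 0 := by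
  induction s with
  | nil => simp at h
  | cons ν s ih =>
    rw [List.nodup_cons, not_and_or, not_not] at h
    rcases h with h | h
    · simpa [dxProd] using dx_mul_dxProd_of_mem (K := K) h
    · have := ih h
      simp only [dxProd, List.map_cons, List.prod_cons] at this ⊢
      rw [this, mul_zero]

theorem dxProd_perm {s t : List (Fin D)} (h : s.Perm t) :
    ∃ c : ℝ, dxProd K s = c • dxProd K t := by
  induction h with
  | nil => exact ⟨1, by simp⟩
  | cons μ _ ih =>
    obtain ⟨c, hc⟩ := ih
    refine ⟨c, ?_⟩
    simp only [dxProd, List.map_cons, List.prod_cons] at hc ⊢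
    rw [hc, mul_smul_comm]
  | swap μ ν s =>
    refine ⟨-1, ?_⟩
    simp only [dxProd, List.map_cons, List.prod_cons, ← mul_assoc]
    rw [dx_mul_dx, neg_mul, neg_smul, one_smul]
  | trans _ _ ih ih' =>
    obtain ⟨c, hc⟩ := ih
    obtain ⟨c', hc'⟩ := ih'
    exact ⟨c * c', by rw [hc, hc', smul_smul]⟩

theorem vol_eq : vol K = dxProd K (List.finRange D) := by
  rw [vol, dxProd, List.ofFn_eq_map]

theorem dxProd_eq_zero_of_lt {s : List (Fin D)} (h : D < s.length) : dxProd K s = 0 := by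
  apply dxProd_eq_zero
  intro hs
  have := hs.length_le_card
  simp at this
  omega

/-- A list of D indices either repeats one, and the product vanishes, or is a permutation of all of
them. -/
theorem dxProd_top {s : List (Fin D)} (h : s.length = D) : ∃ c : ℝ, dxProd K s = c • vol K := by
  by_cases hs : s.Nodup
  · rw [vol_eq]
    apply dxProd_perm
    apply (List.subperm_of_subset hs (fun μ _ => List.mem_finRange μ)).perm_of_length_le
    simp [h]
  · exact ⟨0, by rw [dxProd_eq_zero hs, zero_smul]⟩

theorem dx_mul_prod (μ : Fin D) (l : List (Gen K)) :
    ∃ c : ℝ, gen (.dx μ) * (l.map gen).prod = c • ((l.map gen).prod * gen (.dx μ)) := by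
  induction l with
  | nil => exact ⟨1, by simp⟩
  | cons g l ih =>
    obtain ⟨c, hc⟩ := ih
    refine ⟨sgn (Gen.parity (.dx μ : Gen K)) g.parity * c, ?_⟩
    rw [List.map_cons, List.prod_cons, ← mul_assoc, gen_supercomm, smul_mul_assoc, mul_assoc, hc,
      mul_smul_comm, smul_smul, mul_assoc]

/-- A product of generators is, up to a factor, a product of generators other than the
differentials, followed by a product of differentials. -/
theorem prod_eq_mul_dxProd (l : List (Gen K)) : ∃ (c : ℝ) (m : List (Gen K)) (s : List (Fin D)),
    m ⊆ l ∧ (∀ g ∈ m, g.formDeg = 0) ∧ s.length = (l.map Gen.formDeg).sum ∧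
      (l.map gen).prod = c • ((m.map gen).prod * dxProd K s) := by
  induction l with
  | nil => exact ⟨1, [], [], by simp, by simp, by simp, by simp [dxProd]⟩
  | cons g l ih =>
    obtain ⟨c, m, s, hm, h0, hs, h⟩ := ih
    by_cases hg : g.formDeg = 0
    · refine ⟨c, g :: m, s, List.cons_subset_cons g hm, ?_, by simp [hs, hg], ?_⟩
      · intro g' hg'
        rcases List.mem_cons.1 hg' with rfl | hg'
        · exact hg
        · exact h0 _ hg'
      · simp only [List.map_cons, List.prod_cons, h, mul_smul_comm, mul_assoc]
    · cases g with
      | dx μ =>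
        obtain ⟨c', hc'⟩ := dx_mul_prod μ m
        refine ⟨c * c', m, μ :: s, List.subset_cons_of_subset _ hm, h0, ?_, ?_⟩
        · simp [hs, Gen.formDeg, add_comm]
        · rw [List.map_cons, List.prod_cons, h, mul_smul_comm, ← mul_assoc, hc', smul_mul_assoc,
            smul_smul, mul_assoc]
          simp [dxProd]
      | _ => simp [Gen.formDeg] at hg

theorem Bi_eq_zero {p k : ℤ} (hp : (D : ℤ) < p) {x : LocalForms K} (hx : x ∈ Bi K p k) :
    x = 0 := by
  induction hx using Homog.induction with
  | zero => rfl
  | add x y _ _ hx hy => rw [hx, hy, add_zero]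
  | smul c x _ hx => rw [hx, smul_zero]
  | prod l hl =>
    obtain ⟨c, m, s, -, -, hs, h⟩ := prod_eq_mul_dxProd l
    rw [sum_bideg, Prod.mk.injEq] at hl
    rw [h, dxProd_eq_zero_of_lt (by omega), mul_zero, smul_zero]

/-- In Cartan's formula the other term contains `extd x`, which has form degree D + 1 and therefore
vanishes. -/
theorem total_eq_extd (μ : Fin D) {k : ℤ} {x : LocalForms K} (hx : x ∈ Bi K D k) :
    total μ x = extd (contr μ x) := by
  rw [← contr_extd, Bi_eq_zero (by omega) (extd_Bi hx), map_zero, zero_add]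

/-! ### Total divergences and the volume form. -/

/-- The total divergences of local forms of bidegree `(p, k)`. -/
def Div (K : CoeffAlgebra D) (p k : ℤ) : Submodule ℝ (LocalForms K) :=
  ⨆ μ, (Bi K p k).map (total μ)

theorem Div.total_mem (μ : Fin D) {p k : ℤ} {x : LocalForms K} (hx : x ∈ Bi K p k) :
    total μ x ∈ Div K p k :=
  Submodule.mem_iSup_of_mem μ ⟨x, hx, rfl⟩

theorem Div.exists_extd {k : ℤ} {x : LocalForms K} (hx : x ∈ Div K D k) :
    ∃ n ∈ Bi K (D - 1) k, x = extd n := by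
  have h : Div K D k ≤ (Bi K (D - 1) k).map extd := by
    refine iSup_le fun μ => ?_
    rintro _ ⟨y, hy, rfl⟩
    exact ⟨contr μ y, contr_Bi μ hy, (total_eq_extd μ hy).symm⟩
  obtain ⟨n, hn, h⟩ := h hx
  exact ⟨n, hn, h.symm⟩

theorem vol_Bi : vol K ∈ Bi K D 0 := by
  have h := Homog.prod_mem (deg := bideg) ((List.finRange D).map fun μ => (Gen.dx μ : Gen K))
  have h1 : (((List.finRange D).map fun μ => (Gen.dx μ : Gen K)).map bideg).sum = ((D : ℤ), 0) := by
    rw [sum_bideg]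
    simp [Function.comp_def, Gen.formDeg, Gen.antigh]
  rw [h1, List.map_map] at h
  rw [vol_eq]
  exact h

theorem gen_coef_one : gen (.coef 1) = (1 : LocalForms K) := by
  have h := LocalForms.mk_rel (Rel.coef_const (K := K) 1)
  simpa [gen] using h

theorem gen_coef_algebraMap (r : ℝ) :
    gen (.coef (algebraMap ℝ K.carrier r)) = r • (1 : LocalForms K) := by
  have h := LocalForms.mk_rel (Rel.coef_const (K := K) r)
  rw [AlgHom.commutes, Algebra.algebraMap_eq_smul_one (A := LocalForms K)] at h
  exact h

theorem prod_coef {m : List (Gen K)} (h : ∀ g ∈ m, ∃ f, g = .coef f) :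
    ∃ f, (m.map gen).prod = (gen (.coef f) : LocalForms K) := by
  induction m with
  | nil => exact ⟨1, by simp [gen_coef_one]⟩
  | cons g m ih =>
    obtain ⟨f, hf⟩ := ih fun g hg => h g (List.mem_cons_of_mem _ hg)
    obtain ⟨f', rfl⟩ := h g List.mem_cons_self
    exact ⟨f' * f, by rw [List.map_cons, List.prod_cons, hf, gen_coef_mul]⟩

/-! ### Evaluation at vanishing fields. -/

/-- Evaluation of the coefficient functions at `x` and of all fields at zero. -/
def bgVal (x : Fin D → ℝ) : Gen K → ExteriorAlgebra ℝ (Fin D → ℝ)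
  | .coef f => algebraMap ℝ _ ((f : (Fin D → ℝ) → ℝ) x)
  | .dx μ => ExteriorAlgebra.ι ℝ (Pi.single μ 1)
  | .jet _ _ => 0

theorem bgVal_rel (x : Fin D → ℝ) ⦃a b : FreeAlgebra ℝ (Gen K)⦄ (h : Rel K a b) :
    FreeAlgebra.lift ℝ (bgVal x) a = FreeAlgebra.lift ℝ (bgVal x) b := by
  cases h with
  | supercomm g h =>
    simp only [map_mul, map_smul, FreeAlgebra.lift_ι_apply]
    cases g with
    | coef f => simp [bgVal, Gen.parity, sgn, Algebra.commutes]
    | jet z I => simp [bgVal]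
    | dx μ =>
      cases h with
      | coef f => simp [bgVal, Gen.parity, sgn, Algebra.commutes]
      | jet z I => simp [bgVal]
      | dx ν =>
        have := ExteriorAlgebra.ι_add_mul_swap (R := ℝ) (Pi.single μ 1 : Fin D → ℝ) (Pi.single ν 1)
        simpa [bgVal, Gen.parity, sgn] using eq_neg_of_add_eq_zero_left this
  | coef_add f g => simp [bgVal]
  | coef_mul f g => simp [bgVal]
  | coef_const r => simp only [AlgHom.commutes, FreeAlgebra.lift_ι_apply, bgVal]; rfl
  | _ => simp [bgVal]

/-- The homomorphism evaluating coefficient functions at `x` and all fields at zero. -/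
def bg (x : Fin D → ℝ) : LocalForms K →ₐ[ℝ] ExteriorAlgebra ℝ (Fin D → ℝ) :=
  RingQuot.liftAlgHom ℝ ⟨FreeAlgebra.lift ℝ (bgVal x), bgVal_rel x⟩

theorem bg_gen (x : Fin D → ℝ) (g : Gen K) : bg x (gen g) = bgVal x g := by
  have h := RingQuot.liftAlgHom_mkAlgHom_apply (S := ℝ) (FreeAlgebra.lift ℝ (bgVal x))
    (bgVal_rel (K := K) x) (FreeAlgebra.ι ℝ g)
  rw [FreeAlgebra.lift_ι_apply] at h
  exact h

theorem bg_jet (x : Fin D → ℝ) (z : FieldVar D) (I : Fin D →₀ ℕ) :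
    bg x (jet z I : LocalForms K) = 0 := bg_gen x (.jet z I)

/-- All values of `delta` on generators are linear in the jets, which the evaluation sends to zero.
-/
theorem bg_delta (x : Fin D → ℝ) (a : LocalForms K) : bg x (delta a) = 0 := by
  induction a using LocalForms.induction with
  | one => rw [delta_mem.1, map_zero]
  | add a b ha hb => rw [map_add, map_add, ha, hb, add_zero]
  | smul c a ha => rw [map_smul, map_smul, ha, smul_zero]
  | gen_mul g a ha =>
    rw [delta_mem.2, map_add, map_smul, map_mul, map_mul, ha, mul_zero, smul_zero, add_zero,
      delta_gen]
    suffices h : bg x (deltaVal g) = 0 by rw [h, zero_mul]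
    cases g with
    | jet z I =>
      cases z <;> simp [deltaVal, bg_jet, eom, ricTr, ric, curv, F]
    | _ => simp [deltaVal]

/-- This is where nontriviality enters: the volume form survives in the exterior algebra, where the
determinant detects it. -/
theorem bg_coef_mul_vol (x : Fin D → ℝ) (f : K.carrier)
    (h : bg x (gen (.coef f) * vol K) = 0) : (f : (Fin D → ℝ) → ℝ) x = 0 := by
  have e1 : bg x (vol K) = ExteriorAlgebra.ιMulti ℝ D (fun μ : Fin D => Pi.single μ (1 : ℝ)) := by
    rw [vol, map_list_prod, List.map_ofFn, ExteriorAlgebra.ιMulti_apply]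
    congr 2
    funext μ
    exact bg_gen x (.dx μ)
  rw [map_mul, bg_gen, e1] at h
  simp only [bgVal] at h
  rw [← Algebra.smul_def] at h
  -- The determinant in degree D, extended by zero to the other degrees, defines a functional on the
  -- whole exterior algebra.
  let det : ∀ i, (Fin D → ℝ) [⋀^Fin i]→ₗ[ℝ] ℝ := 
    Pi.single (M := fun i => (Fin D → ℝ) [⋀^Fin i]→ₗ[ℝ] ℝ) D (Pi.basisFun ℝ (Fin D)).det
  have h2 := congrArg (ExteriorAlgebra.liftAlternating (R := ℝ) det) h
  rw [map_smul, ExteriorAlgebra.liftAlternating_apply_ιMulti, map_zero] at h2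
  have h3 : det D (fun μ : Fin D => Pi.single μ (1 : ℝ)) = 1 := by
    simp only [det, Pi.single_eq_same]
    have := (Pi.basisFun ℝ (Fin D)).det_self
    convert this using 2
    funext μ
    simp
  rw [h3] at h2
  simpa using h2

end DiffForms
end DualGravity
end

noncomputable section
namespace DualGravity

/-! ### Constant coefficient differential operators -/

section Operators

variable {D : ℕ} {K : CoeffAlgebra D}

theorem CoeffAlgebra.deriv_comm (μ ν : Fin D) (f : K.carrier) :
    K.deriv μ (K.deriv ν f) = K.deriv ν (K.deriv μ f) := by
  apply Subtype.ext
  funext x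
  have hf : ContDiff ℝ ∞ (f : (Fin D → ℝ) → ℝ) := K.contDiff f f.2
  have hd : Differentiable ℝ (fderiv ℝ (f : (Fin D → ℝ) → ℝ)) :=
    (hf.fderiv_right (m := ∞) (by simp)).differentiable (by simp)
  have key : ∀ ρ τ : Fin D, pd ρ (pd τ (f : (Fin D → ℝ) → ℝ)) x
      = fderiv ℝ (fderiv ℝ (f : (Fin D → ℝ) → ℝ)) x (Pi.single ρ 1) (Pi.single τ 1) := by
    intro ρ τ
    unfold pd
    rw [fderiv_clm_apply hd.differentiableAt (by fun_prop)]
    simp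
  change pd μ (pd ν f) x = pd ν (pd μ f) x
  rw [key, key]
  have hs : IsSymmSndFDerivAt ℝ (f : (Fin D → ℝ) → ℝ) x :=
    (hf.contDiffAt).isSymmSndFDerivAt (by simpa using WithTop.coe_le_coe.2 (le_top (a := (2 : ℕ∞))))
  exact hs _ _

theorem total_comm (μ ν : Fin D) (a : LocalForms K) :
    total μ (total ν a) = total ν (total μ a) := by
  have h := sder_commute (total_mem (K := K) μ) (total_mem ν) (total_gen_par μ) (total_gen_par ν)
    (fun g => ?_) a
  · simpa [sgn] using h
  · have h1 : sgn false false = 1 := rfl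
    rw [total_gen, total_gen, h1, one_smul]
    cases g with
    | coef f => simp [totalVal, total_gen, K.deriv_comm μ ν]
    | dx ρ => simp [totalVal]
    | jet z I => simp only [totalVal, total_jet, add_right_comm]

/-- The commutative algebra of operators generated by the total derivatives. -/
def totalAlg (K : CoeffAlgebra D) : Subalgebra ℝ (Module.End ℝ (LocalForms K)) :=
  Algebra.adjoin ℝ (Set.range total)

instance : IsMulCommutative (totalAlg K) :=
  Algebra.isMulCommutative_adjoin ℝ (by
    rintro _ ⟨μ, rfl⟩ _ ⟨ν, rfl⟩
    exact LinearMap.ext (total_comm μ ν))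

open scoped IsMulCommutative in
/-- The action of polynomials `p(∂)` on local forms. -/
def polyAct (K : CoeffAlgebra D) :
    MvPolynomial (Fin D) ℝ →ₐ[ℝ] Module.End ℝ (LocalForms K) :=
  (totalAlg K).val.comp
    (MvPolynomial.aeval (S₁ := totalAlg K) fun μ =>
      (⟨total μ, Algebra.subset_adjoin ⟨μ, rfl⟩⟩ : totalAlg K))

instance : Module (MvPolynomial (Fin D) ℝ) (LocalForms K) :=
  Module.compHom _ (polyAct K).toRingHom

open MvPolynomial

theorem poly_smul_def (p : MvPolynomial (Fin D) ℝ) (a : LocalForms K) : p • a = polyAct K p a := rfl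

theorem X_smul (μ : Fin D) (a : LocalForms K) :
    (X μ : MvPolynomial (Fin D) ℝ) • a = total μ a := by
  rw [poly_smul_def]
  simp [polyAct]

instance : IsScalarTower ℝ (MvPolynomial (Fin D) ℝ) (LocalForms K) where
  smul_assoc r p a := by rw [poly_smul_def, map_smul]; rfl

theorem C_smul (r : ℝ) (a : LocalForms K) : (C r : MvPolynomial (Fin D) ℝ) • a = r • a := by
  rw [← algebraMap_eq, algebraMap_smul]

instance : SMulCommClass ℝ (MvPolynomial (Fin D) ℝ) (LocalForms K) where
  smul_comm r p a := by rw [← C_smul, ← C_smul, smul_smul, smul_smul, mul_comm]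

theorem poly_induction {motive : MvPolynomial (Fin D) ℝ → Prop}
    (C : ∀ r, motive (C r)) (add : ∀ p q, motive p → motive q → motive (p + q))
    (mul_X : ∀ p μ, motive p → motive (p * X μ)) (p : MvPolynomial (Fin D) ℝ) : motive p :=
  MvPolynomial.induction_on p C add mul_X

theorem map_poly_smul {F : LocalForms K →ₗ[ℝ] LocalForms K}
    (hF : ∀ μ a, F (total μ a) = total μ (F a)) (p : MvPolynomial (Fin D) ℝ) (a : LocalForms K) :
    F (p • a) = p • F a := by
  induction p using poly_induction generalizing a with
  | C r => rw [C_smul, C_smul, map_smul]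
  | add p q hp hq => rw [add_smul, add_smul, map_add, hp, hq]
  | mul_X p μ hp => rw [mul_smul, mul_smul, hp, X_smul, X_smul, hF]

theorem poly_smul_Bi (p : MvPolynomial (Fin D) ℝ) {m k : ℤ} {a : LocalForms K}
    (ha : a ∈ Bi K m k) : p • a ∈ Bi K m k := by
  induction p using poly_induction generalizing a with
  | C r => rw [C_smul]; exact Submodule.smul_mem _ _ ha
  | add p q hp hq => rw [add_smul]; exact add_mem (hp ha) (hq ha)
  | mul_X p μ hp => rw [mul_smul, X_smul]; exact hp (total_Bi μ ha)

theorem monomial_smul_jet (z : FieldVar D) (I J : Fin D →₀ ℕ) :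
    (monomial I (1 : ℝ)) • (jet z J : LocalForms K) = jet z (J + I) := by
  induction I using Finsupp.induction_linear generalizing J with
  | zero => rw [monomial_zero', C_1, one_smul, add_zero]
  | add I I' h h' =>
    rw [← one_mul (1 : ℝ), ← monomial_mul, mul_smul, h', h, add_assoc, add_comm I']
  | single μ n =>
    rw [← X_pow_eq_monomial]
    induction n generalizing J with
    | zero => simp
    | succ n ih =>
      rw [pow_succ', mul_smul, ih, X_smul, total_jet, add_assoc, e, ← Finsupp.single_add]

/-! ### Formal adjoints and integration by parts. -/

/-- The formal adjoint `p(∂) ↦ p(-∂)`. -/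
def reflect : MvPolynomial (Fin D) ℝ →ₐ[ℝ] MvPolynomial (Fin D) ℝ := aeval fun μ => -X μ

theorem reflect_X (μ : Fin D) : reflect (X μ : MvPolynomial (Fin D) ℝ) = -X μ := by
  simp [reflect]

theorem total_mul (μ : Fin D) (x y : LocalForms K) :
    total μ (x * y) = total μ x * y + x * total μ y := sder_even_mul (total_mem μ) x y

theorem integrate_by_parts (p : MvPolynomial (Fin D) ℝ) {m k n l : ℤ} {x y : LocalForms K}
    (hx : x ∈ Bi K m k) (hy : y ∈ Bi K n l) :
    (p • x) * y - x * (reflect p • y) ∈ Div K (m + n) (k + l) := by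
  induction p using poly_induction generalizing x y with
  | C r =>
    have : reflect (C r : MvPolynomial (Fin D) ℝ) = C r := by rw [← algebraMap_eq, AlgHom.commutes]
    rw [this, C_smul, C_smul, smul_mul_assoc, mul_smul_comm, sub_self]
    exact zero_mem _
  | add p q hp hq =>
    rw [map_add, add_smul, add_smul, add_mul, mul_add, add_sub_add_comm]
    exact add_mem (hp hx hy) (hq hx hy)
  | mul_X p μ hp =>
    -- For the factor `X μ` the induction hypothesis is applied to `total μ x`; the divergence of `x
    -- * (reflect p • y)` then moves the last derivative to `y`.
    have h1 := hp (total_Bi μ hx) hy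
    have h2 := Div.total_mem μ (Bi.mul_mem hx (poly_smul_Bi (reflect p) hy))
    rw [total_mul] at h2
    have h3 := add_mem h1 h2
    rw [map_mul, reflect_X, mul_smul, X_smul, mul_comm, mul_smul, neg_smul, X_smul]
    convert h3 using 1
    rw [mul_neg]
    abel

end Operators

/-! ### Sums over the field variables -/

section FieldVars

variable {D : ℕ}

/-- The field variables as a disjoint union of index types. -/
def fieldVarEquiv : FieldVar D ≃
    ((Fin D × Fin D × Fin D) ⊕ (Fin D × Fin D) ⊕ (Fin D × Fin D) ⊕ Fin D) ⊕
      ((Fin D × Fin D × Fin D) ⊕ (Fin D × Fin D) ⊕ (Fin D × Fin D) ⊕ Fin D) where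
  toFun
    | .T α β γ => .inl (.inl (α, β, γ))
    | .S α β => .inl (.inr (.inl (α, β)))
    | .A α β => .inl (.inr (.inr (.inl (α, β))))
    | .C α => .inl (.inr (.inr (.inr α)))
    | .Tst α β γ => .inr (.inl (α, β, γ))
    | .Sst α β => .inr (.inr (.inl (α, β)))
    | .Ast α β => .inr (.inr (.inr (.inl (α, β))))
    | .Cst α => .inr (.inr (.inr (.inr α)))
  invFun
    | .inl (.inl (α, β, γ)) => .T α β γ
    | .inl (.inr (.inl (α, β))) => .S α β
    | .inl (.inr (.inr (.inl (α, β)))) => .A α β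
    | .inl (.inr (.inr (.inr α))) => .C α
    | .inr (.inl (α, β, γ)) => .Tst α β γ
    | .inr (.inr (.inl (α, β))) => .Sst α β
    | .inr (.inr (.inr (.inl (α, β)))) => .Ast α β
    | .inr (.inr (.inr (.inr α))) => .Cst α
  left_inv z := by cases z <;> rfl
  right_inv := by rintro ((_ | _ | _ | _) | (_ | _ | _ | _)) <;> rfl

instance : Fintype (FieldVar D) := Fintype.ofEquiv _ fieldVarEquiv.symm

instance : DecidableEq (FieldVar D) := fieldVarEquiv.decidableEq

theorem sum_fieldVar {M : Type*} [AddCommMonoid M] (f : FieldVar D → M) :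
    ∑ z, f z = ((∑ α, ∑ β, ∑ γ, f (.T α β γ)) + ((∑ α, ∑ β, f (.S α β))
      + ((∑ α, ∑ β, f (.A α β)) + ∑ α, f (.C α))))
      + ((∑ α, ∑ β, ∑ γ, f (.Tst α β γ)) + ((∑ α, ∑ β, f (.Sst α β))
      + ((∑ α, ∑ β, f (.Ast α β)) + ∑ α, f (.Cst α)))) := by
  rw [← fieldVarEquiv.symm.sum_comp]
  simp only [Fintype.sum_sum_type, Fintype.sum_prod_type]
  rfl

end FieldVars
end DualGravity
end

noncomputable section
namespace DualGravity

open MvPolynomial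

/-! ### Tensors with values in a module of differential operators -/

section Tensors

variable {D : ℕ} {N : Type*} [AddCommGroup N] [Module ℝ N] [Module (MvPolynomial (Fin D) ℝ) N]
  [IsScalarTower ℝ (MvPolynomial (Fin D) ℝ) N]

/-- Tensors of hook symmetry: antisymmetric in the first two indices, with vanishing cyclic sum. -/
structure IsHook {ι N : Type*} [AddCommGroup N] (t : ι → ι → ι → N) : Prop where
  antisymm : ∀ α β γ, t α β γ = -t β α γ
  cyclic : ∀ α β γ, t α β γ + t β γ α + t γ α β = 0

/-- The projector onto tensors of hook symmetry. -/
def hookProj {ι N : Type*} [AddCommGroup N] [Module ℝ N] (t : ι → ι → ι → N) (α β γ : ι) : N :=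
  (1 / 6 : ℝ) • ((2 : ℝ) • t α β γ - (2 : ℝ) • t β α γ - t β γ α + t γ β α - t γ α β + t α γ β)

section

variable {ι N : Type*} [AddCommGroup N] [Module ℝ N]

theorem hookProj_isHook (t : ι → ι → ι → N) : IsHook (hookProj t) where
  antisymm α β γ := by unfold hookProj; module
  cyclic α β γ := by unfold hookProj; module

theorem hookProj_eq {t : ι → ι → ι → N} (ht : IsHook t) : hookProj t = t := by
  funext α β γ
  unfold hookProj
  have h1 := ht.antisymm β α γ
  have h2 := ht.antisymm γ β α
  have h3 := ht.antisymm α γ β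
  have h4 := ht.cyclic α β γ
  linear_combination (norm := module) (-1 / 3 : ℝ) • h1 + (1 / 6 : ℝ) • h2 + (1 / 6 : ℝ) • h3
    - (1 / 3 : ℝ) • h4

end

section Sums

variable {M : Type*} [AddCommMonoid M] {ι : Type*} [Fintype ι] (f : ι → ι → ι → M)

theorem sum_213 : ∑ α, ∑ β, ∑ γ, f β α γ = ∑ α, ∑ β, ∑ γ, f α β γ := Finset.sum_comm

theorem sum_132 : ∑ α, ∑ β, ∑ γ, f α γ β = ∑ α, ∑ β, ∑ γ, f α β γ :=
  Finset.sum_congr rfl fun _ _ => Finset.sum_comm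

theorem sum_231 : ∑ α, ∑ β, ∑ γ, f β γ α = ∑ α, ∑ β, ∑ γ, f α β γ := by
  rw [Finset.sum_comm]
  exact sum_132 f

theorem sum_312 : ∑ α, ∑ β, ∑ γ, f γ α β = ∑ α, ∑ β, ∑ γ, f α β γ := by
  rw [← sum_132, sum_213]

theorem sum_321 : ∑ α, ∑ β, ∑ γ, f γ β α = ∑ α, ∑ β, ∑ γ, f α β γ := by
  rw [← sum_231, sum_132]

end Sums

/-- The projector is an element of the group algebra of S₃ that is invariant under inversion: the
two 3-cycles have the same coefficient and the transpositions are their own inverses. -/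
theorem hookProj_adjoint (w : Fin D → Fin D → Fin D → MvPolynomial (Fin D) ℝ)
    (t : Fin D → Fin D → Fin D → N) :
    ∑ α, ∑ β, ∑ γ, hookProj w α β γ • t α β γ = ∑ α, ∑ β, ∑ γ, w α β γ • hookProj t α β γ := by
  have l : ∀ α β γ, hookProj w α β γ • t α β γ = (1 / 6 : ℝ) • ((2 : ℝ) • w α β γ • t α β γ
      - (2 : ℝ) • w β α γ • t α β γ - w β γ α • t α β γ + w γ β α • t α β γ - w γ α β • t α β γ
      + w α γ β • t α β γ) := by
    intro α β γ
    unfold hookProj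
    rw [smul_assoc]
    simp only [add_smul, sub_smul, smul_assoc]
  have r : ∀ α β γ, w α β γ • hookProj t α β γ = (1 / 6 : ℝ) • ((2 : ℝ) • w α β γ • t α β γ
      - (2 : ℝ) • w α β γ • t β α γ - w α β γ • t β γ α + w α β γ • t γ β α - w α β γ • t γ α β
      + w α β γ • t α γ β) := by
    intro α β γ; unfold hookProj; module
  simp only [l, r, Finset.sum_add_distrib, Finset.sum_sub_distrib, ← Finset.smul_sum]
  rw [sum_213 fun α β γ => w α β γ • t β α γ, sum_132 fun α β γ => w α β γ • t α γ β,
    sum_231 fun α β γ => w α β γ • t γ α β, sum_312 fun α β γ => w α β γ • t β γ α,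
    sum_321 fun α β γ => w α β γ • t γ β α]
  module

variable (p : Fin D → MvPolynomial (Fin D) ℝ)

/-- The curl of a tensor on its first two indices, with `∂_μ` replaced by `p μ`. -/
def curl (t : Fin D → Fin D → Fin D → N) (α β γ δ : Fin D) : N :=
  p α • t β γ δ + p β • t γ α δ + p γ • t α β δ

/-- The curvature of a tensor of hook symmetry. -/
def curvature (t : Fin D → Fin D → Fin D → N) (α β δ ε γ : Fin D) : N :=
  (1 / 2 : ℝ) • (p ε • curl p t α β δ γ - p γ • curl p t α β δ ε)

/-- The trace of the curvature. -/
def ricci (t : Fin D → Fin D → Fin D → N) (α β γ : Fin D) : N :=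
  ∑ δ, η δ δ • curvature p t α β δ δ γ

/-- The double trace of the curvature. -/
def ricciTr (t : Fin D → Fin D → Fin D → N) (α : Fin D) : N :=
  ∑ β, η β β • ricci p t α β β

/-- The operator of the equations of motion. -/
def eomOp (t : Fin D → Fin D → Fin D → N) (α β γ : Fin D) : N :=
  (3 : ℝ) • ((η α α * η β β * η γ γ) • ricci p t α β γ
    + (1 / 2 : ℝ) • ((η γ α * η β β) • ricciTr p t β - (η γ β * η α α) • ricciTr p t α))

/-- `p² = η^{μν} p_μ p_ν`. -/
def psq : MvPolynomial (Fin D) ℝ := ∑ δ, η δ δ • (p δ * p δ)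

/-- The divergence on the second index. -/
def divSnd (t : Fin D → Fin D → Fin D → N) (β γ : Fin D) : N := ∑ δ, η δ δ • p δ • t β δ γ

/-- The divergence on the third index. -/
def divThd (t : Fin D → Fin D → Fin D → N) (α β : Fin D) : N := ∑ δ, η δ δ • p δ • t α β δ

/-- The trace on the last two indices. -/
def trThd (t : Fin D → Fin D → Fin D → N) (β : Fin D) : N := ∑ δ, η δ δ • t β δ δ

/-- The divergence of the trace. -/
def divTr (t : Fin D → Fin D → Fin D → N) : N := ∑ β, η β β • p β • trThd t β

/-- The double divergence. -/
def divDiv (t : Fin D → Fin D → Fin D → N) (α : Fin D) : N :=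
  ∑ β, η β β • p β • divSnd p t α β

variable {p}

/-- Sorting the contraction into the wave operator, divergences and traces prepares the proof of
self-adjointness, where each kind of term is paired with its counterpart. -/
theorem two_smul_ricci {t : Fin D → Fin D → Fin D → N} (ht : IsHook t) (α β γ : Fin D) :
    (2 : ℝ) • ricci p t α β γ = psq p • t α β γ + p α • divSnd p t β γ - p β • divSnd p t α γ
      - p γ • (p α • trThd t β - p β • trThd t α + divThd p t α β) := by
  unfold ricci curvature curl psq divSnd trThd divThd
  simp only [Finset.smul_sum, Finset.sum_smul, ← Finset.sum_add_distrib, ← Finset.sum_sub_distrib]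
  refine Finset.sum_congr rfl fun δ _ => ?_
  rw [ht.antisymm δ α γ, ht.antisymm δ α δ, smul_comm (2 : ℝ), smul_smul (2 : ℝ),
    show (2 : ℝ) * (1 / 2) = 1 by norm_num, one_smul, smul_assoc (η δ δ) (p δ * p δ)]
  module

theorem ricciTr_eq {t : Fin D → Fin D → Fin D → N} (ht : IsHook t) (α : Fin D) :
    ricciTr p t α = psq p • trThd t α - p α • divTr p t - divDiv p t α := by
  -- Tracing over the first and third index instead of the second and third costs a sign, by
  -- antisymmetry.
  have h1 : ∑ β, η β β • divSnd p t β β = -divTr p t := by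
    unfold divSnd divTr trThd
    simp only [Finset.smul_sum, ← Finset.sum_neg_distrib]
    rw [Finset.sum_comm]
    refine Finset.sum_congr rfl fun β _ => Finset.sum_congr rfl fun γ _ => ?_
    rw [ht.antisymm γ β γ]
    module
  have h2 : ∑ β, η β β • p β • divThd p t α β = divDiv p t α := by
    unfold divThd divDiv divSnd
    simp only [Finset.smul_sum]
    rw [Finset.sum_comm]
    refine Finset.sum_congr rfl fun β _ => Finset.sum_congr rfl fun γ _ => ?_
    module
  have h : (2 : ℝ) • ricciTr p t α = psq p • trThd t α + p α • ∑ β, η β β • divSnd p t β β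
      - divDiv p t α - (p α • divTr p t - psq p • trThd t α + ∑ β, η β β • p β • divThd p t α β) := by
    have e1 : psq p • trThd t α = ∑ β, (η β β • (p β * p β)) • trThd t α := by
      rw [psq, Finset.sum_smul]
    have e2 : psq p • trThd t α = ∑ β, η β β • psq p • t α β β := by
      rw [trThd, Finset.smul_sum]
      exact Finset.sum_congr rfl fun β _ => by module
    nth_rewrite 1 [e2]
    rw [e1]
    unfold ricciTr divTr divDiv
    simp only [Finset.smul_sum, ← Finset.sum_add_distrib, ← Finset.sum_sub_distrib]
    refine Finset.sum_congr rfl fun β _ => ?_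
    rw [smul_comm (2 : ℝ), two_smul_ricci ht, smul_assoc (η β β) (p β * p β)]
    module
  have h3 : (2 : ℝ) • ricciTr p t α
      = (2 : ℝ) • (psq p • trThd t α - p α • divTr p t - divDiv p t α) := by
    rw [h, h1, h2, two_smul]
    module
  exact smul_right_injective N (two_ne_zero (α := ℝ)) h3

theorem η_sq (α : Fin D) : η α α * η α α = 1 := by
  unfold η
  simp only [if_true]
  split_ifs <;> norm_num

theorem η_ne {α β : Fin D} (h : α ≠ β) : η α β = 0 := if_neg h

/-- The symmetric bilinear form of the equations of motion. -/
def eomForm (p : Fin D → MvPolynomial (Fin D) ℝ)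
    (w t : Fin D → Fin D → Fin D → MvPolynomial (Fin D) ℝ) : MvPolynomial (Fin D) ℝ :=
  psq p * ∑ α, ∑ β, ∑ γ, (η α α * η β β * η γ γ) • (w α β γ * t α β γ)
    - (2 : ℝ) • ∑ α, ∑ β, (η α α * η β β) • (divSnd p w α β * divSnd p t α β)
    - ∑ α, ∑ β, (η α α * η β β) • (divThd p w α β * divThd p t α β)
    + (2 : ℝ) • (∑ α, η α α • (divDiv p w α * trThd t α)
      + ∑ α, η α α • (trThd w α * divDiv p t α))
    - (2 : ℝ) • (psq p * ∑ α, η α α • (trThd w α * trThd t α))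
    + (2 : ℝ) • (divTr p w * divTr p t)

theorem eomForm_comm (w t : Fin D → Fin D → Fin D → MvPolynomial (Fin D) ℝ) :
    eomForm p w t = eomForm p t w := by
  unfold eomForm
  simp only [mul_comm (w _ _ _), mul_comm (divSnd p w _ _), mul_comm (divThd p w _ _),
    mul_comm (divDiv p w _), mul_comm (trThd w _), mul_comm (divTr p w)]
  rw [add_comm (∑ α, η α α • (trThd t α * divDiv p w α))]

/-- All terms are symmetric in `w` and `t` except the last, a double divergence against a trace. Its
mirror image is supplied by the double-trace part of the equations of motion. -/
theorem sum_mul_ricci {w t : Fin D → Fin D → Fin D → MvPolynomial (Fin D) ℝ} (hw : IsHook w)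
    (ht : IsHook t) :
    ∑ α, ∑ β, ∑ γ, (η α α * η β β * η γ γ) • (w α β γ * ((2 : ℝ) • ricci p t α β γ))
    = psq p * ∑ α, ∑ β, ∑ γ, (η α α * η β β * η γ γ) • (w α β γ * t α β γ)
      - (2 : ℝ) • ∑ α, ∑ β, (η α α * η β β) • (divSnd p w α β * divSnd p t α β)
      - ∑ α, ∑ β, (η α α * η β β) • (divThd p w α β * divThd p t α β)
      + (2 : ℝ) • ∑ α, η α α • (divDiv p w α * trThd t α) := by
  have a1 : ∑ α, ∑ β, ∑ γ, (η α α * η β β * η γ γ) • (w α β γ * (p α * divSnd p t β γ))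
      = -∑ α, ∑ β, (η α α * η β β) • (divSnd p w α β * divSnd p t α β) := by
    have : ∀ β γ, divSnd p w β γ = -∑ α, η α α • (p α * w α β γ) := by
      intro β γ
      rw [divSnd, ← Finset.sum_neg_distrib]
      refine Finset.sum_congr rfl fun α _ => ?_
      rw [hw.antisymm β α γ, smul_eq_mul, mul_neg, smul_neg]
    rw [← sum_312]
    rw [← Finset.sum_neg_distrib]
    refine Finset.sum_congr rfl fun β _ => ?_
    rw [← Finset.sum_neg_distrib]
    refine Finset.sum_congr rfl fun γ _ => ?_
    rw [this, neg_mul, smul_neg, neg_neg, Finset.sum_mul, Finset.smul_sum]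
    refine Finset.sum_congr rfl fun α _ => ?_
    simp only [Algebra.smul_def, map_mul]
    ring
  have a2 : ∑ α, ∑ β, ∑ γ, (η α α * η β β * η γ γ) • (w α β γ * (p β * divSnd p t α γ))
      = ∑ α, ∑ β, (η α α * η β β) • (divSnd p w α β * divSnd p t α β) := by
    rw [← sum_132]
    refine Finset.sum_congr rfl fun α _ => Finset.sum_congr rfl fun β _ => ?_
    rw [show divSnd p w α β = ∑ δ, η δ δ • p δ • w α δ β from rfl, Finset.sum_mul, Finset.smul_sum]
    refine Finset.sum_congr rfl fun γ _ => ?_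
    simp only [smul_eq_mul]
    simp only [Algebra.smul_def, map_mul]
    ring
  have a5 : ∑ α, ∑ β, ∑ γ, (η α α * η β β * η γ γ) • (w α β γ * (p γ * divThd p t α β))
      = ∑ α, ∑ β, (η α α * η β β) • (divThd p w α β * divThd p t α β) := by
    refine Finset.sum_congr rfl fun α _ => Finset.sum_congr rfl fun β _ => ?_
    rw [show divThd p w α β = ∑ δ, η δ δ • p δ • w α β δ from rfl, Finset.sum_mul, Finset.smul_sum]
    refine Finset.sum_congr rfl fun γ _ => ?_
    simp only [smul_eq_mul]
    simp only [Algebra.smul_def, map_mul]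
    ring
  have a4 : ∑ α, ∑ β, ∑ γ, (η α α * η β β * η γ γ) • (w α β γ * (p γ * (p β * trThd t α)))
      = ∑ α, η α α • (divDiv p w α * trThd t α) := by
    rw [← sum_132]
    refine Finset.sum_congr rfl fun α _ => ?_
    rw [divDiv, Finset.sum_mul, Finset.smul_sum]
    refine Finset.sum_congr rfl fun β _ => ?_
    rw [divSnd]
    simp only [Finset.smul_sum, Finset.sum_mul]
    refine Finset.sum_congr rfl fun γ _ => ?_
    simp only [smul_eq_mul]
    simp only [Algebra.smul_def, map_mul]
    ring
  have a3 : ∑ α, ∑ β, ∑ γ, (η α α * η β β * η γ γ) • (w α β γ * (p γ * (p α * trThd t β)))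
      = -∑ α, η α α • (divDiv p w α * trThd t α) := by
    rw [← a4, ← sum_213]
    simp only [← Finset.sum_neg_distrib]
    refine Finset.sum_congr rfl fun α _ => Finset.sum_congr rfl fun β _ =>
      Finset.sum_congr rfl fun γ _ => ?_
    rw [hw.antisymm α β γ]
    simp only [Algebra.smul_def, map_mul]
    ring
  have a0 : psq p * ∑ α, ∑ β, ∑ γ, (η α α * η β β * η γ γ) • (w α β γ * t α β γ)
      = ∑ α, ∑ β, ∑ γ, (η α α * η β β * η γ γ) • (w α β γ * (psq p * t α β γ)) := by
    simp only [Finset.mul_sum]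
    refine Finset.sum_congr rfl fun α _ => Finset.sum_congr rfl fun β _ =>
      Finset.sum_congr rfl fun γ _ => ?_
    rw [mul_smul_comm, mul_left_comm]
  have key : ∀ α β γ, (η α α * η β β * η γ γ) • (w α β γ * ((2 : ℝ) • ricci p t α β γ))
      = (η α α * η β β * η γ γ) • (w α β γ * (psq p * t α β γ))
      + (η α α * η β β * η γ γ) • (w α β γ * (p α * divSnd p t β γ))
      - (η α α * η β β * η γ γ) • (w α β γ * (p β * divSnd p t α γ))
      - (η α α * η β β * η γ γ) • (w α β γ * (p γ * (p α * trThd t β)))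
      + (η α α * η β β * η γ γ) • (w α β γ * (p γ * (p β * trThd t α)))
      - (η α α * η β β * η γ γ) • (w α β γ * (p γ * divThd p t α β)) := by
    intro α β γ
    rw [two_smul_ricci ht]
    simp only [smul_eq_mul]
    simp only [Algebra.smul_def, map_mul]
    ring
  simp only [key, Finset.sum_add_distrib, Finset.sum_sub_distrib]
  rw [a1, a2, a3, a4, a5, a0]
  module

theorem sum_mul_ricciTr {w : Fin D → Fin D → Fin D → MvPolynomial (Fin D) ℝ} (hw : IsHook w)
    (r : Fin D → MvPolynomial (Fin D) ℝ) :
    ∑ α, ∑ β, ∑ γ, w α β γ * ((η γ α * η β β) • r β - (η γ β * η α α) • r α)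
    = -((2 : ℝ) • ∑ α, η α α • (trThd w α * r α)) := by
  have b1 : ∑ α, ∑ β, ∑ γ, w α β γ * ((η γ β * η α α) • r α)
      = ∑ α, η α α • (trThd w α * r α) := by
    refine Finset.sum_congr rfl fun α _ => ?_
    rw [trThd, Finset.sum_mul, Finset.smul_sum]
    refine Finset.sum_congr rfl fun β _ => ?_
    rw [Finset.sum_eq_single β]
    · simp only [Algebra.smul_def, map_mul]
      ring
    · intro γ _ h
      rw [η_ne h]
      simp
    · simp
  have b2 : ∑ α, ∑ β, ∑ γ, w α β γ * ((η γ α * η β β) • r β)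
      = -∑ α, η α α • (trThd w α * r α) := by
    rw [← b1, ← sum_213]
    simp only [← Finset.sum_neg_distrib]
    refine Finset.sum_congr rfl fun α _ => Finset.sum_congr rfl fun β _ =>
      Finset.sum_congr rfl fun γ _ => ?_
    rw [hw.antisymm α β γ, neg_mul, neg_neg]
  simp only [mul_sub, Finset.sum_sub_distrib]
  rw [b1, b2]
  module

/-- The trace correction in the equations of motion contributes exactly the missing term `trThd w *
divDiv t`, besides terms that are already symmetric, so the pairing is a symmetric form. -/
theorem sum_mul_eomOp {w t : Fin D → Fin D → Fin D → MvPolynomial (Fin D) ℝ} (hw : IsHook w)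
    (ht : IsHook t) :
    ∑ α, ∑ β, ∑ γ, w α β γ * eomOp p t α β γ = (3 / 2 : ℝ) • eomForm p w t := by
  have key : ∀ α β γ, w α β γ * eomOp p t α β γ
      = (3 / 2 : ℝ) • ((η α α * η β β * η γ γ) • (w α β γ * ((2 : ℝ) • ricci p t α β γ)))
      + (3 / 2 : ℝ) • (w α β γ * ((η γ α * η β β) • ricciTr p t β
        - (η γ β * η α α) • ricciTr p t α)) := by
    intro α β γ
    have e1 : algebraMap ℝ (MvPolynomial (Fin D) ℝ) (1 / 2) * 2 = 1 := by
      rw [← map_ofNat (algebraMap ℝ (MvPolynomial (Fin D) ℝ)) 2, ← map_mul]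
      norm_num
    have e2 : algebraMap ℝ (MvPolynomial (Fin D) ℝ) (3 / 2)
        = 3 * algebraMap ℝ (MvPolynomial (Fin D) ℝ) (1 / 2) := by
      rw [← map_ofNat (algebraMap ℝ (MvPolynomial (Fin D) ℝ)) 3, ← map_mul]
      norm_num
    rw [eomOp]
    simp only [Algebra.smul_def, map_mul, e2, map_ofNat]
    linear_combination (-3 * algebraMap ℝ (MvPolynomial (Fin D) ℝ) (η α α)
      * algebraMap ℝ (MvPolynomial (Fin D) ℝ) (η β β)
      * algebraMap ℝ (MvPolynomial (Fin D) ℝ) (η γ γ) * w α β γ * ricci p t α β γ) * e1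
  simp only [key, Finset.sum_add_distrib, ← Finset.smul_sum]
  rw [sum_mul_ricci hw ht, sum_mul_ricciTr hw, eomForm, ← smul_add]
  congr 1
  have c1 : ∑ α, η α α • (trThd w α * ricciTr p t α)
      = psq p * ∑ α, η α α • (trThd w α * trThd t α) - divTr p w * divTr p t
        - ∑ α, η α α • (trThd w α * divDiv p t α) := by
    rw [divTr, Finset.sum_mul, Finset.mul_sum, ← Finset.sum_sub_distrib, ← Finset.sum_sub_distrib]
    refine Finset.sum_congr rfl fun α _ => ?_
    rw [ricciTr_eq ht]
    simp only [smul_eq_mul]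
    simp only [Algebra.smul_def]
    ring
  rw [c1]
  module

theorem eomOp_symm {w t : Fin D → Fin D → Fin D → MvPolynomial (Fin D) ℝ} (hw : IsHook w)
    (ht : IsHook t) :
    ∑ α, ∑ β, ∑ γ, w α β γ * eomOp p t α β γ = ∑ α, ∑ β, ∑ γ, eomOp p w α β γ * t α β γ := by
  simp only [mul_comm (eomOp p w _ _ _)]
  rw [sum_mul_eomOp hw ht, sum_mul_eomOp ht hw, eomForm_comm]

end Tensors
end DualGravity
end

noncomputable section
namespace DualGravity

open MvPolynomial

/-! ### The equations of motion on tensors with values in a module. -/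

section EomModule

variable {D : ℕ} {N : Type*} [AddCommGroup N] [Module ℝ N] [Module (MvPolynomial (Fin D) ℝ) N]
  [IsScalarTower ℝ (MvPolynomial (Fin D) ℝ) N] {p : Fin D → MvPolynomial (Fin D) ℝ}

theorem curl_antisymm {t : Fin D → Fin D → Fin D → N} (ht : IsHook t) (α β γ δ : Fin D) :
    curl p t α β γ δ = -curl p t β α γ δ := by
  unfold curl
  rw [ht.antisymm β γ δ, ht.antisymm γ α δ, ht.antisymm α β δ]
  module

theorem ricci_antisymm {t : Fin D → Fin D → Fin D → N} (ht : IsHook t) (α β γ : Fin D) :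
    ricci p t α β γ = -ricci p t β α γ := by
  unfold ricci curvature
  rw [← Finset.sum_neg_distrib]
  refine Finset.sum_congr rfl fun δ _ => ?_
  rw [curl_antisymm ht α β δ γ, curl_antisymm ht α β δ δ]
  module

theorem ricci_cyclic {t : Fin D → Fin D → Fin D → N} (ht : IsHook t) (α β γ : Fin D) :
    ricci p t α β γ + ricci p t β γ α + ricci p t γ α β = 0 := by
  unfold ricci
  rw [← Finset.sum_add_distrib, ← Finset.sum_add_distrib]
  refine Finset.sum_eq_zero fun δ _ => ?_
  rw [← smul_add, ← smul_add]
  refine smul_eq_zero_of_right _ ?_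
  unfold curvature curl
  rw [← smul_add, ← smul_add]
  refine smul_eq_zero_of_right _ ?_
  have h := ht.cyclic α β γ
  have a1 := ht.cyclic β δ γ
  have a2 := ht.cyclic γ δ α
  have a3 := ht.cyclic α δ β
  have b1 := ht.antisymm γ β δ
  have b2 := ht.antisymm α γ δ
  have b3 := ht.antisymm β α δ
  have c1 := ht.antisymm β δ δ
  have c2 := ht.antisymm γ δ δ
  have c3 := ht.antisymm α δ δ
  linear_combination (norm := module) (p δ * p δ) • h + (p δ * p α) • a1 + (p δ * p β) • a2
    + (p δ * p γ) • a3 - (p δ * p α) • b1 - (p δ * p β) • b2 - (p δ * p γ) • b3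
    - (p α * p γ) • c1 - (p α * p β) • c2 - (p β * p γ) • c3

theorem eomOp_isHook {t : Fin D → Fin D → Fin D → N} (ht : IsHook t) : IsHook (eomOp p t) where
  antisymm α β γ := by
    unfold eomOp
    rw [ricci_antisymm ht α β γ]
    module
  cyclic α β γ := by
    unfold eomOp
    rw [η_comm γ α, η_comm γ β, η_comm β α]
    linear_combination (norm := module) (3 * (η α α * η β β * η γ γ)) • ricci_cyclic (p := p) ht α β γ

theorem eomOp_add (t u : Fin D → Fin D → Fin D → N) :
    eomOp p (t + u) = eomOp p t + eomOp p u := by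
  have h1 : ∀ α β γ δ, curl p (t + u) α β γ δ = curl p t α β γ δ + curl p u α β γ δ := by
    intro α β γ δ; simp only [curl, Pi.add_apply]; module
  have h2 : ∀ α β γ, ricci p (t + u) α β γ = ricci p t α β γ + ricci p u α β γ := by
    intro α β γ
    unfold ricci curvature
    rw [← Finset.sum_add_distrib]
    refine Finset.sum_congr rfl fun δ _ => ?_
    rw [h1, h1]
    module
  have h3 : ∀ α, ricciTr p (t + u) α = ricciTr p t α + ricciTr p u α := by
    intro α
    simp only [ricciTr, h2, smul_add, Finset.sum_add_distrib]
  funext α β γ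
  simp only [eomOp, h2, h3, Pi.add_apply]
  module

theorem eomOp_zero : eomOp p (0 : Fin D → Fin D → Fin D → N) = 0 := by
  have := eomOp_add (p := p) (0 : Fin D → Fin D → Fin D → N) 0
  simpa using this

theorem eomOp_map {N' : Type*} [AddCommGroup N'] [Module ℝ N'] [Module (MvPolynomial (Fin D) ℝ) N']
    [IsScalarTower ℝ (MvPolynomial (Fin D) ℝ) N'] (f : N →ₗ[MvPolynomial (Fin D) ℝ] N')
    (t : Fin D → Fin D → Fin D → N) (α β γ : Fin D) :
    eomOp p (fun α β γ => f (t α β γ)) α β γ = f (eomOp p t α β γ) := by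
  have hf : ∀ (r : ℝ) n, f (r • n) = r • f n := fun r n => by
    rw [← algebraMap_smul (MvPolynomial (Fin D) ℝ) r n, map_smul, algebraMap_smul]
  simp only [eomOp, ricciTr, ricci, curvature, curl, map_add, map_sub, map_sum, map_smul, hf]

theorem eomOp_sum {ι : Type*} (s : Finset ι) (u : ι → Fin D → Fin D → Fin D → N) :
    eomOp p (∑ i ∈ s, u i) = ∑ i ∈ s, eomOp p (u i) := by
  classical
  induction s using Finset.induction_on with
  | empty => simp [eomOp_zero]
  | insert i s hi ih => rw [Finset.sum_insert hi, Finset.sum_insert hi, eomOp_add, ih]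

/-- The tensor with a single nonvanishing component. -/
def unitTensor (i : Fin D × Fin D × Fin D) (α β γ : Fin D) : MvPolynomial (Fin D) ℝ :=
  (if α = i.1 then 1 else 0) * (if β = i.2.1 then 1 else 0) * (if γ = i.2.2 then 1 else 0)

theorem sum_unitTensor_smul (t : Fin D → Fin D → Fin D → N) (α β γ : Fin D) :
    ∑ i, unitTensor i α β γ • t i.1 i.2.1 i.2.2 = t α β γ := by
  rw [Finset.sum_eq_single (α, β, γ)]
  · simp [unitTensor]
  · rintro ⟨a, b, c⟩ - h
    by_cases h1 : α = a
    · by_cases h2 : β = b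
      · have h3 : γ ≠ c := fun h3 => h (by rw [h1, h2, h3])
        simp [unitTensor, h3]
      · simp [unitTensor, h2]
    · simp [unitTensor, h1]
  · simp

theorem sum_hookProj_unitTensor_smul (t : Fin D → Fin D → Fin D → N) (α β γ : Fin D) :
    ∑ i, hookProj (unitTensor i) α β γ • t i.1 i.2.1 i.2.2 = hookProj t α β γ := by
  unfold hookProj
  simp only [smul_assoc, add_smul, sub_smul, ← Finset.smul_sum, Finset.sum_add_distrib,
    Finset.sum_sub_distrib, sum_unitTensor_smul]

/-- The operator of the equations of motion is formally self-adjoint. -/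
theorem eomOp_adjoint {w : Fin D → Fin D → Fin D → MvPolynomial (Fin D) ℝ} (hw : IsHook w)
    {t : Fin D → Fin D → Fin D → N} (ht : IsHook t) :
    ∑ α, ∑ β, ∑ γ, w α β γ • eomOp p t α β γ = ∑ α, ∑ β, ∑ γ, eomOp p w α β γ • t α β γ := by
  -- Expanding `t` over projected unit tensors puts the module elements outside as scalars'
  -- arguments, which reduces the claim to the polynomial identity `eomOp_symm`.
  have h1 : t = ∑ i : Fin D × Fin D × Fin D,
      fun α β γ => hookProj (unitTensor i) α β γ • t i.1 i.2.1 i.2.2 := by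
    funext α β γ
    rw [Finset.sum_apply, Finset.sum_apply, Finset.sum_apply, sum_hookProj_unitTensor_smul,
      hookProj_eq ht]
  have h2 : ∀ α β γ, eomOp p t α β γ
      = ∑ i : Fin D × Fin D × Fin D, eomOp p (hookProj (unitTensor i)) α β γ • t i.1 i.2.1 i.2.2 := by
    intro α β γ
    nth_rewrite 1 [h1]
    rw [eomOp_sum, Finset.sum_apply, Finset.sum_apply, Finset.sum_apply]
    refine Finset.sum_congr rfl fun i _ => ?_
    exact eomOp_map (LinearMap.toSpanSingleton (MvPolynomial (Fin D) ℝ) N (t i.1 i.2.1 i.2.2))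
      (hookProj (unitTensor i)) α β γ
  have h3 : ∀ i : Fin D × Fin D × Fin D,
      ∑ α, ∑ β, ∑ γ, w α β γ * eomOp p (hookProj (unitTensor i)) α β γ
        = eomOp p w i.1 i.2.1 i.2.2 := by
    intro i
    rw [eomOp_symm hw (hookProj_isHook _)]
    have := hookProj_adjoint (unitTensor i) (eomOp p w)
    simp only [smul_eq_mul, mul_comm (hookProj (unitTensor i) _ _ _),
      mul_comm (unitTensor i _ _ _)] at this
    rw [this, hookProj_eq (eomOp_isHook hw)]
    simp [unitTensor]
  simp only [h2, Finset.smul_sum, smul_smul]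
  calc _ = ∑ i : Fin D × Fin D × Fin D, (∑ α, ∑ β, ∑ γ,
          w α β γ * eomOp p (hookProj (unitTensor i)) α β γ) • t i.1 i.2.1 i.2.2 := by
        simp only [Finset.sum_smul]
        symm
        rw [Finset.sum_comm]
        refine Finset.sum_congr rfl fun α _ => ?_
        rw [Finset.sum_comm]
        refine Finset.sum_congr rfl fun β _ => ?_
        rw [Finset.sum_comm]
    _ = _ := by
        simp only [h3]
        rw [Fintype.sum_prod_type]
        simp only [Fintype.sum_prod_type]

end EomModule
end DualGravity
end

noncomputable section
namespace DualGravity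

open MvPolynomial

/-! ### The linearized Koszul-Tate complex -/

section Linear

variable {D : ℕ} {N : Type*} [AddCommGroup N]

/-- Families indexed by the field variables with the index symmetries of the latter. -/
structure IsSym (t : FieldVar D → N) : Prop where
  T : IsHook fun α β γ => t (.T α β γ)
  S : ∀ α β, t (.S α β) = t (.S β α)
  A : ∀ α β, t (.A α β) = -t (.A β α)
  Tst : IsHook fun α β γ => t (.Tst α β γ)
  Sst : ∀ α β, t (.Sst α β) = t (.Sst β α)
  Ast : ∀ α β, t (.Ast α β) = -t (.Ast β α)

/-- The projector onto families with the index symmetries of the field variables. -/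
def symmetrize [Module ℝ N] (t : FieldVar D → N) : FieldVar D → N
  | .T α β γ => hookProj (fun α β γ => t (.T α β γ)) α β γ
  | .S α β => (1 / 2 : ℝ) • (t (.S α β) + t (.S β α))
  | .A α β => (1 / 2 : ℝ) • (t (.A α β) - t (.A β α))
  | .C α => t (.C α)
  | .Tst α β γ => hookProj (fun α β γ => t (.Tst α β γ)) α β γ
  | .Sst α β => (1 / 2 : ℝ) • (t (.Sst α β) + t (.Sst β α))
  | .Ast α β => (1 / 2 : ℝ) • (t (.Ast α β) - t (.Ast β α))
  | .Cst α => t (.Cst α)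

theorem symmetrize_isSym [Module ℝ N] (t : FieldVar D → N) : IsSym (symmetrize t) where
  T := hookProj_isHook _
  S α β := by simp only [symmetrize, add_comm]
  A α β := by simp only [symmetrize]; module
  Tst := hookProj_isHook _
  Sst α β := by simp only [symmetrize, add_comm]
  Ast α β := by simp only [symmetrize]; module

theorem symmetrize_eq [Module ℝ N] {t : FieldVar D → N} (ht : IsSym t) : symmetrize t = t := by
  funext z
  cases z with
  | T α β γ => simp only [symmetrize, hookProj_eq ht.T]
  | S α β => simp only [symmetrize]; rw [ht.S β α]; module
  | A α β => simp only [symmetrize]; rw [ht.A β α]; module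
  | C α => rfl
  | Tst α β γ => simp only [symmetrize, hookProj_eq ht.Tst]
  | Sst α β => simp only [symmetrize]; rw [ht.Sst β α]; module
  | Ast α β => simp only [symmetrize]; rw [ht.Ast β α]; module
  | Cst α => rfl

variable [Module ℝ N] [Module (MvPolynomial (Fin D) ℝ) N]
  [IsScalarTower ℝ (MvPolynomial (Fin D) ℝ) N]

theorem sum_symm_adjoint (w : Fin D → Fin D → MvPolynomial (Fin D) ℝ) (t : Fin D → Fin D → N) :
    ∑ α, ∑ β, ((1 / 2 : ℝ) • (w α β + w β α)) • t α β
      = ∑ α, ∑ β, w α β • ((1 / 2 : ℝ) • (t α β + t β α)) := by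
  simp only [smul_assoc, smul_add, add_smul, Finset.sum_add_distrib, smul_comm (w _ _) (1 / 2 : ℝ)]
  congr 1
  rw [Finset.sum_comm]

theorem sum_antisymm_adjoint (w : Fin D → Fin D → MvPolynomial (Fin D) ℝ) (t : Fin D → Fin D → N) :
    ∑ α, ∑ β, ((1 / 2 : ℝ) • (w α β - w β α)) • t α β
      = ∑ α, ∑ β, w α β • ((1 / 2 : ℝ) • (t α β - t β α)) := by
  simp only [smul_assoc, smul_sub, sub_smul, Finset.sum_sub_distrib, smul_comm (w _ _) (1 / 2 : ℝ)]
  congr 1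
  rw [Finset.sum_comm]

theorem symmetrize_adjoint (w : FieldVar D → MvPolynomial (Fin D) ℝ) (t : FieldVar D → N) :
    ∑ z, symmetrize w z • t z = ∑ z, w z • symmetrize t z := by
  rw [sum_fieldVar, sum_fieldVar]
  simp only [symmetrize]
  rw [hookProj_adjoint, hookProj_adjoint, sum_symm_adjoint, sum_symm_adjoint, sum_antisymm_adjoint,
    sum_antisymm_adjoint]

theorem sum_single_smul (z : FieldVar D) (t : FieldVar D → N) :
    ∑ z', (Pi.single z 1 : FieldVar D → MvPolynomial (Fin D) ℝ) z' • t z' = t z := by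
  rw [Finset.sum_eq_single z]
  · simp
  · intro z' _ h
    simp [h]
  · simp

/-- The matrix of the projector `symmetrize`. -/
def symMat (z z' : FieldVar D) : MvPolynomial (Fin D) ℝ := symmetrize (Pi.single z 1) z'

theorem sum_symMat_smul (z : FieldVar D) (t : FieldVar D → N) :
    ∑ z', symMat z z' • t z' = symmetrize t z := by
  unfold symMat
  rw [symmetrize_adjoint, sum_single_smul]

/-- The projector is orthogonal, by `symmetrize_adjoint`. -/
theorem symMat_comm (z z' : FieldVar D) : symMat z z' = symMat z' z := by
  have h := sum_symMat_smul z (Pi.single z' 1 : FieldVar D → MvPolynomial (Fin D) ℝ)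
  rw [← symMat, Finset.sum_eq_single z'] at h
  · simpa using h
  · intro b _ hb
    simp [hb]
  · simp

theorem symMat_isSym (z' : FieldVar D) : IsSym fun z => symMat z z' := by
  simp only [symMat_comm _ z']
  exact symmetrize_isSym _

/-- `symmetrize` as a linear operator on polynomial families. -/
def symL : (FieldVar D → MvPolynomial (Fin D) ℝ) →ₗ[MvPolynomial (Fin D) ℝ]
    (FieldVar D → MvPolynomial (Fin D) ℝ) where
  toFun := symmetrize
  map_add' w u := by
    funext z
    cases z <;> simp only [symmetrize, hookProj, Pi.add_apply] <;> module
  map_smul' c w := by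
    funext z
    cases z <;>
      simp only [symmetrize, hookProj, Pi.smul_apply, RingHom.id_apply, smul_comm _ c, smul_add,
        smul_sub]

theorem symL_isSym (w : FieldVar D → MvPolynomial (Fin D) ℝ) : IsSym (symL w) :=
  symmetrize_isSym w

theorem symL_eq {w : FieldVar D → MvPolynomial (Fin D) ℝ} (hw : IsSym w) : symL w = w :=
  symmetrize_eq hw

/-- The Koszul-Tate differential on linear combinations of antifields, for symmetric families. -/
def ktFun (w : FieldVar D → MvPolynomial (Fin D) ℝ) : FieldVar D → MvPolynomial (Fin D) ℝ
  | .T α β γ => eomOp X (fun α β γ => w (.Tst α β γ)) α β γ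
  | .Tst α β γ => hookProj (fun γ α β =>
      -(X γ * ((2 : ℝ) • w (.Sst α β) + (6 : ℝ) • w (.Ast α β)))) α β γ
  | .Sst μ α => (3 : ℝ) • (X μ * w (.Cst α) + X α * w (.Cst μ))
  | .Ast μ α => X μ * w (.Cst α) - X α * w (.Cst μ)
  | _ => 0

theorem ktFun_isSym {w : FieldVar D → MvPolynomial (Fin D) ℝ} (hw : IsSym w) : IsSym (ktFun w) where
  T := eomOp_isHook hw.Tst
  S α β := rfl
  A α β := by simp [ktFun]
  Tst := hookProj_isHook _
  Sst α β := by simp only [ktFun, add_comm]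
  Ast α β := by simp only [ktFun, neg_sub]

/-- The Koszul-Tate differential on linear combinations of antifields. -/
def kt : (FieldVar D → MvPolynomial (Fin D) ℝ) →ₗ[MvPolynomial (Fin D) ℝ]
    (FieldVar D → MvPolynomial (Fin D) ℝ) where
  toFun w := ktFun (symL w)
  map_add' w u := by
    rw [map_add]
    funext z
    cases z with
    | T α β γ =>
      exact congrFun (congrFun (congrFun (eomOp_add (fun α β γ => symL w (.Tst α β γ))
        (fun α β γ => symL u (.Tst α β γ))) α) β) γ
    | Tst α β γ =>
      simp only [ktFun, hookProj, Pi.add_apply, ← smul_eq_mul]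
      module
    | Sst α β => simp only [ktFun, Pi.add_apply, ← smul_eq_mul]; module
    | Ast α β => simp only [ktFun, Pi.add_apply, ← smul_eq_mul]; module
    | _ => simp [ktFun]
  map_smul' c w := by
    rw [map_smul]
    funext z
    cases z with
    | T α β γ =>
      exact eomOp_map (LinearMap.lsmul _ _ c) (fun α β γ => symL w (.Tst α β γ)) α β γ
    | Tst α β γ =>
      simp only [ktFun, hookProj, Pi.smul_apply, RingHom.id_apply, smul_eq_mul, Algebra.smul_def]
      ring
    | Sst α β =>
      simp only [ktFun, Pi.smul_apply, RingHom.id_apply, smul_eq_mul, Algebra.smul_def]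
      ring
    | Ast α β =>
      simp only [ktFun, Pi.smul_apply, RingHom.id_apply, smul_eq_mul]
      ring
    | _ => simp [ktFun]

theorem kt_apply (w : FieldVar D → MvPolynomial (Fin D) ℝ) : kt w = ktFun (symL w) := rfl

theorem kt_isSym (w : FieldVar D → MvPolynomial (Fin D) ℝ) : IsSym (kt w) :=
  ktFun_isSym (symL_isSym w)

theorem symL_kt (w : FieldVar D → MvPolynomial (Fin D) ℝ) : symL (kt w) = kt w :=
  symL_eq (kt_isSym w)

theorem kt_symL (w : FieldVar D → MvPolynomial (Fin D) ℝ) : kt (symL w) = kt w := by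
  rw [kt_apply, symL_eq (symL_isSym w), kt_apply]

theorem kt_of_isSym {w : FieldVar D → MvPolynomial (Fin D) ℝ} (hw : IsSym w) : kt w = ktFun w := by
  rw [kt_apply, symL_eq hw]

theorem eomOp_eq_zero_of_curvature {p : Fin D → MvPolynomial (Fin D) ℝ}
    {t : Fin D → Fin D → Fin D → N} (h : ∀ α β δ ε γ, curvature p t α β δ ε γ = 0) :
    eomOp p t = 0 := by
  funext α β γ
  simp [eomOp, ricciTr, ricci, h]

/-- The pure gauge tensor of hook symmetry built from a tensor with two indices. -/
def gauge (p : Fin D → MvPolynomial (Fin D) ℝ) (u : Fin D → Fin D → MvPolynomial (Fin D) ℝ) :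
    Fin D → Fin D → Fin D → MvPolynomial (Fin D) ℝ :=
  hookProj fun γ α β => -(p γ * u α β)

theorem algebraMap_sixth : algebraMap ℝ (MvPolynomial (Fin D) ℝ) (1 / 6) * 6 = 1 := by
  rw [← map_ofNat (algebraMap ℝ (MvPolynomial (Fin D) ℝ)) 6, ← map_mul]
  norm_num

/-- A gauge tensor is a curl in its first two indices plus `p γ` times an antisymmetric tensor. The
curl drops the first part and turns the second into a multiple of `p` in the last index, which the
final antisymmetrization removes. -/
theorem curvature_gauge (p : Fin D → MvPolynomial (Fin D) ℝ)
    (u : Fin D → Fin D → MvPolynomial (Fin D) ℝ) (α β δ ε γ : Fin D) :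
    curvature p (gauge p u) α β δ ε γ = 0 := by
  unfold curvature curl gauge hookProj
  simp only [smul_eq_mul]
  simp only [Algebra.smul_def, map_ofNat]
  ring

theorem eomOp_gauge (p : Fin D → MvPolynomial (Fin D) ℝ)
    (u : Fin D → Fin D → MvPolynomial (Fin D) ℝ) : eomOp p (gauge p u) = 0 :=
  eomOp_eq_zero_of_curvature (curvature_gauge p u)

/-- The unprojected tensor contains a product of two `p`'s and is symmetric in its first two
indices, so its hook part vanishes. -/
theorem gauge_grad (p c : Fin D → MvPolynomial (Fin D) ℝ) (r : ℝ) :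
    gauge p (fun μ α => r • (p μ * c α)) = 0 := by
  funext α β γ
  unfold gauge hookProj
  simp only [Algebra.smul_def, map_ofNat, Pi.zero_apply]
  ring

/-- On T the square is gauge invariance of the equations of motion; on T* it is the reducibility of
the gauge transformations, `gauge_grad`. -/
theorem kt_kt (w : FieldVar D → MvPolynomial (Fin D) ℝ) : kt (kt w) = 0 := by
  rw [kt_of_isSym (kt_isSym w), kt_apply]
  set u := symL w
  funext z
  cases z with
  | T α β γ =>
    exact congrFun (congrFun (congrFun (eomOp_gauge X
      (fun α β => (2 : ℝ) • u (.Sst α β) + (6 : ℝ) • u (.Ast α β))) α) β) γ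
  | Tst α β γ =>
    -- In `2 S* + 6 A*` both components contribute 6 to the coefficient of the gradient, hence 12,
    -- and the transposed gradients cancel.
    have h := congrFun (congrFun (congrFun (gauge_grad X (fun α => u (.Cst α)) 12) α) β) γ
    simp only [Pi.zero_apply] at h ⊢
    rw [← h]
    simp only [ktFun, gauge, hookProj, Algebra.smul_def, map_ofNat]
    ring
  | Sst α β => simp [ktFun]
  | Ast α β => simp [ktFun]
  | _ => rfl

/-- Restriction of a family to the variables of antighost number `k`. -/
def restr (k : ℕ) : (FieldVar D → MvPolynomial (Fin D) ℝ) →ₗ[MvPolynomial (Fin D) ℝ]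
    (FieldVar D → MvPolynomial (Fin D) ℝ) where
  toFun w z := if z.antigh = k then w z else 0
  map_add' w u := by funext z; simp only [Pi.add_apply]; split_ifs <;> simp
  map_smul' c w := by funext z; simp

theorem restr_apply (k : ℕ) (w : FieldVar D → MvPolynomial (Fin D) ℝ) (z : FieldVar D) :
    restr k w z = if z.antigh = k then w z else 0 := rfl

section Restr

variable (k : ℕ) (w : FieldVar D → MvPolynomial (Fin D) ℝ) (α β γ : Fin D)

theorem restr_T : restr k w (.T α β γ) = if 0 = k then w (.T α β γ) else 0 := rfl

theorem restr_S : restr k w (.S α β) = if 0 = k then w (.S α β) else 0 := rfl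

theorem restr_A : restr k w (.A α β) = if 0 = k then w (.A α β) else 0 := rfl

theorem restr_C : restr k w (.C α) = if 0 = k then w (.C α) else 0 := rfl

theorem restr_Tst : restr k w (.Tst α β γ) = if 1 = k then w (.Tst α β γ) else 0 := rfl

theorem restr_Sst : restr k w (.Sst α β) = if 2 = k then w (.Sst α β) else 0 := rfl

theorem restr_Ast : restr k w (.Ast α β) = if 2 = k then w (.Ast α β) else 0 := rfl

theorem restr_Cst : restr k w (.Cst α) = if 3 = k then w (.Cst α) else 0 := rfl

end Restr

theorem restr_symL (k : ℕ) (w : FieldVar D → MvPolynomial (Fin D) ℝ) :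
    restr k (symL w) = symL (restr k w) := by
  funext z
  change restr k (symmetrize w) z = symmetrize (restr k w) z
  cases z <;> simp only [symmetrize, hookProj, restr_T, restr_S, restr_A, restr_C, restr_Tst,
    restr_Sst, restr_Ast, restr_Cst] <;> split_ifs <;> simp

theorem restr_kt (k : ℕ) (w : FieldVar D → MvPolynomial (Fin D) ℝ) :
    restr k (kt w) = kt (restr (k + 1) w) := by
  rw [kt_apply, kt_apply, ← restr_symL]
  set u := symL w
  funext z
  cases z with
  | T α β γ =>
    simp only [restr_T, restr_Tst, ktFun]
    by_cases hk : k = 0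
    · simp [hk]
    · have h2 : ¬ (1 = k + 1) := by omega
      simp only [if_neg (Ne.symm hk), if_neg h2]
      exact (congrFun (congrFun (congrFun (eomOp_zero (D := D)
        (N := MvPolynomial (Fin D) ℝ)) α) β) γ).symm
  | Tst α β γ =>
    simp only [restr_Tst, restr_Sst, restr_Ast, ktFun, hookProj]
    by_cases hk : k = 1
    · simp [hk]
    · have h2 : ¬ (2 = k + 1) := by omega
      simp [Ne.symm hk, h2]
  | Sst α β =>
    simp only [restr_Sst, restr_Cst, ktFun]
    by_cases hk : k = 2
    · simp [hk]
    · have h2 : ¬ (3 = k + 1) := by omega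
      simp [Ne.symm hk, h2]
  | Ast α β =>
    simp only [restr_Ast, restr_Cst, ktFun]
    by_cases hk : k = 2
    · simp [hk]
    · have h2 : ¬ (3 = k + 1) := by omega
      simp [Ne.symm hk, h2]
  | _ => simp [restr_apply, ktFun]

theorem sum_restr (w : FieldVar D → MvPolynomial (Fin D) ℝ) :
    ∑ k ∈ Finset.range 4, restr k w = w := by
  funext z
  rw [Finset.sum_apply]
  simp only [restr_apply]
  rw [Finset.sum_ite_eq, if_pos]
  cases z <;> simp [FieldVar.antigh]

end Linear

/-! ### Linear combinations of jets -/

section Jets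

variable {D : ℕ} {K : CoeffAlgebra D}

theorem jet_isSym (I : Fin D →₀ ℕ) : IsSym fun z => (jet z I : LocalForms K) where
  T := ⟨fun α β γ => jet_T_antisymm α β γ I, fun α β γ => jet_T_cyclic α β γ I⟩
  S α β := by simpa [gen, jet] using LocalForms.mk_rel (Rel.S_symm (K := K) α β I)
  A α β := by simpa [gen, jet] using LocalForms.mk_rel (Rel.A_antisymm (K := K) α β I)
  Tst := ⟨fun α β γ => by
      simpa [gen, jet] using LocalForms.mk_rel (Rel.Tst_antisymm (K := K) α β γ I),
    fun α β γ => by simpa [gen, jet] using LocalForms.mk_rel (Rel.Tst_cyclic (K := K) α β γ I)⟩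
  Sst α β := by simpa [gen, jet] using LocalForms.mk_rel (Rel.Sst_symm (K := K) α β I)
  Ast α β := by simpa [gen, jet] using LocalForms.mk_rel (Rel.Ast_antisymm (K := K) α β I)

/-- The linear combination of jets with the given polynomial coefficients. -/
def lin (K : CoeffAlgebra D) : (FieldVar D → MvPolynomial (Fin D) ℝ) →ₗ[MvPolynomial (Fin D) ℝ]
    LocalForms K where
  toFun w := ∑ z, w z • jet z 0
  map_add' w u := by simp only [Pi.add_apply, add_smul, Finset.sum_add_distrib]
  map_smul' c w := by
    simp only [Pi.smul_apply, smul_eq_mul, mul_smul, Finset.smul_sum, RingHom.id_apply]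

theorem lin_apply (w : FieldVar D → MvPolynomial (Fin D) ℝ) :
    lin K w = ∑ z, w z • (jet z 0 : LocalForms K) := rfl

theorem lin_symL (w : FieldVar D → MvPolynomial (Fin D) ℝ) : lin K (symL w) = lin K w := by
  rw [lin_apply, lin_apply]
  change ∑ z, symmetrize w z • (jet z 0 : LocalForms K) = _
  rw [symmetrize_adjoint, symmetrize_eq (jet_isSym 0)]

theorem lin_single (z : FieldVar D) (I : Fin D →₀ ℕ) :
    lin K (Pi.single z (monomial I 1)) = jet z I := by
  rw [lin_apply, Finset.sum_eq_single z]
  · rw [Pi.single_eq_same, monomial_smul_jet, zero_add]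
  · intro z' _ h
    rw [Pi.single_eq_of_ne h, zero_smul]
  · simp

theorem deltaVal_jet_add (z : FieldVar D) (I : Fin D →₀ ℕ) (μ : Fin D) :
    deltaVal (.jet z (I + e μ)) = total μ (deltaVal (.jet z I) : LocalForms K) := by
  cases z <;>
    simp only [deltaVal, eom, ricTr, ric, curv, F, map_add, map_sub, map_neg, map_smul, map_sum,
      map_zero, total_jet, add_right_comm I (e μ)] <;>
    simp only [add_right_comm _ (e μ)]

theorem deltaVal_par (g : Gen K) : deltaVal g ∈ Par K (xor g.parity true) := by
  have hj : ∀ (z : FieldVar D) I, (jet z I : LocalForms K) ∈ Par K z.parity :=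
    fun z I => Par.gen_mem (.jet z I)
  cases g with
  | coef f => exact zero_mem _
  | dx μ => exact zero_mem _
  | jet z I =>
    cases z with
    | Tst α β γ =>
      have hT : ∀ α β γ I, (jet (.T α β γ) I : LocalForms K) ∈ Par K false := fun α β γ I =>
        hj (.T α β γ) I
      have hF : ∀ I α β γ δ, (F I α β γ δ : LocalForms K) ∈ Par K false := fun I α β γ δ =>
        Submodule.add_mem _ (Submodule.add_mem _ (hT _ _ _ _) (hT _ _ _ _)) (hT _ _ _ _)
      have hr : ∀ I α β γ, (ric I α β γ : LocalForms K) ∈ Par K false := fun I α β γ =>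
        Submodule.sum_mem _ fun _ _ => Submodule.smul_mem _ _ <|
          Submodule.smul_mem _ _ <| Submodule.sub_mem _ (hF _ _ _ _ _) (hF _ _ _ _ _)
      have ht : ∀ I α, (ricTr I α : LocalForms K) ∈ Par K false := fun I α =>
        Submodule.sum_mem _ fun _ _ => Submodule.smul_mem _ _ (hr _ _ _ _)
      change (eom I α β γ : LocalForms K) ∈ Par K false
      exact Submodule.smul_mem _ _ (Submodule.add_mem _ (Submodule.smul_mem _ _ (hr _ _ _ _))
        (Submodule.smul_mem _ _ (Submodule.sub_mem _ (Submodule.smul_mem _ _ (ht _ _))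
          (Submodule.smul_mem _ _ (ht _ _)))))
    | Sst α β =>
      change _ ∈ Par K true
      rw [deltaVal]
      exact Submodule.neg_mem _ (Submodule.sum_mem _ fun γ _ =>
        Submodule.add_mem _ (hj (.Tst γ α β) _) (hj (.Tst γ β α) _))
    | Ast α β =>
      change _ ∈ Par K true
      rw [deltaVal]
      exact Submodule.smul_mem _ _
        (Submodule.sum_mem _ fun γ _ => Submodule.sub_mem _ (hj (.Tst γ α β) _) (hj (.Tst γ β α) _))
    | Cst α =>
      change _ ∈ Par K false
      rw [deltaVal]
      exact Submodule.add_mem _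
        (Submodule.smul_mem _ _ (Submodule.sum_mem _ fun μ _ => hj (.Sst μ α) _))
        (Submodule.smul_mem _ _ (Submodule.sum_mem _ fun μ _ => hj (.Ast μ α) _))
    | _ => exact zero_mem _

theorem delta_gen_par (g : Gen K) : delta (gen g) ∈ Par K (xor g.parity true) := by
  rw [delta_gen]
  exact deltaVal_par g

theorem delta_total (μ : Fin D) (a : LocalForms K) : delta (total μ a) = total μ (delta a) := by
  have h := sder_commute (delta_mem (K := K)) (total_mem μ) delta_gen_par (total_gen_par μ)
    (fun g => ?_) a
  · simpa [sgn] using h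
  · rw [total_gen, delta_gen]
    have h1 : sgn true false = 1 := rfl
    rw [h1, one_smul]
    cases g with
    | coef f => simp [totalVal, delta_gen, deltaVal]
    | dx ρ => simp [totalVal, deltaVal]
    | jet z I =>
      change delta (gen (.jet z (I + e μ))) = _
      rw [delta_gen, deltaVal_jet_add]

theorem delta_poly_smul (p : MvPolynomial (Fin D) ℝ) (a : LocalForms K) :
    delta (p • a) = p • delta a := map_poly_smul delta_total p a

theorem jet_add_e (z : FieldVar D) (I : Fin D →₀ ℕ) (μ : Fin D) :
    (jet z (I + e μ) : LocalForms K) = (X μ : MvPolynomial (Fin D) ℝ) • jet z I := by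
  rw [X_smul, total_jet]

theorem eom_eq_eomOp (I : Fin D →₀ ℕ) (α β γ : Fin D) :
    (eom I α β γ : LocalForms K) = eomOp X (fun α β γ => (jet (.T α β γ) I : LocalForms K)) α β γ := by
  simp only [eom, ricTr, ric, curv, F, eomOp, ricciTr, ricci, curvature, curl, jet_add_e, smul_add,
    smul_comm (X _ : MvPolynomial (Fin D) ℝ) (X _ : MvPolynomial (Fin D) ℝ)]

/-- The operators are transferred from the jets to the coefficients. No sign of a formal adjoint
arises, because `delta` commutes with polynomials in the derivatives; only the index matrix is
transposed. For T* this is `eomOp_adjoint`, for the other antifields a relabelling of symmetric or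
antisymmetric indices. -/
theorem delta_lin (w : FieldVar D → MvPolynomial (Fin D) ℝ) :
    delta (lin K w) = lin K (kt w) := by
  rw [← lin_symL w, kt_apply]
  have hu := symL_isSym w
  set u := symL w
  have hj := jet_isSym (K := K) 0
  rw [lin_apply, lin_apply, map_sum]
  have h0 : ∀ z, delta (u z • (jet z 0 : LocalForms K)) = u z • deltaVal (.jet z 0) := fun z => by
    rw [delta_poly_smul, jet, delta_gen]
  simp only [h0]
  rw [sum_fieldVar, sum_fieldVar]
  simp only [deltaVal, ktFun, smul_zero, zero_smul, Finset.sum_const_zero, add_zero, zero_add]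
  have hT : ∑ α, ∑ β, ∑ γ, u (.Tst α β γ) • (eom 0 α β γ : LocalForms K)
      = ∑ α, ∑ β, ∑ γ, eomOp X (fun α β γ => u (.Tst α β γ)) α β γ • jet (.T α β γ) 0 := by
    simp only [eom_eq_eomOp]
    exact eomOp_adjoint hu.Tst hj.T
  have hS : ∑ α, ∑ β, ∑ γ, hookProj (fun γ α β =>
      -(X γ * ((2 : ℝ) • u (.Sst α β) + (6 : ℝ) • u (.Ast α β)))) α β γ
        • (jet (.Tst α β γ) 0 : LocalForms K)
      = (∑ α, ∑ β, u (.Sst α β) • -∑ γ, (jet (.Tst γ α β) (0 + e γ)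
          + jet (.Tst γ β α) (0 + e γ) : LocalForms K))
      + ∑ α, ∑ β, u (.Ast α β) • (-(3 : ℝ) • ∑ γ, (jet (.Tst γ α β) (0 + e γ)
          - jet (.Tst γ β α) (0 + e γ) : LocalForms K)) := by
    rw [hookProj_adjoint, hookProj_eq hj.Tst]
    have e1 : ∀ f : Fin D → Fin D → LocalForms K,
        ∑ α, ∑ β, u (.Sst α β) • f β α = ∑ α, ∑ β, u (.Sst α β) • f α β := fun f => by
      rw [Finset.sum_comm]
      refine Finset.sum_congr rfl fun α _ => Finset.sum_congr rfl fun β _ => ?_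
      rw [hu.Sst β α]
    have e2 : ∀ f : Fin D → Fin D → LocalForms K,
        ∑ α, ∑ β, u (.Ast α β) • f β α = -∑ α, ∑ β, u (.Ast α β) • f α β := fun f => by
      rw [Finset.sum_comm]
      simp only [← Finset.sum_neg_distrib]
      refine Finset.sum_congr rfl fun α _ => Finset.sum_congr rfl fun β _ => ?_
      rw [hu.Ast β α, neg_smul]
    have e3 : ∀ α β γ : Fin D, (-(X γ * ((2 : ℝ) • u (.Sst α β) + (6 : ℝ) • u (.Ast α β))))
        • (jet (.Tst γ α β) 0 : LocalForms K)
        = -((2 : ℝ) • u (.Sst α β) • (X γ : MvPolynomial (Fin D) ℝ) • (jet (.Tst γ α β) 0 : LocalForms K))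
        - (6 : ℝ) • u (.Ast α β) • (X γ : MvPolynomial (Fin D) ℝ) • (jet (.Tst γ α β) 0 : LocalForms K) := by
      intro α β γ
      rw [neg_smul, mul_smul, add_smul, smul_add, smul_assoc, smul_assoc,
        smul_comm (X γ : MvPolynomial (Fin D) ℝ), smul_comm (X γ : MvPolynomial (Fin D) ℝ),
        smul_comm (X γ : MvPolynomial (Fin D) ℝ), smul_comm (X γ : MvPolynomial (Fin D) ℝ)]
      abel
    rw [← sum_312]
    simp only [e3, jet_add_e, Finset.sum_add_distrib, Finset.sum_sub_distrib,
      Finset.sum_neg_distrib, ← Finset.smul_sum, smul_neg, smul_add, smul_sub,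
      smul_comm (u _) (-3 : ℝ)]
    rw [e1 fun α β => ∑ γ, (X γ : MvPolynomial (Fin D) ℝ) • (jet (.Tst γ α β) 0 : LocalForms K),
      e2 fun α β => ∑ γ, (X γ : MvPolynomial (Fin D) ℝ) • (jet (.Tst γ α β) 0 : LocalForms K)]
    module
  have hC : ∑ α, u (.Cst α) • ((6 : ℝ) • ∑ μ, (jet (.Sst μ α) (0 + e μ) : LocalForms K)
        + (2 : ℝ) • ∑ μ, jet (.Ast μ α) (0 + e μ))
      = (∑ α, ∑ β, ((3 : ℝ) • (X α * u (.Cst β) + X β * u (.Cst α))) • (jet (.Sst α β) 0 : LocalForms K))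
      + ∑ α, ∑ β, (X α * u (.Cst β) - X β * u (.Cst α)) • (jet (.Ast α β) 0 : LocalForms K) := by
    have e1 : ∑ α, ∑ β, (X β * u (.Cst α)) • (jet (.Sst α β) 0 : LocalForms K)
        = ∑ α, ∑ β, (X α * u (.Cst β)) • (jet (.Sst α β) 0 : LocalForms K) := by
      rw [Finset.sum_comm]
      refine Finset.sum_congr rfl fun α _ => Finset.sum_congr rfl fun β _ => ?_
      rw [hj.Sst α β]
    have e2 : ∑ α, ∑ β, (X β * u (.Cst α)) • (jet (.Ast α β) 0 : LocalForms K)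
        = -∑ α, ∑ β, (X α * u (.Cst β)) • (jet (.Ast α β) 0 : LocalForms K) := by
      rw [Finset.sum_comm]
      simp only [← Finset.sum_neg_distrib]
      refine Finset.sum_congr rfl fun α _ => Finset.sum_congr rfl fun β _ => ?_
      rw [hj.Ast α β, smul_neg, neg_neg]
    simp only [smul_assoc, add_smul, sub_smul, Finset.sum_add_distrib, Finset.sum_sub_distrib,
      ← Finset.smul_sum, smul_add, e1, e2]
    rw [Finset.sum_comm (f := fun α β => (X α * u (.Cst β)) • (jet (.Sst α β) 0 : LocalForms K)),
      Finset.sum_comm (f := fun α β => (X α * u (.Cst β)) • (jet (.Ast α β) 0 : LocalForms K))]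
    simp only [jet_add_e, mul_comm (X _) (u _), mul_smul, ← Finset.smul_sum, smul_comm (u _) (_ : ℝ)]
    module
  simp only [zero_add] at hS hC
  rw [hT, hC, hS]
  abel

end Jets
end DualGravity
end

noncomputable section
namespace DualGravity

open MvPolynomial

/-! ### Exactness of the Koszul complex in low degrees -/

section Koszul

variable {D : ℕ}

/-- The vector of variables `X i`, `i ∈ S`, the other components being zero. -/
def partialX (S : Finset (Fin D)) (i : Fin D) : MvPolynomial (Fin D) ℝ := if i ∈ S then X i else 0

theorem partialX_univ : partialX (Finset.univ : Finset (Fin D)) = X := by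
  funext i; simp [partialX]

theorem partialX_of_mem {S : Finset (Fin D)} {i : Fin D} (h : i ∈ S) : partialX S i = X i :=
  if_pos h

/-- The substitution `X i ↦ 0`. -/
def kill (i : Fin D) : MvPolynomial (Fin D) ℝ →ₐ[ℝ] MvPolynomial (Fin D) ℝ :=
  aeval fun j => if j = i then 0 else X j

theorem kill_X_self (i : Fin D) : kill i (X i : MvPolynomial (Fin D) ℝ) = 0 := by simp [kill]

theorem kill_partialX (S : Finset (Fin D)) (i j : Fin D) :
    kill i (partialX S j) = partialX (S.erase i) j := by
  unfold partialX
  by_cases hj : j ∈ S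
  · by_cases hji : j = i
    · subst hji
      simp [hj, kill]
    · simp [hj, hji, kill]
  · simp [hj]

theorem X_dvd_sub_kill (i : Fin D) (f : MvPolynomial (Fin D) ℝ) : X i ∣ f - kill i f := by
  induction f using poly_induction with
  | C r => simp [kill]
  | add p q hp hq =>
    rw [map_add, add_sub_add_comm]
    exact dvd_add hp hq
  | mul_X p j hp =>
    rw [map_mul]
    by_cases hj : j = i
    · subst hj
      rw [kill_X_self, mul_zero, sub_zero]
      exact Dvd.intro_left p rfl
    · have : kill i (X j : MvPolynomial (Fin D) ℝ) = X j := by simp [kill, hj]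
      rw [this, ← sub_mul]
      exact dvd_mul_of_dvd_left hp _

theorem X_dvd_partialX_sub (S : Finset (Fin D)) (i j : Fin D) :
    X i ∣ partialX S j - partialX (S.erase i) j := by
  rw [← kill_partialX]
  exact X_dvd_sub_kill i _

theorem X_cancel {i : Fin D} {f g : MvPolynomial (Fin D) ℝ} (h : X i * f = X i * g) : f = g :=
  mul_left_cancel₀ (X_ne_zero i) h

theorem koszul_zero {S : Finset (Fin D)} (hS : 1 ≤ S.card) {f : MvPolynomial (Fin D) ℝ}
    (h : ∀ i, partialX S i * f = 0) : f = 0 := by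
  obtain ⟨i, hi⟩ := Finset.card_pos.1 hS
  have := h i
  rw [partialX_of_mem hi] at this
  exact X_cancel (by rw [this, mul_zero])

/-- Setting one variable `X i` to zero lowers the degree of the problem: the component `f i` is
killed by the remaining variables, hence divisible by `X i`, and the quotient is the potential. The
next two lemmas repeat this pattern, each degree using up one more variable. Keeping a subset `S` of
active variables allows the same statements to be used after a variable has been set to zero. -/
theorem koszul_one {S : Finset (Fin D)} (hS : 2 ≤ S.card) {f : Fin D → MvPolynomial (Fin D) ℝ}
    (h : ∀ i j, partialX S i * f j = partialX S j * f i) : ∃ g, ∀ i, f i = partialX S i * g := by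
  obtain ⟨i, hi⟩ := Finset.card_pos.1 (by omega : 0 < S.card)
  have hc : (S.erase i).card = S.card - 1 := Finset.card_erase_of_mem hi
  have h0 : kill i (f i) = 0 := by
    refine koszul_zero (S := S.erase i) (by omega) fun j => ?_
    rw [← kill_partialX, ← map_mul, h j i, map_mul, partialX_of_mem hi, kill_X_self, zero_mul]
  obtain ⟨g, hg⟩ := X_dvd_sub_kill i (f i)
  rw [h0, sub_zero] at hg
  refine ⟨g, fun j => X_cancel (i := i) ?_⟩
  have := h i j
  rw [partialX_of_mem hi] at this
  rw [this, hg]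
  ring

theorem koszul_two {S : Finset (Fin D)} (hS : 3 ≤ S.card)
    {f : Fin D → Fin D → MvPolynomial (Fin D) ℝ} (hf : ∀ i j, f i j = -f j i)
    (h : ∀ i j k, partialX S i * f j k + partialX S j * f k i + partialX S k * f i j = 0) :
    ∃ g : Fin D → MvPolynomial (Fin D) ℝ,
      ∀ i j, f i j = partialX S i * g j - partialX S j * g i := by
  obtain ⟨i, hi⟩ := Finset.card_pos.1 (by omega : 0 < S.card)
  have hc : (S.erase i).card = S.card - 1 := Finset.card_erase_of_mem hi
  have h' : ∀ j k, X i * f j k = partialX S j * f i k - partialX S k * f i j := fun j k => by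
    have := h i j k
    rw [partialX_of_mem hi, hf k i] at this
    linear_combination this
  -- Modulo `X i` the row `f i` is closed in the other variables, hence a gradient. The quotient by
  -- `X i` of the remainder `f i k - partialX S k * g` serves as the potential.
  obtain ⟨g, hg⟩ := koszul_one (S := S.erase i) (by omega) (f := fun k => kill i (f i k)) (by
    intro j k
    have := congrArg (kill i) (h' j k)
    simp only [map_mul, map_sub, kill_X_self, zero_mul, kill_partialX] at this
    linear_combination -this)
  have hd : ∀ k, X i ∣ f i k - partialX S k * g := fun k => by
    have : f i k - partialX S k * g
        = (f i k - kill i (f i k)) - (partialX S k - partialX (S.erase i) k) * g := by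
      rw [hg k]; ring
    rw [this]
    exact dvd_sub (X_dvd_sub_kill i _) (dvd_mul_of_dvd_left (X_dvd_partialX_sub S i k) _)
  choose l hl using hd
  refine ⟨l, fun j k => X_cancel (i := i) ?_⟩
  linear_combination h' j k + partialX S j * hl k - partialX S k * hl j

theorem koszul_three {S : Finset (Fin D)} (hS : 4 ≤ S.card)
    {f : Fin D → Fin D → Fin D → MvPolynomial (Fin D) ℝ} (hf : ∀ i j k, f i j k = -f j i k)
    (hf' : ∀ i j k, f i j k = -f i k j)
    (h : ∀ l i j k, partialX S l * f i j k - partialX S i * f l j k - partialX S j * f i l k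
      - partialX S k * f i j l = 0) :
    ∃ g : Fin D → Fin D → MvPolynomial (Fin D) ℝ, (∀ i j, g i j = -g j i) ∧
      ∀ i j k, f i j k = partialX S i * g j k + partialX S j * g k i + partialX S k * g i j := by
  obtain ⟨i, hi⟩ := Finset.card_pos.1 (by omega : 0 < S.card)
  have hc : (S.erase i).card = S.card - 1 := Finset.card_erase_of_mem hi
  have h' : ∀ j k l, X i * f j k l
      = partialX S j * f i k l + partialX S k * f i l j + partialX S l * f i j k := fun j k l => by
    have := h i j k l
    rw [partialX_of_mem hi, hf j i l, hf' i j l, hf' j k i, hf j i k] at this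
    linear_combination this
  obtain ⟨g, hg⟩ := koszul_two (S := S.erase i) (by omega) (f := fun k l => kill i (f i k l))
    (fun k l => by rw [hf' i k l, map_neg]) (by
      intro j k l
      have := congrArg (kill i) (h' j k l)
      simp only [map_mul, map_add, kill_X_self, zero_mul, kill_partialX] at this
      exact this.symm)
  have hd : ∀ k l, X i ∣ f i k l - (partialX S k * g l - partialX S l * g k) := fun k l => by
    have : f i k l - (partialX S k * g l - partialX S l * g k)
        = (f i k l - kill i (f i k l)) - ((partialX S k - partialX (S.erase i) k) * g l
          - (partialX S l - partialX (S.erase i) l) * g k) := by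
      rw [hg k l]; ring
    rw [this]
    exact dvd_sub (X_dvd_sub_kill i _) (dvd_sub
      (dvd_mul_of_dvd_left (X_dvd_partialX_sub S i k) _)
      (dvd_mul_of_dvd_left (X_dvd_partialX_sub S i l) _))
  choose m hm using hd
  refine ⟨m, fun k l => X_cancel (i := i) ?_, fun j k l => X_cancel (i := i) ?_⟩
  · linear_combination -hm k l - hm l k + hf' i k l
  · linear_combination h' j k l + partialX S j * hm k l + partialX S k * hm l j
      + partialX S l * hm j k

theorem psq_ne_zero {S : Finset (Fin D)} (hS : 1 ≤ S.card) : psq (partialX S) ≠ 0 := by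
  obtain ⟨i, hi⟩ := Finset.card_pos.1 hS
  intro h
  have h1 := congrArg (eval (Pi.single i (1 : ℝ))) h
  rw [psq, map_sum, Finset.sum_eq_single i] at h1
  · rw [partialX_of_mem hi] at h1
    simp only [smul_eval, map_mul, eval_X, Pi.single_eq_same, mul_one, map_zero] at h1
    have := η_sq i
    rw [h1] at this
    norm_num at this
  · intro j _ hj
    unfold partialX
    split_ifs <;> simp [hj]
  · simp

/-! ### Exactness of the complex of polynomial tensors -/

variable {S : Finset (Fin D)}

/-- Contracting the equations of motion with the metric gives the double trace times 3/2 (3 - D), up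
to the sign of the metric component. -/
theorem ricciTr_eq_zero (hD : D ≠ 3) {p : Fin D → MvPolynomial (Fin D) ℝ}
    {w : Fin D → Fin D → Fin D → MvPolynomial (Fin D) ℝ} (h : eomOp p w = 0) (α : Fin D) :
    ricciTr p w α = 0 := by
  have h1 : ∑ β, η β β • eomOp p w α β β = 0 := by
    rw [h]; simp
  have h2 : ∀ β, η β β • eomOp p w α β β = (3 * η α α) • (η β β • ricci p w α β β)
      + (3 / 2 : ℝ) • ((η β α) • ricciTr p w β) - (3 / 2 * η α α) • ricciTr p w α := by
    intro β
    unfold eomOp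
    have e := η_sq β
    have e1 : η β β • (3 : ℝ) • ((η α α * η β β * η β β) • ricci p w α β β
        + (1 / 2 : ℝ) • ((η β α * η β β) • ricciTr p w β - (η β β * η α α) • ricciTr p w α))
        = (3 * η α α * (η β β * η β β)) • (η β β • ricci p w α β β)
        + (3 / 2 * (η β β * η β β)) • ((η β α) • ricciTr p w β)
        - (3 / 2 * η α α * (η β β * η β β)) • ricciTr p w α := by module
    rw [e1, e, mul_one, mul_one, mul_one]
  simp only [h2, Finset.sum_add_distrib, Finset.sum_sub_distrib, ← Finset.smul_sum] at h1
  have h3 : ∑ β, η β α • ricciTr p w β = η α α • ricciTr p w α := by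
    rw [Finset.sum_eq_single α]
    · intro β _ hβ
      rw [η_ne hβ, zero_smul]
    · simp
  rw [← ricciTr, h3, Finset.sum_const, Finset.card_univ, Fintype.card_fin,
    ← Nat.cast_smul_eq_nsmul ℝ] at h1
  have h4 : (3 / 2 * η α α * (3 - (D : ℝ))) • ricciTr p w α = 0 := by
    rw [← h1]; module
  refine (smul_eq_zero.1 h4).resolve_left ?_
  have e := η_sq α
  have hη : η α α ≠ 0 := fun h0 => by rw [h0] at e; norm_num at e
  have hD' : (3 - (D : ℝ)) ≠ 0 := by
    intro h0
    exact hD (by exact_mod_cast (sub_eq_zero.1 h0).symm)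
  positivity

theorem ricci_eq_zero (hD : D ≠ 3) {p : Fin D → MvPolynomial (Fin D) ℝ}
    {w : Fin D → Fin D → Fin D → MvPolynomial (Fin D) ℝ} (h : eomOp p w = 0) (α β γ : Fin D) :
    ricci p w α β γ = 0 := by
  have h1 := congrFun (congrFun (congrFun h α) β) γ
  rw [eomOp, ricciTr_eq_zero hD h, ricciTr_eq_zero hD h] at h1
  simp only [smul_zero, sub_zero, add_zero, Pi.zero_apply] at h1
  rw [smul_smul] at h1
  refine (smul_eq_zero.1 h1).resolve_left ?_
  have hη : ∀ α : Fin D, η α α ≠ 0 := fun α h0 => by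
    have e := η_sq α
    rw [h0] at e
    norm_num at e
  have := hη α
  have := hη β
  have := hη γ
  positivity

/-- Contracting the Bianchi identity of the curl with `p` produces `psq p` times the curl and three
divergences; vanishing of the Ricci tensor turns each divergence into `p γ` times a trace. -/
theorem psq_mul_curl {p : Fin D → MvPolynomial (Fin D) ℝ}
    {w : Fin D → Fin D → Fin D → MvPolynomial (Fin D) ℝ} (hw : IsHook w)
    (h : ∀ α β γ, ricci p w α β γ = 0) (α β δ γ : Fin D) :
    psq p * curl p w α β δ γ = p γ * (p α * (∑ l, η l l • curl p w β δ l l)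
      + p β * (∑ l, η l l • curl p w δ α l l) + p δ * (∑ l, η l l • curl p w α β l l)) := by
  have h1 : ∀ α β γ, ∑ l, η l l • (p l * curl p w α β l γ)
      = p γ * ∑ l, η l l • curl p w α β l l := by
    intro α β γ
    have h0 : (2 : ℝ) • ricci p w α β γ = 0 := by rw [h, smul_zero]
    rw [← sub_eq_zero, ← h0]
    unfold ricci curvature
    simp only [Finset.mul_sum, Finset.smul_sum, ← Finset.sum_sub_distrib]
    refine Finset.sum_congr rfl fun l _ => ?_
    rw [smul_comm (2 : ℝ), smul_smul (2 : ℝ), show (2 : ℝ) * (1 / 2) = 1 by norm_num, one_smul,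
      smul_sub, mul_smul_comm, smul_eq_mul, smul_eq_mul]
  have h2 : psq p * curl p w α β δ γ = p α * (∑ l, η l l • (p l * curl p w β δ l γ))
      + p β * (∑ l, η l l • (p l * curl p w δ α l γ))
      + p δ * (∑ l, η l l • (p l * curl p w α β l γ)) := by
    unfold psq
    simp only [Finset.mul_sum, Finset.sum_mul, ← Finset.sum_add_distrib]
    refine Finset.sum_congr rfl fun l _ => ?_
    unfold curl
    rw [hw.antisymm l β γ, hw.antisymm l δ γ, hw.antisymm l α γ]
    simp only [smul_eq_mul]
    simp only [Algebra.smul_def]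
    ring
  rw [h2, h1, h1, h1]
  ring

/-- Successive potentials are extracted with the Koszul lemmas: the curl is `p γ` times a closed
three-form G, G has a two-form potential H, each slice `w - p γ * H` has a one-form potential U, and
the cyclic identity ties H to U up to one further potential k. -/
theorem exists_gauge (hD : D ≠ 3) (hS : 4 ≤ S.card)
    {w : Fin D → Fin D → Fin D → MvPolynomial (Fin D) ℝ} (hw : IsHook w)
    (h : eomOp (partialX S) w = 0) : ∃ u, w = gauge (partialX S) u := by
  set p := partialX S with hp
  have hcurl : ∀ α β δ, ∃ g, ∀ γ, curl p w α β δ γ = p γ * g := by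
    intro α β δ
    refine koszul_one (by omega) fun ε γ => ?_
    -- After multiplication by `psq p`, the curl is visibly proportional to `p` in its last index.
    apply mul_left_cancel₀ (psq_ne_zero (S := S) (by omega))
    have e1 := psq_mul_curl hw (ricci_eq_zero hD h) α β δ γ
    have e2 := psq_mul_curl hw (ricci_eq_zero hD h) α β δ ε
    linear_combination p ε * e1 - p γ * e2
  choose G hG using hcurl
  have hz : ∀ {f : MvPolynomial (Fin D) ℝ}, (∀ γ, p γ * f = 0) → f = 0 :=
    fun hf => koszul_zero (by omega) hf
  have hG1 : ∀ α β δ, G α β δ = -G β α δ := fun α β δ => by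
    refine eq_neg_of_add_eq_zero_left (hz fun γ => ?_)
    rw [mul_add, ← hG, ← hG, curl_antisymm hw]
    ring
  have hG2 : ∀ α β δ, G α β δ = -G α δ β := fun α β δ => by
    refine eq_neg_of_add_eq_zero_left (hz fun γ => ?_)
    rw [mul_add, ← hG, ← hG]
    unfold curl
    rw [hw.antisymm δ β, hw.antisymm δ α, hw.antisymm β α]
    simp only [smul_eq_mul]
    ring
  -- Closedness of G follows from the vanishing of the double curl, after multiplying by an
  -- arbitrary `p γ`.
  obtain ⟨H, hH, hGH⟩ := koszul_three hS hG1 hG2 (fun l i j k => hz fun γ => by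
    have e1 := hG i j k γ
    have e2 := hG l j k γ
    have e3 := hG i l k γ
    have e4 := hG i j l γ
    unfold curl at e1 e2 e3 e4
    simp only [smul_eq_mul] at e1 e2 e3 e4
    have a1 := hw.antisymm j i γ
    have a2 := hw.antisymm k i γ
    have a3 := hw.antisymm l i γ
    have a4 := hw.antisymm k j γ
    have a5 := hw.antisymm l j γ
    have a6 := hw.antisymm l k γ
    rw [← hp]
    linear_combination -p l * e1 + p i * e2 + p j * e3 + p k * e4
      - p i * p j * a6 - p i * p k * a5 - p j * p k * a3)
  have hU : ∀ γ, ∃ U : Fin D → MvPolynomial (Fin D) ℝ,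
      ∀ β δ, w β δ γ - p γ * H β δ = p β * U δ - p δ * U β := by
    intro γ
    refine koszul_two (by omega) (fun i j => ?_) fun i j k => ?_
    · linear_combination hw.antisymm i j γ - p γ * hH i j
    · have e1 := hG i j k γ
      rw [hGH] at e1
      unfold curl at e1
      simp only [smul_eq_mul] at e1
      linear_combination e1
  choose U hU using hU
  -- The cyclic identity of `w` says precisely that this two-form is closed.
  obtain ⟨k, hk⟩ := koszul_two (S := S) (by omega)
    (f := fun β δ => H β δ + (U δ β - U β δ)) (fun i j => by linear_combination hH i j)
    fun i j l => by
      have e1 := hU l i j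
      have e2 := hU i j l
      have e3 := hU j l i
      linear_combination hw.cyclic i j l - e1 - e2 - e3
  -- Eliminating H leaves `w` expressed by U and k alone; these coefficients match that expression
  -- under the normalization 1/6 of `hookProj`.
  refine ⟨fun δ γ => -4 * U γ δ + 2 * U δ γ - 2 * p γ * k δ, ?_⟩
  funext β δ γ
  have e := algebraMap_sixth (D := D)
  unfold gauge hookProj
  simp only [Algebra.smul_def, map_ofNat]
  have e1 := hU γ β δ
  have e2 := hk β δ
  rw [← hp] at e2
  linear_combination e1 + p γ * e2
    + (p γ * ((U β δ - U δ β) + p β * k δ - p δ * k β) + p β * U γ δ - p δ * U γ β) * (-e)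

/-- The hypothesis equates three times the curl of `u` in its first index with the totally
antisymmetric curl Y of `u`. Taking another curl annihilates the left side, and closedness of Y
turns the right side into `p γ * Y`, so Y vanishes. Each column of `u` is then closed. -/
theorem exists_grad (hS : 4 ≤ S.card) {u : Fin D → Fin D → MvPolynomial (Fin D) ℝ}
    (h : gauge (partialX S) u = 0) : ∃ c : Fin D → MvPolynomial (Fin D) ℝ, ∀ α β, u α β = partialX S α * c β := by
  set p := partialX S with hp
  have hz : ∀ {f : MvPolynomial (Fin D) ℝ}, (∀ γ, p γ * f = 0) → f = 0 :=
    fun hf => koszul_zero (by omega) hf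
  set Y : Fin D → Fin D → Fin D → MvPolynomial (Fin D) ℝ := fun α β γ =>
    p α * (u β γ - u γ β) + p β * (u γ α - u α γ) + p γ * (u α β - u β α) with hY
  have h1 : ∀ α β γ, 3 * (p α * u β γ - p β * u α γ) = Y α β γ := by
    intro α β γ
    have := congrFun (congrFun (congrFun h α) β) γ
    simp only [gauge, hookProj, Algebra.smul_def, map_ofNat, Pi.zero_apply] at this
    have e := algebraMap_sixth (D := D)
    rw [hY]
    linear_combination (-6) * this + (-(2 * (p α * u β γ)) + 2 * (p β * u α γ) + p β * u γ α
      - p γ * u β α + p γ * u α β - p α * u γ β) * e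
  have h2 : ∀ α β δ, Y α β δ = 0 := fun α β δ => hz fun γ => by
    have e1 := h1 α β γ
    have e2 := h1 β δ γ
    have e3 := h1 δ α γ
    simp only [hY] at e1 e2 e3 ⊢
    linear_combination -p δ * e1 - p α * e2 - p β * e3
  have h3 : ∀ β, ∃ c, ∀ α, u α β = p α * c := fun β => by
    refine koszul_one (by omega) fun i j => ?_
    have := h1 i j β
    rw [h2] at this
    have h3 : (3 : MvPolynomial (Fin D) ℝ) ≠ 0 := by norm_num
    exact sub_eq_zero.1 ((mul_eq_zero.1 this).resolve_left h3)
  choose c hc using h3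
  exact ⟨c, fun α β => hc β α⟩

end Koszul
end DualGravity
end

noncomputable section
namespace DualGravity

open MvPolynomial

/-! ### The cokernel of the equations of motion as a module over one derivative -/

section Cokernel

variable {D : ℕ}

theorem algHom_eomOp (φ : MvPolynomial (Fin D) ℝ →ₐ[ℝ] MvPolynomial (Fin D) ℝ)
    (p : Fin D → MvPolynomial (Fin D) ℝ) (t : Fin D → Fin D → Fin D → MvPolynomial (Fin D) ℝ)
    (α β γ : Fin D) :
    φ (eomOp p t α β γ) = eomOp (fun α => φ (p α)) (fun α β γ => φ (t α β γ)) α β γ := by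
  simp only [eomOp, ricciTr, ricci, curvature, curl, map_add, map_sub, map_sum, map_smul,
    smul_eq_mul, map_mul]

theorem eomOp_smul (p : Fin D → MvPolynomial (Fin D) ℝ) (c : MvPolynomial (Fin D) ℝ)
    (t : Fin D → Fin D → Fin D → MvPolynomial (Fin D) ℝ) : eomOp p (c • t) = c • eomOp p t := by
  funext α β γ
  exact eomOp_map (LinearMap.lsmul _ _ c) t α β γ

theorem gauge_isHook (p : Fin D → MvPolynomial (Fin D) ℝ)
    (u : Fin D → Fin D → MvPolynomial (Fin D) ℝ) : IsHook (gauge p u) :=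
  hookProj_isHook _

theorem IsHook.sub {ι N : Type*} [AddCommGroup N] {t u : ι → ι → ι → N} (ht : IsHook t)
    (hu : IsHook u) : IsHook (t - u) where
  antisymm α β γ := by
    simp only [Pi.sub_apply]
    rw [ht.antisymm, hu.antisymm]
    abel
  cyclic α β γ := by
    simp only [Pi.sub_apply]
    have h1 := ht.cyclic α β γ
    have h2 := hu.cyclic α β γ
    rw [← sub_zero 0]
    nth_rw 1 [← h1]
    rw [← h2]
    abel

theorem X_dvd_gauge_sub (i : Fin D) (u : Fin D → Fin D → MvPolynomial (Fin D) ℝ) (α β γ : Fin D) :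
    X i ∣ gauge X u α β γ - gauge (partialX (Finset.univ.erase i)) u α β γ := by
  have h : ∀ j (f : MvPolynomial (Fin D) ℝ),
      ∃ g, X j * f = partialX (Finset.univ.erase i) j * f + X i * g := fun j f => by
    obtain ⟨c, hc⟩ := X_dvd_partialX_sub Finset.univ i j
    rw [partialX_univ] at hc
    exact ⟨c * f, by linear_combination f * hc⟩
  choose g hg using h
  unfold gauge hookProj
  simp only [Algebra.smul_def, map_ofNat]
  refine ⟨algebraMap ℝ _ (1 / 6) * (-2 * g α (u β γ) + 2 * g β (u α γ) + g β (u γ α) - g γ (u β α)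
    + g γ (u α β) - g α (u γ β)), ?_⟩
  linear_combination algebraMap ℝ (MvPolynomial (Fin D) ℝ) (1 / 6) * (-2 * hg α (u β γ)
    + 2 * hg β (u α γ) + hg β (u γ α) - hg γ (u β α) + hg γ (u α β) - hg α (u γ β))

/-- Multiplication by a variable is injective on the cokernel of the equations of motion. -/
theorem eomOp_range_of_X_smul (hD : 4 < D) (i : Fin D)
    {t w : Fin D → Fin D → Fin D → MvPolynomial (Fin D) ℝ} (hw : IsHook w)
    (h : (X i : MvPolynomial (Fin D) ℝ) • t = eomOp X w) : ∃ w', IsHook w' ∧ t = eomOp X w' := by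
  have hS : 4 ≤ (Finset.univ.erase i).card := by
    rw [Finset.card_erase_of_mem (Finset.mem_univ i), Finset.card_univ, Fintype.card_fin]
    omega
  -- At `X i = 0` the tensor `w` solves the equations of motion in the remaining D - 1 ≥ 4 variables
  -- and is pure gauge there. Using the same `u` with all variables gives a gauge tensor congruent
  -- to `w` modulo `X i`; subtracting it does not change `eomOp X w`, and `X i` can be divided out.
  obtain ⟨u, hu⟩ := exists_gauge (w := fun α β γ => kill i (w α β γ)) (by omega) hS
    ⟨fun α β γ => by rw [hw.antisymm, map_neg],
      fun α β γ => by rw [← map_add, ← map_add, hw.cyclic, map_zero]⟩ (by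
      funext α β γ
      have h1 := congrArg (kill i) (congrFun (congrFun (congrFun h α) β) γ)
      rw [algHom_eomOp, Pi.smul_apply, Pi.smul_apply, Pi.smul_apply, smul_eq_mul, map_mul,
        kill_X_self, zero_mul] at h1
      rw [Pi.zero_apply, Pi.zero_apply, Pi.zero_apply, h1]
      congr 1
      funext j
      rw [← kill_partialX, partialX_univ])
  have hd : ∀ α β γ, X i ∣ w α β γ - gauge X u α β γ := fun α β γ => by
    have h1 := dvd_sub (X_dvd_sub_kill i (w α β γ)) (X_dvd_gauge_sub i u α β γ)
    rw [← hu] at h1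
    convert h1 using 1
    ring
  choose w' hw' using hd
  have hw'' : w - gauge X u = (X i : MvPolynomial (Fin D) ℝ) • w' := by
    funext α β γ
    exact hw' α β γ
  have hk : IsHook w' := by
    have h1 := hw.sub (gauge_isHook X u)
    rw [hw''] at h1
    exact ⟨fun α β γ => X_cancel (i := i) (by
        rw [mul_neg]; exact h1.antisymm α β γ),
      fun α β γ => X_cancel (i := i) (by
        rw [mul_zero, mul_add, mul_add]; exact h1.cyclic α β γ)⟩
  refine ⟨w', hk, ?_⟩
  have h1 : (X i : MvPolynomial (Fin D) ℝ) • t = (X i : MvPolynomial (Fin D) ℝ) • eomOp X w' := by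
    rw [h, ← eomOp_smul, ← hw'', ← add_zero (eomOp X (w - gauge X u)), ← eomOp_gauge X u,
      ← eomOp_add, sub_add_cancel]
  funext α β γ
  exact X_cancel (congrFun (congrFun (congrFun h1 α) β) γ)

/-! ### Projectors commuting with one derivative. -/

/-- An injective graded endomorphism of the quotient of a graded vector space by a graded subspace
commutes with some projector along this subspace. -/
theorem exists_equivariant_projector {M : Type*} [AddCommGroup M] [Module ℝ M] (x : M →ₗ[ℝ] M)
    (c : ℕ → M →ₗ[ℝ] M) (hfin : ∀ t, (Function.support fun n => c n t).Finite)
    (hsum : ∀ t, ∑ᶠ n, c n t = t) (hc0 : ∀ t, c 0 (x t) = 0)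
    (hc : ∀ n t, c (n + 1) (x t) = x (c n t)) (B : Submodule ℝ M)
    (hB : ∀ n, ∀ b ∈ B, c n b ∈ B) (hx : ∀ b ∈ B, x b ∈ B) (hinj : ∀ t, x t ∈ B → t ∈ B) :
    ∃ π : M →ₗ[ℝ] M, (∀ t, π (x t) = x (π t)) ∧ (∀ b ∈ B, π b = 0) ∧ ∀ t, t - π t ∈ B := by
  obtain ⟨s₀, hs₀⟩ := LinearMap.exists_rightInverse_of_surjective B.mkQ (Submodule.range_mkQ B)
  let y : M ⧸ B →ₗ[ℝ] M ⧸ B := B.mapQ B x hx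
  have hyinj : LinearMap.ker y = ⊥ := by
    rw [LinearMap.ker_eq_bot']
    intro m hm
    obtain ⟨t, rfl⟩ := B.mkQ_surjective m
    have h1 : B.mkQ (x t) = 0 := hm
    rw [Submodule.mkQ_apply, Submodule.Quotient.mk_eq_zero] at h1
    rw [Submodule.mkQ_apply, Submodule.Quotient.mk_eq_zero]
    exact hinj t h1
  obtain ⟨l, hl⟩ := LinearMap.exists_leftInverse_of_injective y hyinj
  have hl' : ∀ m, l (y m) = m := fun m => LinearMap.congr_fun hl m
  -- One section of the quotient map is built for each degree. In degree n + 1 it is `x ∘ s n`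
  -- transported along the range of `y` by the left inverse `l`, and the arbitrary section `s₀` on
  -- the complement; thus `s (n + 1) ∘ y = x ∘ s n`.
  let s : ℕ → (M ⧸ B →ₗ[ℝ] M) := fun n => Nat.rec s₀
    (fun _ s => x ∘ₗ s ∘ₗ l + s₀ ∘ₗ (LinearMap.id - y ∘ₗ l)) n
  have hs₀' : ∀ m, B.mkQ (s₀ m) = m := fun m => LinearMap.congr_fun hs₀ m
  have hyx : ∀ t, B.mkQ (x t) = y (B.mkQ t) := fun t => rfl
  have hsucc : ∀ n m, s (n + 1) m = x (s n (l m)) + s₀ (m - y (l m)) := fun n m => rfl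
  have hs : ∀ n m, B.mkQ (s n m) = m := by
    intro n
    induction n with
    | zero => exact hs₀'
    | succ n ih =>
      intro m
      rw [hsucc, map_add, hyx, ih, hs₀']
      abel
  have hsx : ∀ n m, s (n + 1) (y m) = x (s n m) := fun n m => by
    rw [hsucc, hl', sub_self, map_zero, add_zero]
  have hsupp : ∀ t, (Function.support fun n => s n (B.mkQ (c n t))).Finite := fun t =>
    (hfin t).subset fun n hn h0 => hn (by
      change c n t = 0 at h0
      simp only [h0, map_zero])
  refine ⟨{ toFun := fun t => ∑ᶠ n, s n (B.mkQ (c n t)), map_add' := ?_, map_smul' := ?_ },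
    fun t => ?_, fun b hb => ?_, fun t => ?_⟩
  · intro t u
    simp only [map_add]
    exact finsum_add_distrib (hsupp t) (hsupp u)
  · intro r t
    simp only [map_smul, RingHom.id_apply]
    exact (smul_finsum r fun n => s n (B.mkQ (c n t))).symm
  · change ∑ᶠ n, s n (B.mkQ (c n (x t))) = x (∑ᶠ n, s n (B.mkQ (c n t)))
    obtain ⟨N, hN⟩ := (hfin t).bddAbove
    have h0 : ∀ n, N + 1 ≤ n → c n t = 0 := fun n hn => by
      by_contra h
      have := hN h
      omega
    -- Since `x` raises the degree by one, the left sum needs one more term; its degree-zero term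
    -- vanishes and the others match after a shift.
    rw [finsum_eq_sum_of_support_subset (s := Finset.range (N + 2)),
      finsum_eq_sum_of_support_subset (s := Finset.range (N + 1)), Finset.sum_range_succ', map_sum]
    · simp only [hc, hc0, hyx, hsx, map_zero, add_zero]
    · intro n hn
      by_contra h
      refine hn ?_
      simp only [Finset.coe_range, Set.mem_Iio, not_lt] at h
      simp only [h0 n h, map_zero]
    · intro n hn
      by_contra h
      refine hn ?_
      simp only [Finset.coe_range, Set.mem_Iio, not_lt] at h
      obtain ⟨n, rfl⟩ : ∃ m, n = m + 1 := ⟨n - 1, by omega⟩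
      simp only [hc, h0 n (by omega), map_zero]
  · change ∑ᶠ n, s n (B.mkQ (c n b)) = 0
    refine finsum_eq_zero_of_forall_eq_zero fun n => ?_
    rw [Submodule.mkQ_apply, (Submodule.Quotient.mk_eq_zero B).2 (hB n b hb), map_zero]
  · change t - ∑ᶠ n, s n (B.mkQ (c n t)) ∈ B
    nth_rw 1 [← hsum t]
    rw [← finsum_sub_distrib (hfin t) (hsupp t)]
    refine finsum_induction (· ∈ B) B.zero_mem (fun _ _ => B.add_mem) fun n => ?_
    rw [← Submodule.Quotient.mk_eq_zero B, ← Submodule.mkQ_apply, map_sub, hs, sub_self]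

theorem homogeneousComponent_X_mul (i : Fin D) (n : ℕ) (p : MvPolynomial (Fin D) ℝ) :
    homogeneousComponent (n + 1) (X i * p) = X i * homogeneousComponent n p := by
  classical
  ext d
  rw [coeff_homogeneousComponent, coeff_X_mul', coeff_X_mul']
  by_cases hi : i ∈ d.support
  · rw [if_pos hi, if_pos hi, coeff_homogeneousComponent]
    have h1 : Finsupp.single i 1 ≤ d := by
      rw [Finsupp.single_le_iff]
      exact Nat.one_le_iff_ne_zero.2 (Finsupp.mem_support_iff.1 hi)
    have h2 : d.degree = (d - Finsupp.single i 1).degree + 1 := by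
      conv_lhs => rw [← tsub_add_cancel_of_le h1, map_add, Finsupp.degree_single]
    rw [h2]
    simp
  · simp [hi]

theorem homogeneousComponent_zero_X_mul (i : Fin D) (p : MvPolynomial (Fin D) ℝ) :
    homogeneousComponent 0 (X i * p) = 0 := by
  classical
  rw [homogeneousComponent_zero, coeff_X_mul', if_neg (by simp), map_zero]

/-- The homogeneous components of a polynomial tensor. -/
def tensorComponent (n : ℕ) : (Fin D → Fin D → Fin D → MvPolynomial (Fin D) ℝ) →ₗ[ℝ]
    (Fin D → Fin D → Fin D → MvPolynomial (Fin D) ℝ) where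
  toFun t α β γ := homogeneousComponent n (t α β γ)
  map_add' t u := by funext α β γ; simp
  map_smul' r t := by funext α β γ; simp

theorem tensorComponent_apply (n : ℕ) (t : Fin D → Fin D → Fin D → MvPolynomial (Fin D) ℝ)
    (α β γ : Fin D) : tensorComponent n t α β γ = homogeneousComponent n (t α β γ) := rfl

theorem IsHook.tensorComponent {t : Fin D → Fin D → Fin D → MvPolynomial (Fin D) ℝ} (ht : IsHook t)
    (n : ℕ) : IsHook (tensorComponent n t) where
  antisymm α β γ := by simp only [tensorComponent_apply]; rw [ht.antisymm, map_neg]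
  cyclic α β γ := by
    simp only [tensorComponent_apply]
    rw [← map_add, ← map_add, ht.cyclic, map_zero]

theorem hookProj_tensorComponent (n : ℕ) (t : Fin D → Fin D → Fin D → MvPolynomial (Fin D) ℝ) :
    hookProj (tensorComponent n t) = tensorComponent n (hookProj t) := by
  funext α β γ
  simp only [hookProj, tensorComponent_apply, map_add, map_sub, map_smul]

theorem tensorComponent_eomOp (n : ℕ) (t : Fin D → Fin D → Fin D → MvPolynomial (Fin D) ℝ) :
    tensorComponent (n + 2) (eomOp X t) = eomOp X (tensorComponent n t) := by
  funext α β γ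
  simp only [eomOp, ricciTr, ricci, curvature, curl, tensorComponent_apply, map_add, map_sub,
    map_sum, map_smul, smul_eq_mul, homogeneousComponent_X_mul, mul_add]

theorem tensorComponent_eomOp_of_lt {n : ℕ} (hn : n < 2)
    (t : Fin D → Fin D → Fin D → MvPolynomial (Fin D) ℝ) : tensorComponent n (eomOp X t) = 0 := by
  have h : ∀ i j (f : MvPolynomial (Fin D) ℝ), homogeneousComponent n (X i * (X j * f)) = 0 := by
    intro i j f
    obtain rfl | rfl : n = 0 ∨ n = 1 := by omega
    · rw [homogeneousComponent_zero_X_mul]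
    · rw [homogeneousComponent_X_mul, homogeneousComponent_zero_X_mul, mul_zero]
  funext α β γ
  simp only [eomOp, ricciTr, ricci, curvature, curl, tensorComponent_apply, map_add, map_sub,
    map_sum, map_smul, smul_eq_mul, mul_add, h]
  simp

theorem hookProj_smul (c : MvPolynomial (Fin D) ℝ)
    (t : Fin D → Fin D → Fin D → MvPolynomial (Fin D) ℝ) : hookProj (c • t) = c • hookProj t := by
  funext α β γ
  simp only [hookProj, Pi.smul_apply, smul_comm _ c, smul_add, smul_sub]

theorem hookProj_add {ι N : Type*} [AddCommGroup N] [Module ℝ N] (t u : ι → ι → ι → N) :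
    hookProj (t + u) = hookProj t + hookProj u := by
  funext α β γ
  simp only [hookProj, Pi.add_apply]
  module

theorem hookProj_real_smul {ι N : Type*} [AddCommGroup N] [Module ℝ N] (r : ℝ) (t : ι → ι → ι → N) :
    hookProj (r • t) = r • hookProj t := by
  funext α β γ
  simp only [hookProj, Pi.smul_apply]
  module

/-- Tensors whose hook part is in the range of the equations of motion. -/
def eomRange : Submodule ℝ (Fin D → Fin D → Fin D → MvPolynomial (Fin D) ℝ) where
  carrier := {t | ∃ w, IsHook w ∧ hookProj t = eomOp X w}
  add_mem' := by
    rintro t u ⟨w, hw, h⟩ ⟨v, hv, h'⟩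
    refine ⟨hookProj (w + v), hookProj_isHook _, ?_⟩
    rw [hookProj_add, hookProj_add, h, h', hookProj_eq hw, hookProj_eq hv, eomOp_add]
  zero_mem' := ⟨0, ⟨by simp, by simp⟩, by
    rw [eomOp_zero]
    funext α β γ
    simp [hookProj]⟩
  smul_mem' := by
    rintro r t ⟨w, hw, h⟩
    refine ⟨hookProj ((C r : MvPolynomial (Fin D) ℝ) • w), hookProj_isHook _, ?_⟩
    have hr : r • t = (C r : MvPolynomial (Fin D) ℝ) • t := by
      funext α β γ
      simp [MvPolynomial.smul_eq_C_mul]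
    rw [hr, hookProj_smul, hookProj_smul, h, hookProj_eq hw, eomOp_smul]

/-- The abstract construction applies with the grading by polynomial degree: the equations of motion
are homogeneous of degree two, so their range is graded, and `eomOp_range_of_X_smul` supplies
injectivity on the quotient. -/
theorem exists_eom_projector (hD : 4 < D) (i : Fin D) :
    ∃ π : (Fin D → Fin D → Fin D → MvPolynomial (Fin D) ℝ) →ₗ[ℝ]
        (Fin D → Fin D → Fin D → MvPolynomial (Fin D) ℝ),
      (∀ t, π ((X i : MvPolynomial (Fin D) ℝ) • t) = (X i : MvPolynomial (Fin D) ℝ) • π t)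
      ∧ (∀ t ∈ eomRange, π t = 0) ∧ ∀ t, t - π t ∈ eomRange := by
  have hfin : ∀ t : Fin D → Fin D → Fin D → MvPolynomial (Fin D) ℝ,
      ∃ N, ∀ n, N < n → tensorComponent n t = 0 := fun t => by
    -- The sum of the degrees is a crude common bound for all components.
    refine ⟨∑ α, ∑ β, ∑ γ, (t α β γ).totalDegree, fun n hn => ?_⟩
    funext α β γ
    refine homogeneousComponent_eq_zero _ _ (lt_of_le_of_lt ?_ hn)
    refine le_trans ?_ (Finset.single_le_sum
      (f := fun α => ∑ β, ∑ γ, (t α β γ).totalDegree) (fun _ _ => Nat.zero_le _)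
      (Finset.mem_univ α))
    refine le_trans ?_ (Finset.single_le_sum
      (f := fun β => ∑ γ, (t α β γ).totalDegree) (fun _ _ => Nat.zero_le _) (Finset.mem_univ β))
    exact Finset.single_le_sum (f := fun γ => (t α β γ).totalDegree) (fun _ _ => Nat.zero_le _)
      (Finset.mem_univ γ)
  refine exists_equivariant_projector ((LinearMap.lsmul (MvPolynomial (Fin D) ℝ)
    (Fin D → Fin D → Fin D → MvPolynomial (Fin D) ℝ) (X i)).restrictScalars ℝ) tensorComponent
    (fun t => ?_) (fun t => ?_) (fun t => ?_) (fun n t => ?_) eomRange ?_ ?_ ?_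
  · obtain ⟨N, hN⟩ := hfin t
    refine (Set.finite_Iic N).subset fun n hn => ?_
    by_contra h
    exact hn (hN n (not_le.1 h))
  · obtain ⟨N, hN⟩ := hfin t
    rw [finsum_eq_sum_of_support_subset (s := Finset.range (N + 1))]
    · funext α β γ
      rw [Finset.sum_apply, Finset.sum_apply, Finset.sum_apply]
      simp only [tensorComponent_apply]
      ext d
      rw [coeff_sum]
      simp only [coeff_homogeneousComponent]
      rw [Finset.sum_ite_eq]
      split_ifs with h
      · rfl
      · have h1 := congrArg (coeff d) (congrFun (congrFun (congrFun
          (hN d.degree (by simpa using h)) α) β) γ)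
        rw [tensorComponent_apply, coeff_homogeneousComponent, if_pos rfl] at h1
        exact h1.symm
    · intro n hn
      by_contra h
      simp only [Finset.coe_range, Set.mem_Iio, not_lt] at h
      exact hn (hN n h)
  · funext α β γ
    exact homogeneousComponent_zero_X_mul i _
  · funext α β γ
    exact homogeneousComponent_X_mul i n _
  · rintro n t ⟨w, hw, h⟩
    rcases Nat.lt_or_ge n 2 with hn | hn
    · refine ⟨0, ⟨by simp, by simp⟩, ?_⟩
      rw [hookProj_tensorComponent, h, tensorComponent_eomOp_of_lt hn, eomOp_zero]
    · obtain ⟨m, rfl⟩ := Nat.exists_eq_add_of_le' hn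
      exact ⟨tensorComponent m w, hw.tensorComponent m, by
        rw [hookProj_tensorComponent, h, tensorComponent_eomOp]⟩
  · rintro t ⟨w, hw, h⟩
    refine ⟨hookProj ((X i : MvPolynomial (Fin D) ℝ) • w), hookProj_isHook _, ?_⟩
    change hookProj ((X i : MvPolynomial (Fin D) ℝ) • t) = _
    rw [hookProj_smul, hookProj_smul, h, hookProj_eq hw, eomOp_smul]
  · rintro t ⟨w, hw, h⟩
    change hookProj ((X i : MvPolynomial (Fin D) ℝ) • t) = _ at h
    rw [hookProj_smul] at h
    exact eomOp_range_of_X_smul hD i hw h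

end Cokernel
end DualGravity
end

noncomputable section
namespace DualGravity

open MvPolynomial

/-! ### A contracting homotopy of the linearized complex -/

section Homotopy

variable {D : ℕ}

theorem kt_restr_zero (w : FieldVar D → MvPolynomial (Fin D) ℝ) : kt (restr 0 w) = 0 := by
  rw [kt_apply, ← restr_symL]
  set u := symL w
  funext z
  cases z with
  | T α β γ =>
    simp only [ktFun, restr_Tst]
    exact congrFun (congrFun (congrFun (eomOp_zero (p := X)) α) β) γ
  | Tst α β γ => simp [ktFun, restr_Sst, restr_Ast, hookProj]
  | Sst α β => simp [ktFun, restr_Cst]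
  | Ast α β => simp [ktFun, restr_Cst]
  | _ => rfl

theorem restr_restr (k l : ℕ) (w : FieldVar D → MvPolynomial (Fin D) ℝ) :
    restr k (restr l w) = if k = l then restr l w else 0 := by
  funext z
  rw [restr_apply, restr_apply]
  by_cases h : k = l
  · subst h
    simp only [if_true, restr_apply]
    split_ifs <;> rfl
  · simp only [h, if_false, Pi.zero_apply]
    split_ifs with h1 h2
    · exact absurd (h1.symm.trans h2) h
    · rfl
    · rfl

/-- In antighost number 0 exactness fails, so there it is a hypothesis. In antighost numbers 1 and 2
it is `exists_gauge` and `exists_grad`; in antighost number 3 a cycle vanishes. -/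
theorem kt_exact (hD : 4 < D) {w : FieldVar D → MvPolynomial (Fin D) ℝ} (hw : IsSym w)
    (h : kt w = 0) (h0 : ∃ v, restr 0 w = kt v) : ∃ v, w = kt v := by
  obtain ⟨v, hv⟩ := h0
  have hcard : 4 ≤ (Finset.univ : Finset (Fin D)).card := by
    rw [Finset.card_univ, Fintype.card_fin]
    omega
  rw [kt_of_isSym hw] at h
  have hT : ∃ u, (fun α β γ => w (.Tst α β γ)) = gauge X u := by
    have h1 := exists_gauge (by omega) hcard hw.Tst (by
      rw [partialX_univ]
      funext α β γ
      exact congrFun h (.T α β γ))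
    rwa [partialX_univ] at h1
  obtain ⟨u, hu⟩ := hT
  have hS : ∃ c : Fin D → MvPolynomial (Fin D) ℝ,
      ∀ α β, (2 : ℝ) • w (.Sst α β) + (6 : ℝ) • w (.Ast α β) = X α * c β := by
    have h1 := exists_grad (u := fun α β => (2 : ℝ) • w (.Sst α β) + (6 : ℝ) • w (.Ast α β))
      hcard (by
        rw [partialX_univ]
        funext α β γ
        exact congrFun h (.Tst α β γ))
    rwa [partialX_univ] at h1
  obtain ⟨c, hc⟩ := hS
  have hC : ∀ α, w (.Cst α) = 0 := fun α => by
    -- The diagonal S* equation reads `3 (2 X α w) = 0`.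
    have h1 := congrFun h (.Sst α α)
    simp only [ktFun, Pi.zero_apply] at h1
    have h2 := (smul_eq_zero.1 h1).resolve_left (by norm_num)
    rw [← two_mul] at h2
    have h3 := (mul_eq_zero.1 h2).resolve_left (by norm_num)
    exact (mul_eq_zero.1 h3).resolve_left (X_ne_zero α)
  -- The factors invert `ktFun`: with 1/4 and 1/12, the combination `2 S* + 6 A*` is `u` itself, and
  -- with 1/12 the symmetric and antisymmetric parts of the gradient of `c` reproduce the S* and A*
  -- components of `w`.
  let y : FieldVar D → MvPolynomial (Fin D) ℝ := fun
    | .Tst α β γ => symL v (.Tst α β γ)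
    | .Sst α β => (1 / 4 : ℝ) • (u α β + u β α)
    | .Ast α β => (1 / 12 : ℝ) • (u α β - u β α)
    | .Cst α => (1 / 12 : ℝ) • c α
    | _ => 0
  have hy : IsSym y :=
    { T := ⟨fun _ _ _ => neg_zero.symm, fun _ _ _ => by simp only [y, add_zero]⟩
      S := fun _ _ => rfl
      A := fun _ _ => neg_zero.symm
      Tst := (symL_isSym v).Tst
      Sst := fun α β => by simp only [y, add_comm]
      Ast := fun α β => by simp only [y]; module }
  refine ⟨y, ?_⟩
  rw [kt_of_isSym hy]
  funext z
  cases z with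
  | T α β γ => exact congrFun hv (.T α β γ)
  | S α β => exact congrFun hv (.S α β)
  | A α β => exact congrFun hv (.A α β)
  | C α => exact congrFun hv (.C α)
  | Tst α β γ =>
    have h1 : w (.Tst α β γ) = gauge X u α β γ := congrFun (congrFun (congrFun hu α) β) γ
    rw [h1]
    unfold gauge
    simp only [ktFun, y]
    congr 1
    funext γ α β
    congr 2
    module
  | Sst α β =>
    have h1 := hc α β
    have h2 := hc β α
    rw [hw.Sst β α, hw.Ast β α] at h2
    simp only [ktFun, y, mul_smul_comm]
    rw [← h1, ← h2]
    module
  | Ast α β =>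
    have h1 := hc α β
    have h2 := hc β α
    rw [hw.Sst β α, hw.Ast β α] at h2
    simp only [ktFun, y, mul_smul_comm]
    rw [← h1, ← h2]
    module
  | Cst α => exact hC α

/-- The extension of a projector on the gauge field by the identity on ghosts and by zero on
antifields. -/
def fieldProj (π : (Fin D → Fin D → Fin D → MvPolynomial (Fin D) ℝ) →ₗ[ℝ]
    (Fin D → Fin D → Fin D → MvPolynomial (Fin D) ℝ)) :
    (FieldVar D → MvPolynomial (Fin D) ℝ) →ₗ[ℝ] (FieldVar D → MvPolynomial (Fin D) ℝ) where
  toFun w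
    | .T α β γ => hookProj (π fun α β γ => w (.T α β γ)) α β γ
    | .S α β => symL w (.S α β)
    | .A α β => symL w (.A α β)
    | .C α => symL w (.C α)
    | _ => 0
  map_add' w u := by
    funext z
    cases z with
    | T α β γ =>
      have h : (fun α β γ => (w + u) (.T α β γ))
          = (fun α β γ => w (.T α β γ)) + fun α β γ => u (.T α β γ) := rfl
      change hookProj (π fun α β γ => (w + u) (.T α β γ)) α β γ = _
      rw [h, map_add, hookProj_add]
      rfl
    | _ => simp
  map_smul' r w := by
    funext z
    have hr : symL (r • w) = r • symL w := LinearMap.map_smul_of_tower _ _ _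
    cases z with
    | T α β γ =>
      have h : (fun α β γ => (r • w) (.T α β γ)) = r • (fun α β γ => w (.T α β γ)) := rfl
      change hookProj (π fun α β γ => (r • w) (.T α β γ)) α β γ = _
      rw [h, map_smul, hookProj_real_smul]
      rfl
    | _ => simp [hr]

theorem symL_T (w : FieldVar D → MvPolynomial (Fin D) ℝ) (α β γ : Fin D) :
    symL w (.T α β γ) = hookProj (fun α β γ => w (.T α β γ)) α β γ := rfl

/-- The properties of a projector onto representatives of the homology of the linearized complex. -/
structure IsHomologyProj (i : Fin D)
    (π : (FieldVar D → MvPolynomial (Fin D) ℝ) →ₗ[ℝ] (FieldVar D → MvPolynomial (Fin D) ℝ)) :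
    Prop where
  isSym : ∀ w, IsSym (π w)
  restr_zero : ∀ w, restr 0 (π w) = π w
  map_symL : ∀ w, π (symL w) = π w
  map_restr : ∀ k ≠ 0, ∀ w, π (restr k w) = 0
  map_kt : ∀ w, π (kt w) = 0
  exists_kt : ∀ w, ∃ v, restr 0 (symL w - π w) = kt v
  map_X : ∀ w, π ((X i : MvPolynomial (Fin D) ℝ) • w) = (X i : MvPolynomial (Fin D) ℝ) • π w
  ghost : ∀ w, (∀ α β γ, w (.T α β γ) = 0) → π (restr 0 w) = symL (restr 0 w)

/-- All homology sits in antighost number 0: the ghosts, which are not hit by `kt`, and the gauge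
field modulo its equations of motion, handled by `exists_eom_projector`. -/
theorem exists_isHomologyProj (hD : 4 < D) (i : Fin D) :
    ∃ π : (FieldVar D → MvPolynomial (Fin D) ℝ) →ₗ[ℝ] (FieldVar D → MvPolynomial (Fin D) ℝ),
      IsHomologyProj i π := by
  obtain ⟨πT, hX, hB, hπ⟩ := exists_eom_projector hD i
  -- A tensor without hook part belongs to `eomRange`, so the projector sees only the hook part.
  have hker : ∀ t, πT (hookProj t) = πT t := fun t => by
    rw [← sub_eq_zero, ← map_sub]
    refine hB _ ⟨0, ⟨by simp, by simp⟩, ?_⟩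
    have h1 : hookProj t - t = hookProj t + (-1 : ℝ) • t := by module
    rw [h1, hookProj_add, hookProj_real_smul, hookProj_eq (hookProj_isHook t), eomOp_zero]
    module
  have hπT : ∀ w α β γ, fieldProj πT w (.T α β γ)
      = hookProj (πT fun α β γ => w (.T α β γ)) α β γ := fun _ _ _ _ => rfl
  have hπS : ∀ w α β, fieldProj πT w (.S α β) = symL w (.S α β) := fun _ _ _ => rfl
  have hπA : ∀ w α β, fieldProj πT w (.A α β) = symL w (.A α β) := fun _ _ _ => rfl
  have hπC : ∀ w α, fieldProj πT w (.C α) = symL w (.C α) := fun _ _ => rfl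
  have hhook : ∀ α β γ, hookProj (0 : Fin D → Fin D → Fin D → MvPolynomial (Fin D) ℝ) α β γ = 0 :=
    fun α β γ => by simp [hookProj]
  refine ⟨fieldProj πT, ?_, ?_, ?_, ?_, ?_, ?_, ?_, ?_⟩
  · exact fun w =>
    { T := hookProj_isHook _
      S := (symL_isSym w).S
      A := (symL_isSym w).A
      Tst := ⟨fun _ _ _ => neg_zero.symm, fun _ _ _ => by
        change (0 : MvPolynomial (Fin D) ℝ) + 0 + 0 = 0
        simp⟩
      Sst := fun _ _ => rfl
      Ast := fun _ _ => neg_zero.symm }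
  · intro w
    funext z
    cases z <;> rfl
  · intro w
    have h2 : symL (symL w) = symL w := symL_eq (symL_isSym w)
    funext z
    cases z with
    | T α β γ =>
      rw [hπT, hπT]
      have h1 : (fun α β γ => symL w (.T α β γ)) = hookProj fun α β γ => w (.T α β γ) := rfl
      rw [h1, hker]
    | S α β => rw [hπS, hπS, h2]
    | A α β => rw [hπA, hπA, h2]
    | C α => rw [hπC, hπC, h2]
    | _ => rfl
  · intro k hk w
    funext z
    cases z with
    | T α β γ =>
      rw [hπT]
      have h1 : (fun α β γ => restr k w (.T α β γ)) = 0 := by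
        funext α β γ
        rw [restr_T, if_neg hk.symm]
        rfl
      rw [h1, map_zero, hhook]
      rfl
    | S α β => rw [hπS, ← restr_symL, restr_S, if_neg hk.symm]; rfl
    | A α β => rw [hπA, ← restr_symL, restr_A, if_neg hk.symm]; rfl
    | C α => rw [hπC, ← restr_symL, restr_C, if_neg hk.symm]; rfl
    | _ => rfl
  · intro w
    funext z
    cases z with
    | T α β γ =>
      rw [hπT, hB _ ⟨fun α β γ => symL w (.Tst α β γ), (symL_isSym w).Tst, ?_⟩, hhook]
      · rfl
      · exact hookProj_eq (kt_isSym w).T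
    | S α β => rw [hπS, symL_kt]; rfl
    | A α β => rw [hπA, symL_kt]; rfl
    | C α => rw [hπC, symL_kt]; rfl
    | _ => rfl
  · intro w
    obtain ⟨y, hy, hy'⟩ := hπ fun α β γ => w (.T α β γ)
    let v : FieldVar D → MvPolynomial (Fin D) ℝ := fun
      | .Tst α β γ => y α β γ
      | _ => 0
    have hv : IsSym v :=
      { T := ⟨fun _ _ _ => neg_zero.symm, fun _ _ _ => by simp only [v, add_zero]⟩
        S := fun _ _ => rfl
        A := fun _ _ => neg_zero.symm
        Tst := hy
        Sst := fun _ _ => rfl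
        Ast := fun _ _ => neg_zero.symm }
    refine ⟨v, ?_⟩
    rw [kt_of_isSym hv]
    funext z
    cases z with
    | T α β γ =>
      rw [restr_T, if_pos rfl, Pi.sub_apply, hπT, symL_T]
      have h1 := congrFun (congrFun (congrFun hy' α) β) γ
      change _ = eomOp X y α β γ
      rw [← h1]
      simp only [hookProj, Pi.sub_apply]
      module
    | S α β => rw [restr_S, if_pos rfl, Pi.sub_apply, hπS, sub_self]; rfl
    | A α β => rw [restr_A, if_pos rfl, Pi.sub_apply, hπA, sub_self]; rfl
    | C α => rw [restr_C, if_pos rfl, Pi.sub_apply, hπC, sub_self]; rfl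
    | Tst α β γ => simp [restr_Tst, ktFun, v, hookProj]
    | Sst α β => simp [restr_Sst, ktFun, v]
    | Ast α β => simp [restr_Ast, ktFun, v]
    | Cst α => rfl
  · intro w
    have h1 := map_smul symL (X i : MvPolynomial (Fin D) ℝ) w
    funext z
    rw [Pi.smul_apply]
    cases z with
    | T α β γ =>
      rw [hπT, hπT]
      have h2 : (fun α β γ => ((X i : MvPolynomial (Fin D) ℝ) • w) (.T α β γ))
        = (X i : MvPolynomial (Fin D) ℝ) • fun α β γ => w (.T α β γ) := rfl
      rw [h2, hX, hookProj_smul]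
      rfl
    | S α β => rw [hπS, hπS, h1]; rfl
    | A α β => rw [hπA, hπA, h1]; rfl
    | C α => rw [hπC, hπC, h1]; rfl
    | _ =>
      rw [smul_eq_mul]
      exact (mul_zero _).symm
  · intro w hw
    funext z
    cases z with
    | T α β γ =>
      have h3 : (fun α β γ => restr 0 w (.T α β γ)) = 0 := by
        funext α β γ
        exact hw α β γ
      rw [hπT, symL_T, h3, map_zero]
    | S α β => exact hπS _ _ _
    | A α β => exact hπA _ _ _
    | C α => exact hπC _ _
    | _ => rw [← restr_symL]; rfl

namespace IsHomologyProj

variable {i : Fin D}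
  {π : (FieldVar D → MvPolynomial (Fin D) ℝ) →ₗ[ℝ] (FieldVar D → MvPolynomial (Fin D) ℝ)}

theorem map_restr_zero (hπ : IsHomologyProj i π) (w : FieldVar D → MvPolynomial (Fin D) ℝ) :
    π (restr 0 w) = π w := by
  conv_rhs => rw [← sum_restr w, map_sum, Finset.sum_range_succ']
  simp only [hπ.map_restr _ (Nat.succ_ne_zero _), Finset.sum_const_zero, zero_add]

theorem idem (hπ : IsHomologyProj i π) (w : FieldVar D → MvPolynomial (Fin D) ℝ) :
    π (π w) = π w := by
  obtain ⟨v, hv⟩ := hπ.exists_kt w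
  have h1 := hπ.map_restr_zero (symL w - π w)
  rw [hv, hπ.map_kt, map_sub, hπ.map_symL] at h1
  exact (sub_eq_zero.1 h1.symm).symm

theorem kt_map (hπ : IsHomologyProj i π) (w : FieldVar D → MvPolynomial (Fin D) ℝ) :
    kt (π w) = 0 := by
  rw [← hπ.restr_zero w, kt_restr_zero]

end IsHomologyProj

/-- A linear right inverse of the differential on its range. -/
theorem exists_kt_section :
    ∃ g : (FieldVar D → MvPolynomial (Fin D) ℝ) →ₗ[ℝ] (FieldVar D → MvPolynomial (Fin D) ℝ),
      (∀ w, kt (g (kt w)) = kt w) ∧ (∀ w, restr 0 (g w) = 0) ∧ ∀ w, symL (g w) = g w := by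
  obtain ⟨g₀, hg₀⟩ : ∃ g₀ : (FieldVar D → MvPolynomial (Fin D) ℝ) →ₗ[ℝ]
      (FieldVar D → MvPolynomial (Fin D) ℝ), ∀ w, kt (g₀ (kt w)) = kt w := by
    obtain ⟨g, hg⟩ := LinearMap.exists_rightInverse_of_surjective
      ((kt (D := D)).restrictScalars ℝ).rangeRestrict (LinearMap.range_rangeRestrict _)
    obtain ⟨g', hg'⟩ := LinearMap.exists_extend g
    refine ⟨g', fun w => ?_⟩
    have h1 : g' (kt w) = g ⟨kt w, w, rfl⟩ := LinearMap.congr_fun hg' ⟨kt w, w, rfl⟩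
    rw [h1]
    exact congrArg Subtype.val (LinearMap.congr_fun hg ⟨kt w, w, rfl⟩)
  -- Symmetrizing and discarding the part of antighost number 0 leave `kt` of the result unchanged.
  refine ⟨((LinearMap.id - restr 0) ∘ₗ symL).restrictScalars ℝ ∘ₗ g₀, fun w => ?_, fun w => ?_,
    fun w => ?_⟩
  · change kt (symL (g₀ (kt w)) - restr 0 (symL (g₀ (kt w)))) = _
    rw [map_sub, kt_restr_zero, sub_zero, kt_symL, hg₀]
  · change restr 0 (symL (g₀ w) - restr 0 (symL (g₀ w))) = _
    rw [map_sub, restr_restr, if_pos rfl, sub_self]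
  · change symL (symL (g₀ w) - restr 0 (symL (g₀ w))) = symL (g₀ w) - restr 0 (symL (g₀ w))
    rw [map_sub, ← restr_symL, symL_eq (symL_isSym _)]

theorem restr_of_le {k : ℕ} (hk : 4 ≤ k) (w : FieldVar D → MvPolynomial (Fin D) ℝ) :
    restr k w = 0 := by
  funext z
  rw [restr_apply, if_neg]
  · rfl
  · cases z <;> simp only [FieldVar.antigh] <;> omega

/-- A contracting homotopy for the linearized Koszul-Tate complex. -/
structure IsHomotopy
    (π s : (FieldVar D → MvPolynomial (Fin D) ℝ) →ₗ[ℝ] (FieldVar D → MvPolynomial (Fin D) ℝ)) :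
    Prop where
  kt_add : ∀ w, kt (s w) + s (kt w) = symL w - π w
  map_symL : ∀ w, s (symL w) = s w
  ghost : ∀ w, (∀ α β γ, w (.T α β γ) = 0) → s (restr 0 w) = 0

/-- With `ρ = symL - π` and `g` a section of `kt`, the element `ρ w - g (kt w)` is a cycle that is
exact in antighost number 0, hence a boundary. Applying `g` once more defines the homotopy; on
boundaries it reduces to `g` because π kills them. -/
theorem exists_isHomotopy (hD : 4 < D) {i : Fin D}
    {π : (FieldVar D → MvPolynomial (Fin D) ℝ) →ₗ[ℝ] (FieldVar D → MvPolynomial (Fin D) ℝ)}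
    (hπ : IsHomologyProj i π) : ∃ s, IsHomotopy π s := by
  obtain ⟨g, hg, hg0, hgsym⟩ := exists_kt_section (D := D)
  let ρ : (FieldVar D → MvPolynomial (Fin D) ℝ) →ₗ[ℝ] (FieldVar D → MvPolynomial (Fin D) ℝ) :=
    symL.restrictScalars ℝ - π
  have hρ : ∀ w, ρ w = symL w - π w := fun _ => rfl
  let s := g ∘ₗ (ρ - g ∘ₗ kt.restrictScalars ℝ)
  have hs : ∀ w, s w = g (ρ w - g (kt w)) := fun _ => rfl
  clear_value s ρ
  have hex : ∀ w, ∃ v, ρ w - g (kt w) = kt v := fun w => by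
    have hsy : symL (ρ w - g (kt w)) = ρ w - g (kt w) := by
      rw [map_sub, hgsym, hρ, map_sub, symL_eq (symL_isSym w), symL_eq (hπ.isSym w)]
    refine kt_exact hD (hsy ▸ symL_isSym _) ?_ ?_
    · rw [map_sub, hg, hρ, map_sub, kt_symL, hπ.kt_map, sub_zero, sub_self]
    · obtain ⟨v, hv⟩ := hπ.exists_kt w
      exact ⟨v, by rw [map_sub, hg0, sub_zero, hρ, hv]⟩
  have hρkt : ∀ w, ρ (kt w) = kt w := fun w => by rw [hρ, symL_kt, hπ.map_kt, sub_zero]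
  refine ⟨s, fun w => ?_, fun w => ?_, fun w hw => ?_⟩
  · obtain ⟨v, hv⟩ := hex w
    rw [hs, hs, hρkt, kt_kt, map_zero, sub_zero, hv, hg, ← hv, hρ, sub_add_cancel]
  · rw [hs, hs, kt_symL, hρ, hρ, hπ.map_symL, symL_eq (symL_isSym w)]
  · rw [hs, kt_restr_zero, map_zero, sub_zero, hρ, hπ.ghost w hw, sub_self, map_zero]

/-- A contracting homotopy for the linearized Koszul-Tate complex can be chosen to raise the
antighost number by one. -/
theorem exists_graded_isHomotopy (hD : 4 < D) {i : Fin D}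
    {π : (FieldVar D → MvPolynomial (Fin D) ℝ) →ₗ[ℝ] (FieldVar D → MvPolynomial (Fin D) ℝ)}
    (hπ : IsHomologyProj i π) :
    ∃ s, IsHomotopy π s ∧ ∀ k w, s (restr k w) = restr (k + 1) (s w) := by
  obtain ⟨s, hs⟩ := exists_isHomotopy hD hπ
  -- Only the components of degree +1 of `s` are kept; the homotopy identity has degree 0 and is
  -- preserved. Four values of `k` suffice because antighost numbers do not exceed 3.
  let s' : (FieldVar D → MvPolynomial (Fin D) ℝ) →ₗ[ℝ] (FieldVar D → MvPolynomial (Fin D) ℝ) :=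
    ∑ k ∈ Finset.range 4, (restr (k + 1)).restrictScalars ℝ ∘ₗ s ∘ₗ (restr k).restrictScalars ℝ
  have hs' : ∀ w, s' w = ∑ k ∈ Finset.range 4, restr (k + 1) (s (restr k w)) := fun w => by
    simp only [s', LinearMap.sum_apply]
    rfl
  clear_value s'
  have hs'r : ∀ k w, s' (restr k w) = restr (k + 1) (s (restr k w)) := fun k w => by
    rw [hs']
    simp only [restr_restr]
    rcases Nat.lt_or_ge k 4 with hk | hk
    · rw [Finset.sum_eq_single k]
      · simp
      · intro l _ hl
        simp [hl]
      · intro h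
        exact absurd (Finset.mem_range.2 hk) h
    · simp [restr_of_le hk]
  refine ⟨s', ⟨fun w => ?_, fun w => ?_, fun w hw => ?_⟩, fun k w => ?_⟩
  · have h1 : kt (s' w) = ∑ k ∈ Finset.range 4, restr k (kt (s (restr k w))) := by
      rw [hs', map_sum]
      exact Finset.sum_congr rfl fun k _ => (restr_kt k _).symm
    have h2 : s' (kt w) = ∑ k ∈ Finset.range 4, restr k (s (kt (restr k w))) := by
      rw [hs']
      simp only [restr_kt]
      rw [Finset.sum_range_succ, Finset.sum_range_succ' _ 3, kt_restr_zero,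
        restr_of_le (k := 3 + 1) le_rfl, map_zero, map_zero]
    have h3 : ∑ k ∈ Finset.range 4, restr k (π (restr k w)) = π w := by
      rw [Finset.sum_range_succ']
      simp only [hπ.map_restr _ (Nat.succ_ne_zero _), map_zero, Finset.sum_const_zero, zero_add]
      rw [hπ.restr_zero, hπ.map_restr_zero]
    rw [h1, h2, ← Finset.sum_add_distrib]
    simp only [← map_add, hs.kt_add]
    simp only [map_sub, ← restr_symL, restr_restr, if_true, Finset.sum_sub_distrib, sum_restr, h3]
  · rw [hs', hs']
    simp only [restr_symL, hs.map_symL]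
  · rw [hs'r, hs.ghost w hw, map_zero]
  · rw [hs'r, hs', map_sum]
    simp only [restr_restr, add_left_inj]
    rw [Finset.sum_ite_eq]
    split_ifs with hk
    · rfl
    · have h4 : 4 ≤ k := by simpa using hk
      exact restr_of_le (by omega) _

end Homotopy
end DualGravity
end

noncomputable section
namespace DualGravity

open MvPolynomial

/-! ### Superderivations determined by their values on jets -/

section JetDer

variable {D : ℕ} {K : CoeffAlgebra D}

/-- Values on generators, prescribed on jets and zero on coefficients and differentials. -/
def jetVal (v : FieldVar D → (Fin D →₀ ℕ) → LocalForms K) : Gen K → LocalForms K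
  | .jet z I => v z I
  | _ => 0

theorem jetVal_isDerData {ε : Bool} {v : FieldVar D → (Fin D →₀ ℕ) → LocalForms K}
    (hv : ∀ z I, v z I ∈ superCentral (K := K) (xor z.parity ε))
    (hs : ∀ I, IsSym fun z => v z I) : IsDerData ε (jetVal v) where
  mem g := by
    cases g with
    | jet z I => exact hv z I
    | _ => exact zero_mem _
  coef_add f g := by simp [jetVal]
  coef_mul f g := by simp [jetVal]
  coef_const r := rfl
  T_antisymm α β γ I := (hs I).T.antisymm α β γ
  T_cyclic α β γ I := (hs I).T.cyclic α β γ
  S_symm α β I := (hs I).S α β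
  A_antisymm α β I := (hs I).A α β
  Tst_antisymm α β γ I := (hs I).Tst.antisymm α β γ
  Tst_cyclic α β γ I := (hs I).Tst.cyclic α β γ
  Sst_symm α β I := (hs I).Sst α β
  Ast_antisymm α β I := (hs I).Ast α β

theorem IsHook.map {ι N N' : Type*} [AddCommGroup N] [AddCommGroup N'] (f : N →+ N')
    {t : ι → ι → ι → N} (ht : IsHook t) : IsHook fun α β γ => f (t α β γ) where
  antisymm α β γ := by rw [ht.antisymm, map_neg]
  cyclic α β γ := by rw [← map_add, ← map_add, ht.cyclic, map_zero]

theorem IsSym.map {N N' : Type*} [AddCommGroup N] [AddCommGroup N'] (f : N →+ N')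
    {t : FieldVar D → N} (ht : IsSym t) : IsSym fun z => f (t z) where
  T := ht.T.map f
  S α β := by rw [ht.S]
  A α β := by rw [ht.A, map_neg]
  Tst := ht.Tst.map f
  Sst α β := by rw [ht.Sst]
  Ast α β := by rw [ht.Ast, map_neg]

theorem symL_single (z : FieldVar D) (p : MvPolynomial (Fin D) ℝ) :
    symL (Pi.single z p) = p • symMat z := by
  have h : Pi.single z p = p • (Pi.single z 1 : FieldVar D → MvPolynomial (Fin D) ℝ) := by
    rw [← Pi.single_smul', smul_eq_mul, mul_one]
  rw [h, map_smul]
  rfl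

theorem symMat_isSym' : IsSym (symMat (D := D)) where
  T := ⟨fun α β γ => funext fun z => (symMat_isSym z).T.antisymm α β γ,
    fun α β γ => funext fun z => (symMat_isSym z).T.cyclic α β γ⟩
  S α β := funext fun z => (symMat_isSym z).S α β
  A α β := funext fun z => (symMat_isSym z).A α β
  Tst := ⟨fun α β γ => funext fun z => (symMat_isSym z).Tst.antisymm α β γ,
    fun α β γ => funext fun z => (symMat_isSym z).Tst.cyclic α β γ⟩
  Sst α β := funext fun z => (symMat_isSym z).Sst α β
  Ast α β := funext fun z => (symMat_isSym z).Ast α β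

theorem lin_mem {W : Submodule ℝ (LocalForms K)} {w : FieldVar D → MvPolynomial (Fin D) ℝ}
    (h : ∀ z, w z ≠ 0 → ∀ I, jet z I ∈ W) : lin K w ∈ W := by
  rw [lin_apply]
  refine Submodule.sum_mem _ fun z _ => ?_
  by_cases hz : w z = 0
  · rw [hz, zero_smul]
    exact zero_mem _
  · rw [(w z).as_sum, Finset.sum_smul]
    refine Submodule.sum_mem _ fun I _ => ?_
    have h1 : monomial I (coeff I (w z)) = coeff I (w z) • monomial I (1 : ℝ) := by
      rw [smul_monomial, smul_eq_mul, mul_one]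
    rw [h1, smul_assoc, monomial_smul_jet]
    exact Submodule.smul_mem _ _ (h z hz _)

theorem family_ext {N : Type*} [AddCommGroup N] [Module ℝ N]
    {F G : (FieldVar D → MvPolynomial (Fin D) ℝ) →ₗ[ℝ] N}
    (h : ∀ z I, F (Pi.single z (monomial I 1)) = G (Pi.single z (monomial I 1))) : F = G := by
  refine LinearMap.pi_ext' fun z => ?_
  refine MvPolynomial.linearMap_ext fun I => LinearMap.ext_ring ?_
  exact h z I

theorem sder_par {ε p : Bool} {F : LocalForms K →ₗ[ℝ] LocalForms K} (hF : F ∈ sder K ε)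
    (h : ∀ g, F (gen g) ∈ Par K (xor g.parity ε)) {x : LocalForms K} (hx : x ∈ Par K p) :
    F x ∈ Par K (xor p ε) := by
  unfold Par at *
  rw [parZ_xor]
  refine sder_homog hF (fun g => ?_) hx
  rw [← parZ_xor]
  exact h g

theorem delta_Bi {p k : ℤ} {x : LocalForms K} (hx : x ∈ Bi K p k) : delta x ∈ Bi K p (k - 1) := by
  have h := sder_Bi (c := 0) (c' := -1) (delta_mem (K := K)) (fun g => ?_) hx
  · rw [add_zero, ← sub_eq_add_neg] at h
    exact h
  · cases g with
    | jet z I =>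
      rw [← jet, ← lin_single, delta_lin]
      have h1 : (Pi.single z (monomial I 1) : FieldVar D → MvPolynomial (Fin D) ℝ)
          = restr z.antigh (Pi.single z (monomial I 1)) := by
        funext z'
        rw [restr_apply]
        split_ifs with hz
        · rfl
        · exact Pi.single_eq_of_ne (fun h => hz (by rw [h])) _
      refine lin_mem fun z' hz' J => ?_
      have h2 : (z'.antigh : ℤ) = z.antigh + -1 := by
        rcases Nat.eq_zero_or_pos z.antigh with h0 | h0
        · rw [h1, h0, kt_restr_zero] at hz'
          exact absurd rfl hz'
        · obtain ⟨k, hk⟩ : ∃ k, z.antigh = k + 1 := ⟨z.antigh - 1, by omega⟩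
          rw [h1, hk, ← restr_kt, restr_apply] at hz'
          have : z'.antigh = k := by
            by_contra h
            exact hz' (if_neg h)
          omega
      have h3 := Bi.jet_mem (K := K) z' J
      rw [h2] at h3
      exact h3
    | _ =>
      rw [delta_gen]
      exact zero_mem _

theorem delta_delta (a : LocalForms K) : delta (delta a) = 0 := by
  have h := sder_commute (delta_mem (K := K)) delta_mem delta_gen_par delta_gen_par
    (fun g => ?_) a
  · have h1 : sgn true true = -1 := rfl
    rw [h1, neg_one_smul] at h
    have h2 : (2 : ℝ) • delta (delta a) = 0 := by
      rw [two_smul]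
      nth_rw 1 [h]
      exact neg_add_cancel _
    exact (smul_eq_zero.1 h2).resolve_left two_ne_zero
  · have h0 : delta (delta (gen g)) = 0 := by
      cases g with
      | jet z I => rw [← jet, ← lin_single, delta_lin, delta_lin, kt_kt, map_zero]
      | coef f => rw [delta_gen]; exact map_zero _
      | dx μ => rw [delta_gen]; exact map_zero _
    rw [h0, smul_zero]

theorem Bi_neg {p k : ℤ} (hk : k < 0) {x : LocalForms K} (hx : x ∈ Bi K p k) : x = 0 := by
  induction hx using Homog.induction with
  | zero => rfl
  | add x y _ _ hx hy => rw [hx, hy, add_zero]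
  | smul c x _ hx => rw [hx, smul_zero]
  | prod l hl =>
    rw [sum_bideg, Prod.mk.injEq] at hl
    omega

end JetDer

/-! ### Acyclicity in positive antighost number, and weakly constant functions -/

section Acyclic

variable {D : ℕ} {K : CoeffAlgebra D} {i : Fin D}
  {π s : (FieldVar D → MvPolynomial (Fin D) ℝ) →ₗ[ℝ] (FieldVar D → MvPolynomial (Fin D) ℝ)}

/-- Along T, T*, (S*, A*), C* raising the antighost number by one also flips the parity. The odd
ghosts would break this rule, which is why the homotopy was made to vanish on ghosts. -/
theorem homotopy_support (hs : IsHomotopy π s) (hs' : ∀ k w, s (restr k w) = restr (k + 1) (s w))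
    (z : FieldVar D) (p : MvPolynomial (Fin D) ℝ) {z' : FieldVar D} (h : s (Pi.single z p) z' ≠ 0) :
    z'.antigh = z.antigh + 1 ∧ z'.parity = xor z.parity true := by
  have h1 : (Pi.single z p : FieldVar D → MvPolynomial (Fin D) ℝ)
      = restr z.antigh (Pi.single z p) := by
    funext z'
    rw [restr_apply]
    split_ifs with hz
    · rfl
    · exact Pi.single_eq_of_ne (fun h => hz (by rw [h])) _
  have h2 : z'.antigh = z.antigh + 1 := by
    rw [h1, hs', restr_apply] at h
    by_contra h'
    exact h (if_neg h')
  refine ⟨h2, ?_⟩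
  by_cases hg : z.antigh = 0 ∧ ∀ α β γ, z ≠ .T α β γ
  · rw [h1, hg.1, hs.ghost] at h
    · exact absurd rfl h
    · exact fun α β γ => Pi.single_eq_of_ne (Ne.symm (hg.2 α β γ)) _
  · clear h h1
    cases z <;> cases z' <;> first
      | rfl
      | (simp [FieldVar.antigh] at h2; done)
      | (refine absurd ⟨rfl, fun _ _ _ => ?_⟩ hg; simp)

/-- Prescribing `s` on jets defines an odd derivation: `homotopy_support` gives the parity, and
invariance of `s` under symmetrization gives compatibility with the index symmetries. -/
theorem exists_sigma (hs : IsHomotopy π s) (hs' : ∀ k w, s (restr k w) = restr (k + 1) (s w)) :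
    ∃ σ ∈ sder K true, (∀ w, σ (lin K w) = lin K (s w)) ∧ (∀ f, σ (gen (.coef f)) = 0)
      ∧ (∀ μ, σ (gen (.dx μ)) = 0) ∧ (∀ g, σ (gen g) ∈ Par K (xor g.parity true))
      ∧ ∀ p k, ∀ x ∈ Bi K p k, σ x ∈ Bi K p (k + 1) := by
  let v : FieldVar D → (Fin D →₀ ℕ) → LocalForms K :=
    fun z I => lin K (s (Pi.single z (monomial I 1)))
  have hmem : ∀ (W : Bool → Submodule ℝ (LocalForms K)),
      (∀ z I, (jet z I : LocalForms K) ∈ W z.parity) → ∀ z I, v z I ∈ W (xor z.parity true) :=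
    fun W hW z I => lin_mem fun z' hz' J => by
      rw [← (homotopy_support hs hs' z _ hz').2]
      exact hW z' J
  have hsym : ∀ I, IsSym fun z => v z I := fun I => by
    have h1 : ∀ z, v z I = lin K (s ((monomial I (1 : ℝ)) • symMat z)) := fun z => by
      rw [← symL_single, hs.map_symL]
    simp only [h1]
    exact symMat_isSym'.map (((lin K).toAddMonoidHom.comp s.toAddMonoidHom).comp
      (DistribSMul.toAddMonoidHom _ (monomial I (1 : ℝ))))
  let hd := jetVal_isDerData (hmem (fun p => superCentral p) jet_mem) hsym
  have hgen : ∀ g, superDer hd (gen g) = jetVal v g := superDer_gen hd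
  refine ⟨superDer hd, superDer_mem hd, fun w => ?_, fun f => hgen _, fun μ => hgen _, fun g => ?_,
    fun p k x hx => ?_⟩
  · have h1 : superDer hd ∘ₗ (lin K).restrictScalars ℝ = (lin K).restrictScalars ℝ ∘ₗ s := by
      refine family_ext fun z I => ?_
      change superDer hd (lin K (Pi.single z (monomial I 1))) = _
      rw [lin_single]
      exact hgen (.jet z I)
    exact LinearMap.congr_fun h1 w
  · rw [hgen]
    cases g with
    | jet z I => exact hmem (fun p => Par K p) (fun z I => Par.gen_mem (.jet z I)) z I
    | _ => exact zero_mem _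
  · have h := sder_Bi (c := 0) (c' := 1) (superDer_mem hd) (fun g => ?_) hx
    · rwa [add_zero] at h
    · rw [hgen]
      cases g with
      | jet z I =>
        refine lin_mem fun z' hz' J => ?_
        have h1 := Bi.jet_mem (K := K) z' J
        rw [(homotopy_support hs hs' z _ hz').1, Nat.cast_add, Nat.cast_one] at h1
        exact h1
      | _ => exact zero_mem _

theorem exists_eigen_split {V : Type*} [AddCommGroup V] [Module ℝ V] {T : V →ₗ[ℝ] V} {x : V}
    (hx : x ∈ eigSpan T 0) : ∃ y z, x = y + z ∧ T y = 0 ∧ z ∈ eigSpan T 1 := by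
  induction hx using Submodule.span_induction with
  | mem x h =>
    obtain ⟨j, -, hj⟩ := h
    rcases Nat.eq_zero_or_pos j with rfl | h0
    · exact ⟨x, 0, by simp, by simpa using hj, zero_mem _⟩
    · exact ⟨0, x, by simp, by simp, Submodule.subset_span ⟨j, h0, hj⟩⟩
  | zero => exact ⟨0, 0, by simp, by simp, zero_mem _⟩
  | add x x' _ _ h h' =>
    obtain ⟨y, z, rfl, hy, hz⟩ := h
    obtain ⟨y', z', rfl, hy', hz'⟩ := h'
    exact ⟨y + y', z + z', by abel, by rw [map_add, hy, hy', add_zero], add_mem hz hz'⟩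
  | smul c x _ h =>
    obtain ⟨y, z, rfl, hy, hz⟩ := h
    exact ⟨c • y, c • z, smul_add _ _ _, by rw [map_smul, hy, smul_zero],
      Submodule.smul_mem _ _ hz⟩

theorem mem_eigSpan {T : LocalForms K →ₗ[ℝ] LocalForms K} (hT : T ∈ sder K false)
    (h : ∀ g, gen g ∈ eigSpan T 0) (a : LocalForms K) : a ∈ eigSpan T 0 := by
  induction a using LocalForms.induction with
  | one => simpa using eigSpan_prod hT h []
  | add a b ha hb => exact Submodule.add_mem _ ha hb
  | smul c a ha => exact Submodule.smul_mem _ _ ha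
  | gen_mul g a ha => simpa using eigSpan_mul hT (h g) ha

/-- The number operator of the contractible part of the Koszul-Tate complex. -/
structure IsContraction (i : Fin D) (σ Δ : LocalForms K →ₗ[ℝ] LocalForms K) : Prop where
  eq : ∀ a, Δ a = delta (σ a) + σ (delta a)
  mem : Δ ∈ sder K false
  sigma_Bi : ∀ p k, ∀ x ∈ Bi K p k, σ x ∈ Bi K p (k + 1)
  eig : ∀ g, gen g ∈ eigSpan Δ 0
  eig_one : ∀ g : Gen K, 1 ≤ g.antigh → gen g ∈ eigSpan Δ 1
  total : ∀ a, total i (Δ a) = Δ (total i a)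

/-- On linear combinations of jets Δ is `1 - π`, a projector, so jets split into eigenvectors for 0
and 1. Since π vanishes on antifields, these have eigenvalue 1; since π commutes with `X i`, Δ
commutes with `total i`. -/
theorem exists_isContraction (hD : 4 < D) (i : Fin D) :
    ∃ σ Δ : LocalForms K →ₗ[ℝ] LocalForms K, IsContraction i σ Δ := by
  obtain ⟨π, hπ⟩ := exists_isHomologyProj hD i
  obtain ⟨s, hs, hs'⟩ := exists_graded_isHomotopy hD hπ
  obtain ⟨σ, hσ, hσl, hσc, hσd, hσp, hσb⟩ := exists_sigma (K := K) hs hs'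
  have hsgn : sgn true true = -1 := rfl
  let Δ : LocalForms K →ₗ[ℝ] LocalForms K := delta ∘ₗ σ - sgn true true • σ ∘ₗ delta
  have hΔ : ∀ a, Δ a = delta (σ a) + σ (delta a) := fun a => by
    simp only [Δ, hsgn, LinearMap.sub_apply, LinearMap.smul_apply, LinearMap.comp_apply]
    module
  have hΔm : Δ ∈ sder K false := sder_bracket delta_mem hσ delta_gen_par hσp
  clear_value Δ
  have hΔl : ∀ w, Δ (lin K w) = lin K w - lin K (π w) := fun w => by
    rw [hΔ, hσl, delta_lin, delta_lin, hσl, ← map_add, hs.kt_add, map_sub, lin_symL]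
  have hΔc : ∀ f, Δ (gen (.coef f)) = 0 := fun f => by
    have h0 : delta (gen (.coef f) : LocalForms K) = 0 := delta_gen _
    rw [hΔ, hσc, h0, map_zero, map_zero, add_zero]
  have hΔd : ∀ μ, Δ (gen (.dx μ)) = 0 := fun μ => by
    have h0 : delta (gen (.dx μ) : LocalForms K) = 0 := delta_gen _
    rw [hΔ, hσd, h0, map_zero, map_zero, add_zero]
  have hπ0 : ∀ w, Δ (lin K (π w)) = 0 := fun w => by rw [hΔl, hπ.idem, sub_self]
  have hπ1 : ∀ w, lin K w - lin K (π w) ∈ eigSpan Δ 1 := fun w =>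
    Submodule.subset_span ⟨1, le_rfl, by rw [map_sub, hπ0, hΔl, sub_zero, Nat.cast_one, one_smul]⟩
  refine ⟨σ, Δ, hΔ, hΔm, hσb, fun g => ?_, fun g hg => ?_, fun a => ?_⟩
  · cases g with
    | coef f => exact Submodule.subset_span ⟨0, le_rfl, by rw [hΔc, Nat.cast_zero, zero_smul]⟩
    | dx μ => exact Submodule.subset_span ⟨0, le_rfl, by rw [hΔd, Nat.cast_zero, zero_smul]⟩
    | jet z I =>
      rw [← jet, ← lin_single,
        ← sub_add_cancel (lin K (Pi.single z (monomial I 1))) (lin K (π (Pi.single z (monomial I 1))))]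
      exact add_mem (eigSpan_mono Δ zero_le_one (hπ1 _))
        (Submodule.subset_span ⟨0, le_rfl, by rw [hπ0, Nat.cast_zero, zero_smul]⟩)
  · cases g with
    | jet z I =>
      have h1 : (Pi.single z (monomial I 1) : FieldVar D → MvPolynomial (Fin D) ℝ)
          = restr z.antigh (Pi.single z (monomial I 1)) := by
        funext z'
        rw [restr_apply]
        split_ifs with hz
        · rfl
        · exact Pi.single_eq_of_ne (fun h => hz (by rw [h])) _
      have h2 := hπ1 (Pi.single z (monomial I 1))
      have h3 : π (Pi.single z (monomial I 1)) = 0 := by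
        rw [h1]
        exact hπ.map_restr _ (Nat.one_le_iff_ne_zero.1 hg) _
      rw [h3, map_zero, sub_zero, lin_single] at h2
      exact h2
    | coef f => exact absurd hg (by simp [Gen.antigh])
    | dx μ => exact absurd hg (by simp [Gen.antigh])
  · have hΔp : ∀ g, Δ (gen g) ∈ Par K (xor g.parity false) := fun g => by
      rw [hΔ]
      have h1 := sder_par delta_mem delta_gen_par (hσp g)
      have h2 := sder_par hσ hσp (delta_gen_par g)
      have h3 : xor (xor g.parity true) true = xor g.parity false := by cases g.parity <;> rfl
      rw [h3] at h1 h2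
      exact add_mem h1 h2
    have h := sder_commute (total_mem (K := K) i) hΔm (total_gen_par i) hΔp (fun g => ?_) a
    · simpa [sgn] using h
    · have h1 : sgn false false = 1 := rfl
      rw [h1, one_smul, total_gen]
      cases g with
      | coef f => rw [hΔc, map_zero, totalVal, hΔc]
      | dx μ => rw [hΔd, map_zero, totalVal, map_zero]
      | jet z I =>
        rw [totalVal, ← jet, ← total_jet, ← lin_single, hΔl, map_sub, ← X_smul, ← X_smul,
          ← map_smul (lin K), ← map_smul (lin K), hΔl, hπ.map_X]

namespace IsContraction

variable {σ Δ : LocalForms K →ₗ[ℝ] LocalForms K}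

theorem delta_comm (h : IsContraction i σ Δ) (a : LocalForms K) : delta (Δ a) = Δ (delta a) := by
  rw [h.eq, h.eq, map_add, delta_delta, delta_delta, map_zero, zero_add, add_zero]

theorem map_Bi (h : IsContraction i σ Δ) {p k : ℤ} {x : LocalForms K} (hx : x ∈ Bi K p k) :
    Δ x ∈ Bi K p k := by
  rw [h.eq]
  have h1 := delta_Bi (h.sigma_Bi p k x hx)
  have h2 := h.sigma_Bi p (k - 1) _ (delta_Bi hx)
  rw [add_sub_cancel_right] at h1
  rw [sub_add_cancel] at h2
  exact add_mem h1 h2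

theorem invertible (h : IsContraction i σ Δ) {p k : ℤ} (hk : 1 ≤ k) {x : LocalForms K}
    (hx : x ∈ Bi K p k) : x ∈ invertibleOn Δ :=
  eigSpan_one_le Δ (Bi_le_eigSpan h.mem h.eig h.eig_one hk hx)

/-- For the cycle `x` one has `Δ x = delta (σ x)`; the polynomial inverse of Δ commutes with `delta`
and can be applied inside. -/
theorem exists_delta (h : IsContraction i σ Δ) {p k : ℤ} {x y : LocalForms K} (hx : x ∈ Bi K p k)
    (hxδ : delta x = 0) (hy : y ∈ invertibleOn Δ) (hxy : Δ y = Δ x) :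
    ∃ m ∈ Bi K p (k + 1), y = delta m := by
  obtain ⟨r, hr⟩ := invertibleOn.exists_eq hy
  refine ⟨Polynomial.aeval (R := ℝ) Δ r (σ x),
    aeval_mem (fun _ => h.map_Bi) r (h.sigma_Bi p k x hx), ?_⟩
  rw [aeval_commute h.delta_comm, hr, hxy, h.eq x, hxδ, map_zero, add_zero]

end IsContraction

/-- The homology of the Koszul-Tate differential vanishes in positive antighost number. -/
theorem delta_acyclic (hD : 4 < D) {p k : ℤ} (hk : 1 ≤ k) {x : LocalForms K} (hx : x ∈ Bi K p k)
    (h : delta x = 0) : ∃ y ∈ Bi K p (k + 1), x = delta y := by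
  obtain ⟨σ, Δ, hc⟩ := exists_isContraction (K := K) hD ⟨0, by omega⟩
  exact hc.exists_delta hx h (hc.invertible hk hx) rfl

/-- A form with a weakly vanishing derivative is weakly equal to one with vanishing derivative. -/
theorem weakly_constant (hD : 4 < D) (i : Fin D) {p : ℤ} {f g : LocalForms K} (hf : f ∈ Bi K p 0)
    (hg : g ∈ Bi K p 1) (h : total i f = delta g) :
    ∃ f₀ ∈ Bi K p 0, ∃ m ∈ Bi K p 1, f = f₀ + delta m ∧ total i f₀ = 0 := by
  obtain ⟨σ, Δ, hc⟩ := exists_isContraction (K := K) hD i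
  have hδ : delta f = 0 := Bi_neg (by norm_num) (delta_Bi hf)
  -- The kernel part of Δ is the representative sought, and the part with positive eigenvalues is
  -- δ-exact.
  obtain ⟨y, z, rfl, hy, hz⟩ := exists_eigen_split (mem_eigSpan hc.mem hc.eig f)
  obtain ⟨m, hm, hzm⟩ := hc.exists_delta hf hδ (eigSpan_one_le Δ hz) (by rw [map_add, hy, zero_add])
  rw [zero_add] at hm
  have hδm := delta_Bi hm
  rw [sub_self] at hδm
  have hyB : y ∈ Bi K p 0 := by
    have h1 := Submodule.sub_mem _ hf hδm
    rwa [hzm, add_sub_cancel_right] at h1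
  refine ⟨y, hyB, m, hm, by rw [hzm], ?_⟩
  have h1 : total i y = delta (g - total i m) := by
    rw [map_sub, ← h, delta_total, hzm, map_add, add_sub_cancel_right]
  -- The derivative is `delta` of a form of antighost number 1, where Δ is invertible; on the other
  -- hand Δ annihilates it because Δ commutes with `total i`.
  have h2 : total i y ∈ invertibleOn Δ := by
    rw [h1]
    exact invertibleOn.map hc.delta_comm
      (hc.invertible le_rfl (Submodule.sub_mem _ hg (total_Bi i hm)))
  exact invertibleOn.eq_zero h2 (by rw [← hc.total, hy, map_zero])

end Acyclic
end DualGravity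
end

noncomputable section
namespace DualGravity

open MvPolynomial

/-! ### Partial derivatives with respect to the jet variables -/

section JetDerivative

variable {D : ℕ} {K : CoeffAlgebra D}

theorem symL_single_support (z z' : FieldVar D) (p : MvPolynomial (Fin D) ℝ)
    (h : symL (Pi.single z' p) z ≠ 0) : z'.parity = z.parity ∧ z'.antigh = z.antigh := by
  by_contra hz
  refine h ?_
  change symmetrize (Pi.single z' p) z = 0
  cases z <;> cases z' <;> first
    | exact absurd ⟨rfl, rfl⟩ hz
    | (simp [symmetrize, hookProj])

/-- Values of the derivative dual to the functional `φ` with respect to the jets of `z`. -/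
def jetDVal (K : CoeffAlgebra D) (z : FieldVar D) (φ : MvPolynomial (Fin D) ℝ →ₗ[ℝ] ℝ)
    (z' : FieldVar D) (J : Fin D →₀ ℕ) : LocalForms K :=
  φ (symL (Pi.single z' (monomial J 1)) z) • 1

theorem jetDVal_mem (z : FieldVar D) (φ : MvPolynomial (Fin D) ℝ →ₗ[ℝ] ℝ)
    {W : Bool → Submodule ℝ (LocalForms K)} (hW : 1 ∈ W false) (z' : FieldVar D)
    (J : Fin D →₀ ℕ) : jetDVal K z φ z' J ∈ W (xor z'.parity z.parity) := by
  unfold jetDVal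
  by_cases h : symL (Pi.single z' (monomial J 1)) z = 0
  · rw [h, map_zero, zero_smul]
    exact zero_mem _
  · rw [(symL_single_support z z' _ h).1, Bool.xor_self]
    exact Submodule.smul_mem _ _ hW

theorem jetDVal_isSym (z : FieldVar D) (φ : MvPolynomial (Fin D) ℝ →ₗ[ℝ] ℝ) (J : Fin D →₀ ℕ) :
    IsSym fun z' => jetDVal K z φ z' J := by
  have h : ∀ z', jetDVal K z φ z' J = φ (monomial J 1 * symMat z' z) • 1 := fun z' => by
    rw [jetDVal, symL_single, Pi.smul_apply, smul_eq_mul]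
  simp only [h]
  exact (symMat_isSym z).map (((LinearMap.toSpanSingleton ℝ (LocalForms K) 1).toAddMonoidHom.comp
    φ.toAddMonoidHom).comp (AddMonoidHom.mulLeft (monomial J 1)))

/-- The superderivation dual to the functional `φ` with respect to the jets of `z`: its value on the
linear combination of jets with coefficients `w` is `φ (w z)`, up to symmetrization. -/
def jetD (z : FieldVar D) (φ : MvPolynomial (Fin D) ℝ →ₗ[ℝ] ℝ) : LocalForms K →ₗ[ℝ] LocalForms K :=
  superDer (jetVal_isDerData (ε := z.parity)
    (jetDVal_mem z φ (W := fun p => superCentral p) one_mem_superCentral) (jetDVal_isSym z φ))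

theorem jetD_mem (z : FieldVar D) (φ : MvPolynomial (Fin D) ℝ →ₗ[ℝ] ℝ) :
    jetD z φ ∈ sder K z.parity := superDer_mem _

theorem jetD_gen (z : FieldVar D) (φ : MvPolynomial (Fin D) ℝ →ₗ[ℝ] ℝ) (g : Gen K) :
    jetD z φ (gen g) = jetVal (jetDVal K z φ) g := superDer_gen _ g

theorem jetD_coef (z : FieldVar D) (φ : MvPolynomial (Fin D) ℝ →ₗ[ℝ] ℝ) (f : K.carrier) :
    jetD z φ (gen (.coef f)) = 0 := jetD_gen z φ _

theorem jetD_dx (z : FieldVar D) (φ : MvPolynomial (Fin D) ℝ →ₗ[ℝ] ℝ) (μ : Fin D) :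
    jetD z φ (gen (.dx μ) : LocalForms K) = 0 := jetD_gen z φ _

theorem jetD_lin (z : FieldVar D) (φ : MvPolynomial (Fin D) ℝ →ₗ[ℝ] ℝ)
    (w : FieldVar D → MvPolynomial (Fin D) ℝ) :
    jetD z φ (lin K w) = φ (symL w z) • 1 := by
  have h : jetD z φ ∘ₗ (lin K).restrictScalars ℝ
      = (LinearMap.toSpanSingleton ℝ (LocalForms K) 1) ∘ₗ φ ∘ₗ LinearMap.proj z
        ∘ₗ symL.restrictScalars ℝ := by
    refine family_ext fun z' I => ?_
    change jetD z φ (lin K (Pi.single z' (monomial I 1))) = _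
    rw [lin_single]
    exact jetD_gen z φ (.jet z' I)
  exact LinearMap.congr_fun h w

theorem jetD_par (z : FieldVar D) (φ : MvPolynomial (Fin D) ℝ →ₗ[ℝ] ℝ) (g : Gen K) :
    jetD z φ (gen g) ∈ Par K (xor g.parity z.parity) := by
  rw [jetD_gen]
  cases g with
  | jet z' J => exact jetDVal_mem z φ (W := fun p => Par K p) Par.one_mem z' J
  | _ => exact zero_mem _

theorem jetD_Bi (z : FieldVar D) (φ : MvPolynomial (Fin D) ℝ →ₗ[ℝ] ℝ) {p k : ℤ} {x : LocalForms K}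
    (hx : x ∈ Bi K p k) : jetD z φ x ∈ Bi K p (k - z.antigh) := by
  have h := sder_Bi (c := 0) (c' := -z.antigh) (jetD_mem (K := K) z φ) (fun g => ?_) hx
  · rw [add_zero, ← sub_eq_add_neg] at h
    exact h
  · rw [jetD_gen]
    cases g with
    | jet z' J =>
      change φ (symL (Pi.single z' (monomial J 1)) z) • 1 ∈ Bi K (0 + 0) (z'.antigh + -z.antigh)
      by_cases h : symL (Pi.single z' (monomial J 1)) z = 0
      · rw [h, map_zero, zero_smul]
        exact zero_mem _
      · rw [(symL_single_support z z' _ h).2, add_neg_cancel, add_zero]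
        exact Submodule.smul_mem _ _ Bi.one_mem
    | _ => exact zero_mem _

theorem jetD_zero (z : FieldVar D) : jetD z 0 = (0 : LocalForms K →ₗ[ℝ] LocalForms K) :=
  sder_ext (jetD_mem z 0) (zero_mem _) fun g => by
    rw [jetD_gen]
    cases g with
    | jet z' J => simp [jetVal, jetDVal]
    | _ => rfl

theorem jetD_gen_mul (z : FieldVar D) (φ : MvPolynomial (Fin D) ℝ →ₗ[ℝ] ℝ) (g : Gen K)
    (a : LocalForms K) : jetD z φ (gen g * a)
      = jetD z φ (gen g) * a + sgn z.parity g.parity • (gen g * jetD z φ a) :=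
  (jetD_mem z φ).2 g a

/-- The commutator is a derivation, so it suffices to compare on generators. For φ the coefficient
at I this is the familiar rule that the commutator of ∂/∂z_I with ∂_μ is ∂/∂z_{I-μ}; general
functionals φ make the index subtraction unnecessary. -/
theorem jetD_total (z : FieldVar D) (φ : MvPolynomial (Fin D) ℝ →ₗ[ℝ] ℝ) (μ : Fin D)
    (a : LocalForms K) : jetD z φ (total μ a)
      = total μ (jetD z φ a) + jetD z (φ ∘ₗ LinearMap.mulLeft ℝ (X μ)) a := by
  have hb := sder_bracket (jetD_mem (K := K) z φ) (total_mem μ) (jetD_par z φ) (total_gen_par μ)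
  have h1 : sgn z.parity false = 1 := by cases z.parity <;> rfl
  rw [Bool.xor_false, h1, one_smul] at hb
  have h := LinearMap.congr_fun (sder_ext hb (jetD_mem z (φ ∘ₗ LinearMap.mulLeft ℝ (X μ)))
    fun g => ?_) a
  · rw [LinearMap.sub_apply, LinearMap.comp_apply, LinearMap.comp_apply] at h
    rw [← h]
    abel
  · rw [LinearMap.sub_apply, LinearMap.comp_apply, LinearMap.comp_apply]
    cases g with
    | coef f => rw [total_gen, totalVal, jetD_coef, jetD_coef, jetD_coef, map_zero, sub_zero]
    | dx ν => rw [total_gen, totalVal, jetD_dx, jetD_dx, map_zero, map_zero, sub_zero]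
    | jet z' J =>
      rw [← jet, ← lin_single, ← X_smul, ← map_smul, jetD_lin, jetD_lin, jetD_lin, map_smul symL,
        map_smul (total μ), (total_mem μ).1, smul_zero, sub_zero]
      rfl

/-- The matrix of the linearized Koszul-Tate differential. -/
def ktMat (z' z : FieldVar D) : MvPolynomial (Fin D) ℝ := kt (Pi.single z' 1) z

theorem kt_eq_sum (w : FieldVar D → MvPolynomial (Fin D) ℝ) (z : FieldVar D) :
    kt w z = ∑ z', ktMat z' z * w z' := by
  have hw : w = ∑ z', w z' • (Pi.single z' 1 : FieldVar D → MvPolynomial (Fin D) ℝ) := by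
    funext z
    rw [Finset.sum_apply, Finset.sum_eq_single z]
    · simp
    · intro z' _ h
      rw [Pi.smul_apply, Pi.single_eq_of_ne h.symm, smul_zero]
    · simp
  have h1 := congrFun (congrArg kt hw) z
  rw [map_sum, Finset.sum_apply] at h1
  rw [h1]
  refine Finset.sum_congr rfl fun z' _ => ?_
  rw [map_smul, Pi.smul_apply, smul_eq_mul, mul_comm]
  rfl

theorem ktMat_support {z' z : FieldVar D} (h : ktMat z' z ≠ 0) :
    z'.antigh = z.antigh + 1 ∧ z'.parity = xor z.parity true := by
  have h1 : (Pi.single z' 1 : FieldVar D → MvPolynomial (Fin D) ℝ)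
      = restr z'.antigh (Pi.single z' 1) := by
    funext z''
    rw [restr_apply]
    split_ifs with hz
    · rfl
    · exact Pi.single_eq_of_ne (fun h => hz (by rw [h])) _
  have h2 : z'.antigh = z.antigh + 1 := by
    rw [ktMat, h1] at h
    rcases Nat.eq_zero_or_pos z'.antigh with h0 | h0
    · rw [h0, kt_restr_zero] at h
      exact absurd rfl h
    · obtain ⟨k, hk⟩ : ∃ k, z'.antigh = k + 1 := ⟨z'.antigh - 1, by omega⟩
      rw [hk, ← restr_kt, restr_apply] at h
      have : z.antigh = k := by
        by_contra h'
        exact h (if_neg h')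
      omega
  refine ⟨h2, ?_⟩
  clear h1
  cases z <;> cases z' <;> first
    | rfl
    | (simp [FieldVar.antigh] at h2; done)
    | exact absurd rfl h

theorem sum_ktMat_mul (z'' z : FieldVar D) : ∑ z', ktMat z' z * ktMat z'' z' = 0 := by
  have h := congrFun (kt_kt (Pi.single z'' 1)) z
  rw [kt_eq_sum] at h
  exact h

theorem sum_ktMat_smul (z' : FieldVar D) :
    ∑ z, ktMat z' z • (jet z 0 : LocalForms K) = delta (jet z' 0) := by
  rw [← lin_single, delta_lin, lin_apply]
  rfl

/-- The supercommutator is again a derivation, and on linear jets it reads off the matrix of `kt`.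
`ktMat_support` ensures that every summand has the required parity. -/
theorem jetD_delta (z : FieldVar D) (φ : MvPolynomial (Fin D) ℝ →ₗ[ℝ] ℝ) (a : LocalForms K) :
    jetD z φ (delta a) = sgn z.parity true • delta (jetD z φ a)
      + ∑ z', jetD z' (φ ∘ₗ LinearMap.mulLeft ℝ (ktMat z' z)) a := by
  have hb := sder_bracket (jetD_mem (K := K) z φ) delta_mem (jetD_par z φ) delta_gen_par
  have hs : ∑ z', jetD z' (φ ∘ₗ LinearMap.mulLeft ℝ (ktMat z' z)) ∈ sder K (xor z.parity true) :=
    Submodule.sum_mem _ fun z' _ => by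
      by_cases h : ktMat z' z = 0
      · rw [h, LinearMap.mulLeft_zero_eq_zero, LinearMap.comp_zero, jetD_zero]
        exact zero_mem _
      · rw [← (ktMat_support h).2]
        exact jetD_mem _ _
  have h := LinearMap.congr_fun (sder_ext hb hs fun g => ?_) a
  · rw [LinearMap.sub_apply, LinearMap.smul_apply, LinearMap.comp_apply, LinearMap.comp_apply,
      LinearMap.sum_apply] at h
    rw [← h]
    abel
  · rw [LinearMap.sub_apply, LinearMap.smul_apply, LinearMap.comp_apply, LinearMap.comp_apply,
      LinearMap.sum_apply]
    cases g with
    | coef f =>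
      simp only [jetD_coef, delta_gen, deltaVal, map_zero, smul_zero, sub_zero,
        Finset.sum_const_zero]
    | dx ν =>
      simp only [jetD_dx, delta_gen, deltaVal, map_zero, smul_zero, sub_zero,
        Finset.sum_const_zero]
    | jet z' J =>
      rw [← jet, ← lin_single, delta_lin]
      simp only [jetD_lin]
      rw [map_smul, delta_mem.1, smul_zero, smul_zero, sub_zero, symL_kt, ← kt_symL, kt_eq_sum,
        map_sum, Finset.sum_smul]
      rfl

/-! ### Euler-Lagrange derivatives -/

open Filter

/-- The partial derivative with respect to the jet `z_I`. -/
abbrev jetC (z : FieldVar D) (I : Fin D →₀ ℕ) : LocalForms K →ₗ[ℝ] LocalForms K :=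
  jetD z (lcoeff ℝ I)

/-- Sums over all multi-indices are handled as sums over sufficiently large finite sets; as an
eventual statement along `atTop`, finitely many such expansions can be realized by one common set.
-/
theorem eventually_functional {N : Type*} [AddCommGroup N] [Module ℝ N]
    (p : MvPolynomial (Fin D) ℝ) : ∀ᶠ t : Finset (Fin D →₀ ℕ) in atTop,
      ∀ φ : MvPolynomial (Fin D) ℝ →ₗ[ℝ] N, φ p = ∑ I ∈ t, coeff I p • φ (monomial I 1) := by
  filter_upwards [eventually_ge_atTop p.support] with t ht φ
  conv_lhs => rw [p.as_sum, map_sum]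
  rw [Finset.sum_subset ht]
  · refine Finset.sum_congr rfl fun I _ => ?_
    rw [← map_smul, smul_monomial, smul_eq_mul, mul_one]
  · intro I _ hI
    rw [notMem_support_iff.1 hI, map_zero, map_zero]

theorem jetD_expand_gen (z : FieldVar D) (g : Gen K) : ∀ᶠ t : Finset (Fin D →₀ ℕ) in atTop,
    ∀ φ, jetD z φ (gen g) = ∑ I ∈ t, φ (monomial I 1) • jetC z I (gen g) := by
  cases g with
  | coef f => exact Eventually.of_forall fun t φ => by simp [jetC, jetD_coef]
  | dx μ => exact Eventually.of_forall fun t φ => by simp [jetC, jetD_dx]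
  | jet z' J =>
    rw [← jet, ← lin_single]
    filter_upwards [eventually_functional (N := ℝ) (symL (Pi.single z' (monomial J 1)) z)]
      with t ht φ
    simp only [jetC, jetD_lin]
    rw [ht φ, Finset.sum_smul]
    refine Finset.sum_congr rfl fun I _ => ?_
    rw [smul_smul, smul_eq_mul, mul_comm]
    rfl

theorem jetD_expand (z : FieldVar D) (a : LocalForms K) : ∀ᶠ t : Finset (Fin D →₀ ℕ) in atTop,
    ∀ φ, jetD z φ a = ∑ I ∈ t, φ (monomial I 1) • jetC z I a := by
  induction a using LocalForms.induction with
  | one => exact Eventually.of_forall fun t φ => by simp [jetC, (jetD_mem z _).1]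
  | add a b ha hb =>
    filter_upwards [ha, hb] with t ha hb φ
    simp only [map_add, smul_add, Finset.sum_add_distrib, ← ha, ← hb]
  | smul c a ha =>
    filter_upwards [ha] with t ha φ
    simp only [map_smul, smul_comm _ c, ← Finset.smul_sum, ← ha]
  | gen_mul g a ha =>
    filter_upwards [ha, jetD_expand_gen z g] with t ha hg φ
    simp only [jetC, jetD_gen_mul, smul_add, Finset.sum_add_distrib]
    rw [hg φ, ha φ, Finset.sum_mul, Finset.mul_sum, Finset.smul_sum]
    congr 1
    · refine Finset.sum_congr rfl fun I _ => ?_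
      rw [smul_mul_assoc]
    · refine Finset.sum_congr rfl fun I _ => ?_
      rw [mul_smul_comm, smul_comm]

theorem jetC_eventually_zero (z : FieldVar D) (a : LocalForms K) :
    ∀ᶠ t : Finset (Fin D →₀ ℕ) in atTop, ∀ I, I ∉ t → jetC z I a = 0 := by
  filter_upwards [jetD_expand z a] with t ht I hI
  rw [jetC, ht]
  refine Finset.sum_eq_zero fun J hJ => ?_
  have h : lcoeff ℝ I (monomial J (1 : ℝ)) = 0 := by
    classical
    change coeff I (monomial J (1 : ℝ)) = 0
    rw [coeff_monomial, if_neg]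
    rintro rfl
    exact hI hJ
  rw [h, zero_smul]

theorem jetC_support_finite (z : FieldVar D) (a : LocalForms K) :
    (Function.support fun I => jetC z I a).Finite := by
  obtain ⟨t, ht⟩ := (jetC_eventually_zero z a).exists
  refine t.finite_toSet.subset fun I hI => ?_
  by_contra h
  exact hI (ht I h)

theorem EL_support_finite (z : FieldVar D) (a : LocalForms K) :
    (Function.support fun I => reflect (monomial I (1 : ℝ)) • jetC z I a).Finite :=
  (jetC_support_finite z a).subset fun I hI h => hI (by
    change jetC z I a = 0 at h
    simp only [h, smul_zero])

/-- The Euler-Lagrange derivative with respect to `z`. -/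
def EL (z : FieldVar D) : LocalForms K →ₗ[ℝ] LocalForms K where
  toFun a := ∑ᶠ I, reflect (monomial I (1 : ℝ)) • jetC z I a
  map_add' a b := by
    simp only [map_add, smul_add]
    exact finsum_add_distrib (EL_support_finite z a) (EL_support_finite z b)
  map_smul' c a := by
    simp only [map_smul, RingHom.id_apply]
    rw [smul_finsum]
    simp only [smul_comm c]

theorem EL_eventually (z : FieldVar D) (a : LocalForms K) :
    ∀ᶠ t : Finset (Fin D →₀ ℕ) in atTop,
      EL z a = ∑ I ∈ t, reflect (monomial I (1 : ℝ)) • jetC z I a := by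
  filter_upwards [jetC_eventually_zero z a] with t ht
  refine finsum_eq_sum_of_support_subset _ fun I hI => ?_
  by_contra h
  refine hI ?_
  change reflect (monomial I (1 : ℝ)) • jetC z I a = 0
  rw [ht I h, smul_zero]

/-- The linear map `q ↦ q(-∂) a`. -/
def reflectAct (a : LocalForms K) : MvPolynomial (Fin D) ℝ →ₗ[ℝ] LocalForms K where
  toFun q := reflect q • a
  map_add' p q := by rw [map_add, add_smul]
  map_smul' r q := by rw [map_smul, smul_assoc, RingHom.id_apply]

/-- Expanding the shifted functionals in coefficients and exchanging the sums collects the monomials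
of `p * monomial J 1`, whose reflection factors. -/
theorem EL_eventually_mul (z : FieldVar D) (p : MvPolynomial (Fin D) ℝ) (a : LocalForms K) :
    ∀ᶠ t : Finset (Fin D →₀ ℕ) in atTop, ∑ I ∈ t, reflect (monomial I (1 : ℝ))
      • jetD z (lcoeff ℝ I ∘ₗ LinearMap.mulLeft ℝ p) a = reflect p • EL z a := by
  obtain ⟨u, hu, hu'⟩ := ((jetD_expand z a).and (EL_eventually z a)).exists
  have h := (eventually_all_finset u).2 fun J _ =>
    eventually_functional (N := LocalForms K) (p * monomial J 1)
  filter_upwards [h] with t ht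
  rw [hu', Finset.smul_sum, Finset.sum_congr rfl fun I _ => congrArg _ (hu _)]
  simp only [Finset.smul_sum]
  rw [Finset.sum_comm]
  refine Finset.sum_congr rfl fun J hJ => ?_
  have h1 := ht J hJ (reflectAct (jetC z J a))
  change reflect (p * monomial J 1) • jetC z J a = _ at h1
  rw [map_mul, mul_smul] at h1
  rw [h1]
  refine Finset.sum_congr rfl fun I _ => ?_
  rw [smul_comm]
  rfl

/-- The commutator term of `jetD_total` sums to `reflect (X μ) • EL z a`, that is minus `total μ (EL
z a)`, and cancels the other term. -/
theorem EL_total (z : FieldVar D) (μ : Fin D) (a : LocalForms K) : EL z (total μ a) = 0 := by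
  obtain ⟨t, h1, h2, h3⟩ := ((EL_eventually z (total μ a)).and
    ((EL_eventually z a).and (EL_eventually_mul z (X μ) a))).exists
  rw [h1]
  simp only [jetC, jetD_total, smul_add, Finset.sum_add_distrib]
  rw [h3, reflect_X, neg_smul, h2, Finset.smul_sum]
  rw [← sub_eq_add_neg, sub_eq_zero]
  refine Finset.sum_congr rfl fun I _ => ?_
  rw [← X_smul, smul_comm]

theorem EL_delta (z : FieldVar D) (a : LocalForms K) :
    EL z (delta a) = sgn z.parity true • delta (EL z a)
      + ∑ z', reflect (ktMat z' z) • EL z' a := by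
  obtain ⟨t, h1, h2, h3⟩ := ((EL_eventually z (delta a)).and ((EL_eventually z a).and
    (eventually_all.2 fun z' => EL_eventually_mul z' (ktMat z' z) a))).exists
  rw [h1]
  simp only [jetC, jetD_delta, smul_add, Finset.sum_add_distrib, Finset.smul_sum]
  rw [Finset.sum_comm]
  simp only [h3]
  rw [h2, map_sum, Finset.smul_sum]
  simp only [delta_poly_smul, smul_comm (sgn z.parity true)]

theorem poly_smul_dx_mul (p : MvPolynomial (Fin D) ℝ) (μ : Fin D) (a : LocalForms K) :
    p • (gen (.dx μ) * a) = gen (.dx μ) * (p • a) := by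
  refine (map_poly_smul (F := LinearMap.mulLeft ℝ (gen (.dx μ))) (fun ν a => ?_) p a).symm
  rw [LinearMap.mulLeft_apply, LinearMap.mulLeft_apply, total_mul, total_gen, totalVal, zero_mul,
    zero_add]

theorem EL_dx_mul (z : FieldVar D) (μ : Fin D) (a : LocalForms K) :
    EL z (gen (.dx μ) * a) = sgn z.parity true • (gen (.dx μ) * EL z a) := by
  obtain ⟨t, h1, h2⟩ := ((EL_eventually z (gen (.dx μ) * a)).and (EL_eventually z a)).exists
  rw [h1, h2, Finset.mul_sum, Finset.smul_sum]
  refine Finset.sum_congr rfl fun I _ => ?_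
  rw [jetC, jetD_gen_mul, jetD_dx, zero_mul, zero_add, smul_comm, poly_smul_dx_mul]
  rfl

theorem EL_extd (z : FieldVar D) (a : LocalForms K) : EL z (extd a) = 0 := by
  rw [extd_apply, map_sum]
  refine Finset.sum_eq_zero fun μ _ => ?_
  rw [EL_dx_mul, EL_total, mul_zero, smul_zero]

theorem EL_Bi (z : FieldVar D) {p k : ℤ} {x : LocalForms K} (hx : x ∈ Bi K p k) :
    EL z x ∈ Bi K p (k - z.antigh) := by
  obtain ⟨t, ht⟩ := (EL_eventually z x).exists
  rw [ht]
  exact Submodule.sum_mem _ fun I _ => poly_smul_Bi _ (jetD_Bi z _ hx)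

theorem sder_vol {ε : Bool} {F : LocalForms K →ₗ[ℝ] LocalForms K} (hF : F ∈ sder K ε)
    (h : ∀ μ, F (gen (.dx μ)) = 0) : F (vol K) = 0 := by
  rw [vol_eq]
  generalize List.finRange D = s
  induction s with
  | nil => exact hF.1
  | cons μ s ih =>
    have h1 : dxProd K (μ :: s) = gen (.dx μ) * dxProd K s := by simp [dxProd]
    rw [h1, hF.2, h, ih, zero_mul, mul_zero, smul_zero, add_zero]

/-- The coefficient family of a constant combination of the antifields `C^*`. -/
def cstFamily (c : Fin D → ℝ) : FieldVar D → MvPolynomial (Fin D) ℝ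
  | .Cst μ => C (c μ)
  | _ => 0

theorem lin_cstFamily (c : Fin D → ℝ) : lin K (cstFamily c) = ∑ μ, c μ • Cstar K μ := by
  rw [lin_apply, sum_fieldVar]
  simp [cstFamily, C_smul, Cstar]

theorem sder_lin_mul_vol {F : LocalForms K →ₗ[ℝ] LocalForms K} {ε : Bool} (hF : F ∈ sder K ε)
    (hd : ∀ μ, F (gen (.dx μ)) = 0) (w : FieldVar D → MvPolynomial (Fin D) ℝ) :
    F (lin K w * vol K) = F (lin K w) * vol K := by
  have h : F ∘ₗ LinearMap.mulRight ℝ (vol K) ∘ₗ (lin K).restrictScalars ℝ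
      = LinearMap.mulRight ℝ (vol K) ∘ₗ F ∘ₗ (lin K).restrictScalars ℝ := by
    refine family_ext fun z I => ?_
    change F (lin K (Pi.single z (monomial I 1)) * vol K)
      = F (lin K (Pi.single z (monomial I 1))) * vol K
    rw [lin_single, jet, hF.2, sder_vol hF hd, mul_zero, smul_zero, add_zero]
  exact LinearMap.congr_fun h w

theorem EL_Cst (c : Fin D → ℝ) (ν : Fin D) :
    EL (.Cst ν) ((∑ μ, c μ • Cstar K μ) * vol K) = c ν • vol K := by
  rw [← lin_cstFamily]
  obtain ⟨t, h1, h2⟩ := ((EL_eventually (.Cst ν) (lin K (cstFamily c) * vol K)).and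
    (eventually_functional (N := LocalForms K) (C (c ν)))).exists
  have h3 := h2 (reflectAct (vol K))
  change reflect (C (c ν) : MvPolynomial (Fin D) ℝ) • vol K = _ at h3
  rw [← algebraMap_eq, AlgHom.commutes, algebraMap_smul] at h3
  rw [h1, h3]
  refine Finset.sum_congr rfl fun I _ => ?_
  rw [jetC, sder_lin_mul_vol (jetD_mem _ _) (jetD_dx _ _), jetD_lin, smul_mul_assoc, one_mul, smul_comm]
  rfl

end JetDerivative
end DualGravity
end

noncomputable section
namespace DualGravity

open MvPolynomial Filter

/-! ### The number operator -/

section Number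

variable {D : ℕ} {K : CoeffAlgebra D}

/-- The operator counting the jet variables. -/
def num : LocalForms K →ₗ[ℝ] LocalForms K :=
  superDer (jetVal_isDerData (ε := false) (v := jet)
    (fun z I => by rw [Bool.xor_false]; exact jet_mem z I) jet_isSym)

theorem num_mem : num ∈ sder K false := superDer_mem _

theorem num_gen (g : Gen K) : num (gen g) = jetVal jet g := superDer_gen _ g

theorem num_coef (f : K.carrier) : num (gen (.coef f)) = 0 := num_gen _

theorem num_dx (μ : Fin D) : num (gen (.dx μ) : LocalForms K) = 0 := num_gen _

theorem num_jet (z : FieldVar D) (I : Fin D →₀ ℕ) : num (jet z I : LocalForms K) = jet z I :=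
  num_gen (.jet z I)

theorem num_lin (w : FieldVar D → MvPolynomial (Fin D) ℝ) : num (lin K w) = lin K w := by
  have h : num ∘ₗ (lin K).restrictScalars ℝ = (lin K).restrictScalars ℝ := by
    refine family_ext fun z I => ?_
    change num (lin K (Pi.single z (monomial I 1))) = lin K (Pi.single z (monomial I 1))
    rw [lin_single, num_jet]
  exact LinearMap.congr_fun h w

theorem num_par (g : Gen K) : num (gen g) ∈ Par K (xor g.parity false) := by
  rw [Bool.xor_false, num_gen]
  cases g with
  | jet z I => exact Par.gen_mem (.jet z I)
  | _ => exact zero_mem _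

theorem total_num (μ : Fin D) (a : LocalForms K) : total μ (num a) = num (total μ a) := by
  have h := sder_commute (total_mem (K := K) μ) num_mem (total_gen_par μ) num_par (fun g => ?_) a
  · simpa [sgn] using h
  · have h1 : sgn false false = 1 := rfl
    rw [h1, one_smul]
    cases g with
    | coef f => rw [num_coef, map_zero, total_gen, totalVal, num_coef]
    | dx ν => rw [num_dx, map_zero, total_gen, totalVal, map_zero]
    | jet z I => rw [← jet, num_jet, total_jet, num_jet]

theorem delta_num (a : LocalForms K) : delta (num a) = num (delta a) := by
  have h := sder_commute (delta_mem (K := K)) num_mem delta_gen_par num_par (fun g => ?_) a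
  · simpa [sgn] using h
  · have h1 : sgn true false = 1 := rfl
    rw [h1, one_smul]
    cases g with
    | coef f => rw [num_coef, map_zero, delta_gen, deltaVal, map_zero]
    | dx ν => rw [num_dx, map_zero, delta_gen, deltaVal, map_zero]
    | jet z I => rw [← jet, ← lin_single, num_lin, delta_lin, num_lin]

theorem num_Bi {p k : ℤ} {x : LocalForms K} (hx : x ∈ Bi K p k) : num x ∈ Bi K p k := by
  have h := sder_Bi (c := 0) (c' := 0) (num_mem (K := K)) (fun g => ?_) hx
  · simpa only [add_zero] using h
  · rw [num_gen, add_zero, add_zero]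
    cases g with
    | jet z I => exact Bi.gen_mem (.jet z I)
    | _ => exact zero_mem _

theorem jet_mem_eigSpan (z : FieldVar D) (I : Fin D →₀ ℕ) :
    (jet z I : LocalForms K) ∈ eigSpan num 1 :=
  Submodule.subset_span ⟨1, le_rfl, by rw [num_jet, Nat.cast_one, one_smul]⟩

theorem gen_mem_eigSpan (g : Gen K) : gen g ∈ eigSpan num 0 := by
  cases g with
  | coef f => exact Submodule.subset_span ⟨0, le_rfl, by rw [num_coef, Nat.cast_zero, zero_smul]⟩
  | dx μ => exact Submodule.subset_span ⟨0, le_rfl, by rw [num_dx, Nat.cast_zero, zero_smul]⟩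
  | jet z I => exact eigSpan_mono _ zero_le_one (jet_mem_eigSpan z I)

theorem num_invertible {p k : ℤ} (hk : 1 ≤ k) {x : LocalForms K} (hx : x ∈ Bi K p k) :
    x ∈ invertibleOn num := by
  refine eigSpan_one_le num (Bi_le_eigSpan num_mem gen_mem_eigSpan (fun g hg => ?_) hk hx)
  cases g with
  | jet z I => exact jet_mem_eigSpan z I
  | coef f => exact absurd hg (by simp [Gen.antigh])
  | dx μ => exact absurd hg (by simp [Gen.antigh])

theorem map_Div {T : LocalForms K →ₗ[ℝ] LocalForms K} {p k : ℤ}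
    (hB : ∀ x ∈ Bi K p k, T x ∈ Bi K p k) (hT : ∀ μ a, T (total μ a) = total μ (T a))
    {x : LocalForms K} (hx : x ∈ Div K p k) : T x ∈ Div K p k := by
  have h : Div K p k ≤ (Div K p k).comap T := by
    refine iSup_le fun μ => ?_
    rintro _ ⟨y, hy, rfl⟩
    rw [Submodule.mem_comap, hT]
    exact Div.total_mem μ (hB y hy)
  exact h hx

/-- The linear map `q ↦ q(∂) a`. -/
def polyActOn (a : LocalForms K) : MvPolynomial (Fin D) ℝ →ₗ[ℝ] LocalForms K where
  toFun q := q • a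
  map_add' p q := add_smul p q a
  map_smul' r q := smul_assoc r q a

theorem num_expand_gen (g : Gen K) : ∀ᶠ t : Finset (Fin D →₀ ℕ) in atTop,
    num (gen g) = ∑ z, ∑ I ∈ t, jet z I * jetC z I (gen g) := by
  cases g with
  | coef f => exact Eventually.of_forall fun t => by simp [jetC, jetD_coef, num_coef]
  | dx μ => exact Eventually.of_forall fun t => by simp [jetC, jetD_dx, num_dx]
  | jet z' J =>
    rw [← jet, ← lin_single]
    filter_upwards [eventually_all.2 fun z => eventually_functional (N := LocalForms K)
      (symL (Pi.single z' (monomial J 1)) z)] with t ht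
    simp only [jetC, jetD_lin, mul_smul_comm, mul_one]
    rw [num_lin, ← lin_symL, lin_apply]
    refine Finset.sum_congr rfl fun z _ => ?_
    have h := ht z (polyActOn (jet z 0))
    change symL (Pi.single z' (monomial J 1)) z • (jet z 0 : LocalForms K) = _ at h
    rw [h]
    refine Finset.sum_congr rfl fun I _ => ?_
    change _ • (monomial I (1 : ℝ) • (jet z 0 : LocalForms K)) = _
    rw [monomial_smul_jet, zero_add]
    rfl

theorem num_expand (a : LocalForms K) : ∀ᶠ t : Finset (Fin D →₀ ℕ) in atTop,
    num a = ∑ z, ∑ I ∈ t, jet z I * jetC z I a := by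
  induction a using LocalForms.induction with
  | one => exact Eventually.of_forall fun t => by simp [jetC, (jetD_mem _ _).1, num_mem.1]
  | add a b ha hb =>
    filter_upwards [ha, hb] with t ha hb
    simp only [map_add, mul_add, Finset.sum_add_distrib, ← ha, ← hb]
  | smul c a ha =>
    filter_upwards [ha] with t ha
    simp only [map_smul, mul_smul_comm, ← Finset.smul_sum, ← ha]
  | gen_mul g a ha =>
    filter_upwards [ha, num_expand_gen g] with t ha hg
    rw [sder_even_mul num_mem, hg, ha]
    simp only [Finset.sum_mul, Finset.mul_sum, ← Finset.sum_add_distrib]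
    refine Finset.sum_congr rfl fun z _ => Finset.sum_congr rfl fun I _ => ?_
    have h1 : (jet z I * gen g : LocalForms K) = sgn z.parity g.parity • (gen g * jet z I) :=
      gen_supercomm (.jet z I) g
    rw [jetC, jetD_gen_mul, mul_add, mul_smul_comm, ← mul_assoc, ← mul_assoc, ← mul_assoc, h1,
      smul_mul_assoc, smul_smul, sgn_mul_self, one_smul]

/-- The sum of the variables times their Euler-Lagrange derivatives is the number operator up to a
total divergence. -/
theorem num_sub_EL {p k : ℤ} {a : LocalForms K} (ha : a ∈ Bi K p k) :
    num a - ∑ z, jet z 0 * EL z a ∈ Div K p k := by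
  obtain ⟨t, h1, h2⟩ := ((num_expand a).and (eventually_all.2 fun z => EL_eventually z a)).exists
  rw [h1, ← Finset.sum_sub_distrib]
  refine Submodule.sum_mem _ fun z _ => ?_
  rw [h2, Finset.mul_sum, ← Finset.sum_sub_distrib]
  refine Submodule.sum_mem _ fun I _ => ?_
  have h := integrate_by_parts (monomial I (1 : ℝ)) (Bi.jet_mem (K := K) z 0)
    (jetD_Bi z (lcoeff ℝ I) ha)
  rw [monomial_smul_jet, zero_add, zero_add, add_sub_cancel] at h
  exact h

/-! ### Forms without jet variables -/

/-- The argument of the highest derivative: each ∂f/∂z_J equals minus the total derivative of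
∂f/∂z_{J+i}. Iterating reaches multi-indices on which `f` no longer depends. -/
theorem jetC_total_eq_zero (i : Fin D) {f : LocalForms K} (hf : total i f = 0) (z : FieldVar D)
    (J : Fin D →₀ ℕ) : jetC z J f = 0 := by
  have h1 : ∀ J, jetC z J f = -total i (jetC z (J + e i) f) := fun J => by
    have h := jetD_total z (lcoeff ℝ (J + e i)) i f
    have h2 : lcoeff ℝ (J + e i) ∘ₗ LinearMap.mulLeft ℝ (X i) = lcoeff ℝ J := by
      refine LinearMap.ext fun p => ?_
      change coeff (J + Finsupp.single i 1) (X i * p) = coeff J p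
      rw [add_comm J, coeff_X_mul]
    rw [hf, map_zero, h2] at h
    exact (neg_eq_of_add_eq_zero_right h.symm).symm
  have h2 : ∀ (n : ℕ) J, jetC z (J + n • e i) f = 0 → jetC z J f = 0 := by
    intro n
    induction n with
    | zero => intro J h; simpa using h
    | succ n ih =>
      intro J h
      refine ih J ?_
      rw [h1, add_assoc, ← succ_nsmul, h, map_zero, neg_zero]
  obtain ⟨t, ht⟩ := (jetC_eventually_zero z f).exists
  have hinj : Function.Injective fun n : ℕ => J + n • e i := fun m n h => by
    have h3 := congrArg (fun I : Fin D →₀ ℕ => I i) h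
    simpa [e] using h3
  obtain ⟨n, hn⟩ : ∃ n : ℕ, J + n • e i ∉ t := by
    by_contra! hc
    exact (Set.infinite_range_of_injective hinj) (t.finite_toSet.subset (by
      rintro _ ⟨n, rfl⟩
      exact hc n))
  exact h2 n J (ht _ hn)

theorem smul_gen_coef (r : ℝ) (f : K.carrier) :
    r • (gen (.coef f) : LocalForms K) = gen (.coef (algebraMap ℝ K.carrier r * f)) := by
  rw [gen_coef_mul, gen_coef_algebraMap, smul_mul_assoc, one_mul]

/-- A top-degree monomial either contains a jet, and then has positive eigenvalue under `num`, or is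
a coefficient function times the volume form. -/
theorem exists_coef_add {k : ℤ} {f : LocalForms K} (hf : f ∈ Bi K D k) :
    ∃ h : K.carrier, f - gen (.coef h) * vol K ∈ eigSpan num 1 := by
  induction hf using Homog.induction with
  | zero => exact ⟨0, by rw [gen_coef_zero, zero_mul, sub_zero]; exact zero_mem _⟩
  | add x y _ _ hx hy =>
    obtain ⟨h, hx⟩ := hx
    obtain ⟨h', hy⟩ := hy
    refine ⟨h + h', ?_⟩
    rw [gen_coef_add, add_mul, add_sub_add_comm]
    exact Submodule.add_mem _ hx hy
  | smul c x _ hx =>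
    obtain ⟨h, hx⟩ := hx
    refine ⟨algebraMap ℝ K.carrier c * h, ?_⟩
    rw [← smul_gen_coef, smul_mul_assoc, ← smul_sub]
    exact Submodule.smul_mem _ _ hx
  | prod l hl =>
    by_cases hj : ∃ g ∈ l, ∃ z I, g = Gen.jet z I
    · obtain ⟨g, hg, z, I, rfl⟩ := hj
      refine ⟨0, ?_⟩
      rw [gen_coef_zero, zero_mul, sub_zero]
      exact eigSpan_prod_one num_mem gen_mem_eigSpan ⟨_, hg, jet_mem_eigSpan z I⟩
    · rw [sum_bideg, Prod.mk.injEq] at hl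
      obtain ⟨c, m, s, hml, hm, hs, hprod⟩ := prod_eq_mul_dxProd l
      obtain ⟨f, hf⟩ := prod_coef (m := m) fun g hg => by
        have h0 := hm g hg
        cases g with
        | coef f => exact ⟨f, rfl⟩
        | dx μ => exact absurd h0 (by simp [Gen.formDeg])
        | jet z I => exact absurd ⟨_, hml hg, z, I, rfl⟩ hj
      obtain ⟨c', hc'⟩ := dxProd_top (K := K) (s := s) (by
        rw [hs]
        exact_mod_cast hl.1)
      refine ⟨algebraMap ℝ K.carrier (c * c') * f, ?_⟩
      rw [hprod, hf, hc', ← smul_gen_coef, mul_smul_comm, smul_mul_assoc, smul_smul, sub_self]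
      exact zero_mem _

/-- Independence of all jets gives `num f = 0`, while the difference from its jet-free part lies
where `num` is invertible. -/
theorem exists_coef_of_total_eq_zero (i : Fin D) {k : ℤ} {f : LocalForms K} (hf : f ∈ Bi K D k)
    (h : total i f = 0) : ∃ h : K.carrier, f = gen (.coef h) * vol K := by
  obtain ⟨h', hh⟩ := exists_coef_add hf
  refine ⟨h', sub_eq_zero.1 (invertibleOn.eq_zero (eigSpan_one_le num hh) ?_)⟩
  obtain ⟨t, ht⟩ := (num_expand f).exists
  have h0 : num f = 0 := by
    rw [ht]
    refine Finset.sum_eq_zero fun z _ => Finset.sum_eq_zero fun I _ => ?_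
    rw [jetC_total_eq_zero i h, mul_zero]
  rw [map_sub, h0, sder_even_mul num_mem, num_coef, sder_vol num_mem num_dx, zero_mul, mul_zero,
    add_zero, sub_zero]

theorem CoeffAlgebra.exists_eq_algebraMap (f : K.carrier)
    (h : ∀ μ x, (K.deriv μ f : (Fin D → ℝ) → ℝ) x = 0) : ∃ r, f = algebraMap ℝ K.carrier r := by
  refine ⟨(f : (Fin D → ℝ) → ℝ) 0, Subtype.ext (funext fun x => ?_)⟩
  refine is_const_of_fderiv_eq_zero (𝕜 := ℝ) (fun x => K.differentiableAt f x) (fun x => ?_) x 0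
  refine ContinuousLinearMap.coe_injective (LinearMap.pi_ext' fun μ => LinearMap.ext_ring ?_)
  exact h μ x

end Number
end DualGravity
end

noncomputable section
namespace DualGravity

open MvPolynomial

/-! ### The characteristic cohomology in antighost number three -/

section Main

variable {D : ℕ} {K : CoeffAlgebra D}

theorem exists_delta_add_div {T : LocalForms K →ₗ[ℝ] LocalForms K} {p k : ℤ}
    (hB : ∀ l, ∀ x ∈ Bi K p l, T x ∈ Bi K p l) (hT : ∀ μ a, total μ (T a) = T (total μ a))
    (hδ : ∀ a, delta (T a) = T (delta a)) {x m y : LocalForms K} (hx : x ∈ invertibleOn T)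
    (hm : m ∈ Bi K p (k + 1)) (hy : y ∈ Div K p k) (h : T x = delta m + y) :
    ∃ m' ∈ Bi K p (k + 1), ∃ y' ∈ Div K p k, x = delta m' + y' := by
  obtain ⟨r, hr⟩ := invertibleOn.exists_eq hx
  refine ⟨Polynomial.aeval (R := ℝ) T r m, aeval_mem (hB _) r hm, Polynomial.aeval (R := ℝ) T r y,
    aeval_mem (fun y hy => map_Div (hB k) (fun μ a => (hT μ a).symm) hy) r hy, ?_⟩
  rw [aeval_commute hδ, ← map_add, ← h]
  exact hr

theorem delta_mul_vol (x : LocalForms K) (hx : ∃ w, x = lin K w) :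
    delta (x * vol K) = delta x * vol K := by
  obtain ⟨w, rfl⟩ := hx
  exact sder_lin_mul_vol delta_mem (fun μ => delta_gen _) w

theorem total_mul_vol (μ : Fin D) (x : LocalForms K) : total μ (x * vol K) = total μ x * vol K := by
  rw [total_mul, sder_vol (total_mem μ) (fun ν => total_gen μ _), mul_zero, add_zero]

/-- The divergence form of δC* survives multiplication by constants and by the volume form, which
have vanishing total derivatives. -/
theorem delta_Cst_mem_Div (c : Fin D → ℝ) :
    delta ((∑ μ, c μ • Cstar K μ) * vol K) ∈ Div K D 2 := by
  rw [delta_mul_vol _ ⟨_, (lin_cstFamily c).symm⟩, map_sum, Finset.sum_mul]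
  refine Submodule.sum_mem _ fun α _ => ?_
  rw [map_smul, smul_mul_assoc]
  refine Submodule.smul_mem _ _ ?_
  have h : ∀ μ (z : FieldVar D), z.antigh = 2 → jet z (0 + e μ) * vol K ∈ Div K D 2 := by
    intro μ z hz
    rw [← total_jet, ← total_mul_vol]
    refine Div.total_mem μ ?_
    have h1 := Bi.mul_mem (Bi.jet_mem (K := K) z 0) (vol_Bi (K := K))
    rw [hz, zero_add, add_zero] at h1
    exact h1
  rw [Cstar, jet, delta_gen, deltaVal, add_mul, smul_mul_assoc, smul_mul_assoc, Finset.sum_mul,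
    Finset.sum_mul]
  exact Submodule.add_mem _
    (Submodule.smul_mem _ _ (Submodule.sum_mem _ fun μ _ => h μ (.Sst μ α) rfl))
    (Submodule.smul_mem _ _ (Submodule.sum_mem _ fun μ _ => h μ (.Ast μ α) rfl))

theorem EL_Div (z : FieldVar D) {p k : ℤ} {x : LocalForms K} (hx : x ∈ Div K p k) : EL z x = 0 := by
  have h : Div K p k ≤ LinearMap.ker (EL z) := by
    refine iSup_le fun μ => ?_
    rintro _ ⟨y, -, rfl⟩
    exact EL_total z μ y
  exact h hx

theorem Cst_Bi (c : Fin D → ℝ) : (∑ μ, c μ • Cstar K μ) * vol K ∈ Bi K D 3 := by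
  rw [Finset.sum_mul]
  refine Submodule.sum_mem _ fun μ _ => ?_
  rw [smul_mul_assoc]
  refine Submodule.smul_mem _ _ ?_
  have h1 := Bi.mul_mem (Bi.jet_mem (K := K) (.Cst μ) 0) (vol_Bi (K := K))
  rw [zero_add, add_zero] at h1
  exact h1

theorem sum_single_reflect (q : MvPolynomial (Fin D) ℝ) (z : FieldVar D)
    (t : FieldVar D → LocalForms K) :
    ∑ z', reflect (q * (Pi.single z' 1 : FieldVar D → MvPolynomial (Fin D) ℝ) z) • t z'
      = reflect q • t z := by
  rw [Finset.sum_eq_single z]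
  · rw [Pi.single_eq_same, mul_one]
  · intro z' _ h
    rw [Pi.single_eq_of_ne h.symm, mul_zero, map_zero, zero_smul]
  · simp

theorem sum_ktMat_Sst (μ α : Fin D) (t : FieldVar D → LocalForms K) :
    ∑ z', reflect (ktMat z' (.Sst μ α)) • t z'
      = -(3 : ℝ) • (total μ (t (.Cst α)) + total α (t (.Cst μ))) := by
  have h : ∀ z', ktMat z' (.Sst μ α) = (3 : ℝ) • (X μ * (Pi.single z' 1 : FieldVar D → _) (.Cst α)
      + X α * (Pi.single z' 1 : FieldVar D → _) (.Cst μ)) := fun _ => rfl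
  simp only [h, map_smul, map_add, smul_assoc, add_smul, smul_add, Finset.sum_add_distrib,
    ← Finset.smul_sum, sum_single_reflect, reflect_X, neg_smul, X_smul]
  module

theorem sum_ktMat_Ast (μ α : Fin D) (t : FieldVar D → LocalForms K) :
    ∑ z', reflect (ktMat z' (.Ast μ α)) • t z'
      = -(total μ (t (.Cst α)) - total α (t (.Cst μ))) := by
  have h : ∀ z', ktMat z' (.Ast μ α) = X μ * (Pi.single z' 1 : FieldVar D → _) (.Cst α)
      - X α * (Pi.single z' 1 : FieldVar D → _) (.Cst μ) := fun _ => rfl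
  simp only [h, map_sub, sub_smul, Finset.sum_sub_distrib, sum_single_reflect, reflect_X, neg_smul,
    X_smul]
  module

/-- The equations satisfied by the Euler-Lagrange derivatives of a cocycle. -/
def ELCocycle (t : FieldVar D → LocalForms K) : Prop :=
  ∀ z, sgn z.parity true • delta (t z) + ∑ z', reflect (ktMat z' z) • t z' = 0

/-- The S* and A* equations determine the symmetrized and antisymmetrized derivatives of the C*
components; together they determine every single derivative. -/
theorem ELCocycle.total_Cst {t : FieldVar D → LocalForms K} (h : ELCocycle t) (μ α : Fin D) :
    total μ (t (.Cst α))
      = delta ((1 / 6 : ℝ) • (t (.Sst μ α) + (3 : ℝ) • t (.Ast μ α))) := by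
  have h1 := h (.Sst μ α)
  have h2 := h (.Ast μ α)
  rw [sum_ktMat_Sst] at h1
  rw [sum_ktMat_Ast] at h2
  have e1 : sgn (FieldVar.parity (.Sst μ α)) true = 1 := rfl
  have e2 : sgn (FieldVar.parity (.Ast μ α)) true = 1 := rfl
  rw [e1] at h1
  rw [e2] at h2
  rw [map_smul, map_add, map_smul]
  linear_combination (norm := module) (-1 / 6 : ℝ) • h1 - (1 / 2 : ℝ) • h2

theorem exists_const (hD : 4 < D) {t : FieldVar D → LocalForms K} (h : ELCocycle t)
    (ht : ∀ z, t z ∈ Bi K D (3 - z.antigh)) (α : Fin D) :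
    ∃ c : ℝ, ∃ m ∈ Bi K D 1, t (.Cst α) = c • vol K + delta m := by
  have hC : t (.Cst α) ∈ Bi K D 0 := ht (.Cst α)
  have hg : ∀ μ, (1 / 6 : ℝ) • (t (.Sst μ α) + (3 : ℝ) • t (.Ast μ α)) ∈ Bi K D 1 := fun μ =>
    Submodule.smul_mem _ _ (Submodule.add_mem _ (ht (.Sst μ α))
      (Submodule.smul_mem _ _ (ht (.Ast μ α))))
  -- One direction is enough to remove all jets, so the projector needs to commute with only one
  -- variable.
  obtain ⟨f₀, hf₀, m, hm, hfm, h0⟩ := weakly_constant hD ⟨0, by omega⟩ hC (hg _) (h.total_Cst _ α)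
  obtain ⟨f, rfl⟩ := exists_coef_of_total_eq_zero _ hf₀ h0
  -- Every derivative of the remaining function times the volume form is δ-exact, hence zero when
  -- the fields are set to zero.
  obtain ⟨c, hc⟩ := CoeffAlgebra.exists_eq_algebraMap f fun μ x => by
    refine bg_coef_mul_vol x (K.deriv μ f) ?_
    have h1 : gen (.coef (K.deriv μ f)) * vol K
        = delta ((1 / 6 : ℝ) • (t (.Sst μ α) + (3 : ℝ) • t (.Ast μ α)) - total μ m) := by
      rw [map_sub, ← h.total_Cst, hfm, delta_total, map_add, add_sub_cancel_right, total_mul_vol,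
        total_gen]
      rfl
    rw [h1, bg_delta]
  refine ⟨c, m, hm, ?_⟩
  rw [hfm, hc, gen_coef_algebraMap, smul_mul_assoc, one_mul]

/-- The adjoint of `kt ∘ kt = 0`; the sign is constant over the nonzero terms by `ktMat_support`. -/
theorem reflect_ktMat_smul_sum (z : FieldVar D) (t : FieldVar D → LocalForms K) :
    ∑ z', reflect (ktMat z' z) • (sgn z'.parity true • ∑ z'', reflect (ktMat z'' z') • t z'')
      = 0 := by
  have h1 : ∀ z', reflect (ktMat z' z)
      • (sgn z'.parity true • ∑ z'', reflect (ktMat z'' z') • t z'')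
      = ∑ z'', (-sgn z.parity true) • (reflect (ktMat z' z * ktMat z'' z') • t z'') := fun z' => by
    by_cases h : ktMat z' z = 0
    · simp [h]
    · have h2 : sgn z'.parity true = -sgn z.parity true := by
        rw [(ktMat_support h).2]
        cases z.parity <;> simp [sgn]
      rw [h2, smul_comm, Finset.smul_sum, Finset.smul_sum]
      refine Finset.sum_congr rfl fun z'' _ => ?_
      rw [smul_smul (reflect _), map_mul]
  simp only [h1]
  rw [Finset.sum_comm]
  refine Finset.sum_eq_zero fun z'' _ => ?_
  rw [← Finset.smul_sum, ← Finset.sum_smul, ← map_sum, sum_ktMat_mul, map_zero, zero_smul,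
    smul_zero]

/-- Solving the equations of the Euler-Lagrange derivatives in one antighost number. -/
theorem ELCocycle.exists_step (hD : 4 < D) {t r : FieldVar D → LocalForms K} (h : ELCocycle t)
    (ht : ∀ z, t z ∈ Bi K D (3 - z.antigh)) {z : FieldVar D} (hz : z.antigh ≤ 2)
    (hr : ∀ z', z'.antigh = z.antigh + 1 → r z' ∈ Bi K D (4 - z'.antigh) ∧
      t z' = delta (r z') - sgn z'.parity true • ∑ z'', reflect (ktMat z'' z') • r z'') :
    ∃ y ∈ Bi K D (4 - z.antigh),
      t z = delta y - sgn z.parity true • ∑ z', reflect (ktMat z' z) • r z' := by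
  have hs : sgn z.parity true * sgn z.parity true = 1 := sgn_mul_self _ _
  have hmem : ∑ z', reflect (ktMat z' z) • r z' ∈ Bi K D (3 - z.antigh) :=
    Submodule.sum_mem _ fun z' _ => by
      by_cases h0 : ktMat z' z = 0
      · rw [h0, map_zero, zero_smul]
        exact zero_mem _
      · have h1 := (ktMat_support h0).1
        have h2 := poly_smul_Bi (reflect (ktMat z' z)) (hr z' h1).1
        have h3 : (4 : ℤ) - z'.antigh = 3 - z.antigh := by omega
        rw [h3] at h2
        exact h2
  have hδ : ∑ z', reflect (ktMat z' z) • delta (r z')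
      = ∑ z', reflect (ktMat z' z) • t z' := by
    rw [← add_zero (∑ z', reflect (ktMat z' z) • t z'), ← reflect_ktMat_smul_sum z r,
      ← Finset.sum_add_distrib]
    refine Finset.sum_congr rfl fun z' _ => ?_
    by_cases h0 : ktMat z' z = 0
    · simp [h0]
    · rw [(hr z' (ktMat_support h0).1).2, ← smul_add, sub_add_cancel]
  -- The corrected component is a δ-cycle by the equation for `z` and by the solutions one antighost
  -- number higher. Its own antighost number `3 - z.antigh` is at least 1, so acyclicity applies.
  obtain ⟨y, hy, hyz⟩ := delta_acyclic hD (k := 3 - z.antigh) (by omega)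
    (Submodule.add_mem _ (ht z) (Submodule.smul_mem _ (sgn z.parity true) hmem)) (by
      rw [map_add, map_smul, map_sum]
      simp only [delta_poly_smul]
      rw [hδ]
      have h1 := congrArg (fun x => sgn z.parity true • x) (h z)
      simp only [smul_add, smul_smul, hs, one_smul, smul_zero] at h1
      exact h1)
  refine ⟨y, ?_, ?_⟩
  · have h3 : (3 : ℤ) - z.antigh + 1 = 4 - z.antigh := by omega
    rw [h3] at hy
    exact hy
  · rw [← hyz, add_sub_cancel_right]

theorem ELCocycle.exists_solution (hD : 4 < D) {t : FieldVar D → LocalForms K} (h : ELCocycle t)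
    (ht : ∀ z, t z ∈ Bi K D (3 - z.antigh))
    (hC : ∀ α, ∃ m ∈ Bi K D 1, t (.Cst α) = delta m) :
    ∃ r : FieldVar D → LocalForms K, ∀ z, r z ∈ Bi K D (4 - z.antigh) ∧
      t z = delta (r z) - sgn z.parity true • ∑ z', reflect (ktMat z' z) • r z' := by
  suffices hk : ∀ k ≤ 3, ∃ r : FieldVar D → LocalForms K, ∀ z, 3 ≤ z.antigh + k →
      r z ∈ Bi K D (4 - z.antigh) ∧
        t z = delta (r z) - sgn z.parity true • ∑ z', reflect (ktMat z' z) • r z' by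
    obtain ⟨r, hr⟩ := hk 3 le_rfl
    exact ⟨r, fun z => hr z (by omega)⟩
  intro k
  induction k with
  | zero =>
    intro _
    choose m hm hm' using hC
    -- The descent starts at C*, where no correction occurs since the column of `ktMat` is zero.
    refine ⟨fun | .Cst α => m α | _ => 0, fun z hz => ?_⟩
    cases z with
    | Cst α =>
      refine ⟨hm α, ?_⟩
      rw [Finset.sum_eq_zero, smul_zero, sub_zero]
      · exact hm' α
      · intro z' _
        have h0 : ktMat z' (.Cst α) = 0 := rfl
        rw [h0, map_zero, zero_smul]
    | _ => exact absurd hz (by simp [FieldVar.antigh])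
  | succ k ih =>
    intro hk
    obtain ⟨r, hr⟩ := ih (by omega)
    have hy : ∀ z : FieldVar D, z.antigh + k = 2 → ∃ y ∈ Bi K D (4 - z.antigh),
        t z = delta y - sgn z.parity true • ∑ z', reflect (ktMat z' z) • r z' := fun z hz =>
      h.exists_step hD ht (by omega) fun z' hz' => hr z' (by omega)
    choose! y hyB hy using hy
    let r' : FieldVar D → LocalForms K := fun z => if z.antigh + k = 2 then y z else r z
    have hsum : ∀ z, 2 ≤ z.antigh + k → ∑ z', reflect (ktMat z' z) • r' z'
        = ∑ z', reflect (ktMat z' z) • r z' := fun z hz => by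
      refine Finset.sum_congr rfl fun z' _ => ?_
      by_cases h0 : ktMat z' z = 0
      · simp [h0]
      · have h1 := (ktMat_support h0).1
        have h2 : r' z' = r z' := if_neg (by omega)
        rw [h2]
    refine ⟨r', fun z hz => ?_⟩
    rw [hsum z (by omega)]
    by_cases h2 : z.antigh + k = 2
    · have h3 : r' z = y z := if_pos h2
      rw [h3]
      exact ⟨hyB z h2, hy z h2⟩
    · have h3 : r' z = r z := if_neg h2
      rw [h3]
      exact hr z (by omega)

/-- After the terms with `delta (r z)` cancel, the terms `delta (jet z 0) * r z` match the adjoint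
terms `jet z 0 * (reflect (ktMat z' z) • r z')` under exchange of indices, up to an integration by
parts. -/
theorem sum_jet_mul_EL {t r : FieldVar D → LocalForms K}
    (hr : ∀ z, r z ∈ Bi K D (4 - z.antigh) ∧
      t z = delta (r z) - sgn z.parity true • ∑ z', reflect (ktMat z' z) • r z') :
    ∑ z, jet z 0 * t z - delta (∑ z, sgn z.parity true • (jet z 0 * r z)) ∈ Div K D 3 := by
  have h1 : ∀ z, jet z 0 * t z - delta (sgn z.parity true • (jet z 0 * r z))
      = -(sgn z.parity true • (delta (jet z 0) * r z))
        - sgn z.parity true • ∑ z', jet z 0 * (reflect (ktMat z' z) • r z') := fun z => by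
    have h2 : delta (jet z 0 * r z)
        = delta (jet z 0) * r z + sgn true z.parity • (jet z 0 * delta (r z)) :=
      delta_mem.2 (.jet z 0) (r z)
    rw [map_smul, h2, sgn_comm true, smul_add, smul_smul, sgn_mul_self, one_smul, (hr z).2, mul_sub,
      mul_smul_comm, Finset.mul_sum]
    abel
  have h2 : ∀ z, sgn z.parity true • ∑ z', jet z 0 * (reflect (ktMat z' z) • r z')
      = -∑ z', sgn z'.parity true • (jet z 0 * (reflect (ktMat z' z) • r z')) := fun z => by
    rw [Finset.smul_sum, ← Finset.sum_neg_distrib]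
    refine Finset.sum_congr rfl fun z' _ => ?_
    by_cases h : ktMat z' z = 0
    · simp [h]
    · rw [(ktMat_support h).2, ← neg_smul]
      congr 1
      cases z.parity <;> simp [sgn]
  have h3 : ∀ z, sgn z.parity true • (delta (jet z 0) * r z)
      = ∑ z', sgn z.parity true • ((ktMat z z' • jet z' 0) * r z) := fun z => by
    rw [← sum_ktMat_smul, Finset.sum_mul, Finset.smul_sum]
  rw [map_sum, ← Finset.sum_sub_distrib]
  simp only [h1, h2, h3]
  rw [Finset.sum_sub_distrib, Finset.sum_neg_distrib, Finset.sum_neg_distrib, sub_neg_eq_add,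
    Finset.sum_comm (f := fun z z' => sgn z'.parity true • (jet z 0 * (reflect (ktMat z' z) • r z'))),
    neg_add_eq_sub, ← Finset.sum_sub_distrib]
  refine Submodule.sum_mem _ fun z _ => ?_
  rw [← Finset.sum_sub_distrib]
  refine Submodule.sum_mem _ fun z' _ => ?_
  rw [← smul_sub]
  refine Submodule.smul_mem _ _ ?_
  by_cases h : ktMat z z' = 0
  · simp only [h, map_zero, zero_smul, mul_zero, zero_mul, sub_zero]
    exact zero_mem _
  · have h4 := Submodule.neg_mem _
      (integrate_by_parts (ktMat z z') (Bi.jet_mem (K := K) z' 0) (hr z).1)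
    have h5 : (z'.antigh : ℤ) + (4 - z.antigh) = 3 := by
      have := (ktMat_support h).1
      omega
    rw [neg_sub, zero_add, h5] at h4
    exact h4

theorem ELCocycle_of_EL_delta {a : LocalForms K} (h : ∀ z, EL z (delta a) = 0) :
    ELCocycle fun z => EL z a := fun z => by
  rw [← EL_delta]
  exact h z

end Main
end DualGravity
end

noncomputable section
namespace DualGravity

/-! ### Triviality, existence and uniqueness of the constants. -/

section Main

variable {D : ℕ} {K : CoeffAlgebra D}

/-- A form of antighost number three is trivial modulo `d` as soon as its Euler–Lagrange derivatives
solve the Koszul–Tate cocycle condition with exact components along the `C^*`. -/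
theorem exists_delta_add_extd (hD : 4 < D) {a : LocalForms K} (ha : a ∈ Bi K D 3)
    (h : ∀ z, EL z (delta a) = 0) (hC : ∀ α, ∃ m ∈ Bi K D 1, EL (.Cst α) a = delta m) :
    ∃ m ∈ Bi K D 4, ∃ n ∈ Bi K (D - 1) 3, a = delta m + extd n := by
  obtain ⟨r, hr⟩ := (ELCocycle_of_EL_delta h).exists_solution hD (fun z => EL_Bi z ha) hC
  have hm : ∑ z, sgn z.parity true • (jet z 0 * r z) ∈ Bi K D (3 + 1) :=
    Submodule.sum_mem _ fun z _ => Submodule.smul_mem _ _ (by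
      have h1 := Bi.mul_mem (Bi.jet_mem (K := K) z 0) (hr z).1
      rw [zero_add, add_sub_cancel] at h1
      exact h1)
  -- Both differences are divergences, so `num a` is δ-exact modulo divergences; inverting `num`
  -- then transfers this to `a`.
  have h1 := add_mem (num_sub_EL ha) (sum_jet_mul_EL hr)
  rw [sub_add_sub_cancel] at h1
  obtain ⟨m, hm', y, hy, hy'⟩ := exists_delta_add_div (T := num) (fun l x hx => num_Bi hx)
    total_num delta_num (num_invertible (by norm_num) ha) hm h1 (add_sub_cancel _ _).symm
  obtain ⟨n, hn, rfl⟩ := Div.exists_extd hy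
  exact ⟨m, hm', n, hn, hy'⟩

theorem exists_Cst_add_delta_add_extd (hD : 4 < D) {a : LocalForms K} (ha : a ∈ Bi K D 3)
    (h : ∀ z, EL z (delta a) = 0) :
    ∃ c : Fin D → ℝ, ∃ m ∈ Bi K D 4, ∃ n ∈ Bi K (D - 1) 3,
      a - (∑ μ, c μ • Cstar K μ) * vol K = delta m + extd n := by
  choose c m hm hc using
    exists_const hD (ELCocycle_of_EL_delta h) fun z => EL_Bi z ha
  -- Subtracting the combination of the C* preserves the cocycle equations and leaves only the
  -- δ-exact part of each C* component.
  refine ⟨c, exists_delta_add_extd hD (Submodule.sub_mem _ ha (Cst_Bi c)) (fun z => ?_)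
    fun α => ⟨m α, hm α, ?_⟩⟩
  · rw [map_sub, map_sub, h, EL_Div z (delta_Cst_mem_Div c), sub_zero]
  · rw [map_sub, EL_Cst, hc, add_sub_cancel_left]

/-- The Euler-Lagrange derivative along C*_ν isolates `c ν • vol`. It kills `extd n` and makes
`delta m` δ-exact, as the C* column of `ktMat` vanishes, so evaluation at zero fields gives `c ν =
0`. -/
theorem Cst_eq_zero_of_eq_delta_add_extd {c : Fin D → ℝ} {m n : LocalForms K}
    (h : (∑ μ, c μ • Cstar K μ) * vol K = delta m + extd n) : c = 0 := by
  funext ν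
  have h1 := congrArg (EL (.Cst ν)) h
  have h2 : ∑ z', reflect (ktMat z' (.Cst ν)) • EL z' m = 0 :=
    Finset.sum_eq_zero fun z' _ => by
      rw [show ktMat z' (.Cst ν) = 0 by cases z' <;> rfl, map_zero, zero_smul]
  rw [EL_Cst, map_add, EL_delta, EL_extd, h2, add_zero, add_zero] at h1
  refine bg_coef_mul_vol (K := K) 0 (algebraMap ℝ K.carrier (c ν)) ?_
  rw [gen_coef_algebraMap, smul_mul_assoc, one_mul, h1, map_smul, bg_delta, smul_zero]

end Main
end DualGravity
end

open DualGravity in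
theorem mainTheorem5 (D : ℕ) (hD : 4 < D) (K : CoeffAlgebra D) :
    (∀ c : Fin D → ℝ, IsCocycle K 3 ((∑ μ, c μ • Cstar K μ) * vol K)) ∧
    ∀ a : LocalForms K, IsCocycle K 3 a →
      ∃! c : Fin D → ℝ, IsTrivial K 3 (a - (∑ μ, c μ • Cstar K μ) * vol K) := by
  have hD' : ((D - 1 : ℕ) : ℤ) = D - 1 := by omega
  refine ⟨fun c => ⟨?_, ?_⟩, fun a ⟨ha, b, _, hab⟩ => ?_⟩
  · rw [Forms_eq_Bi]
    exact Cst_Bi c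
  · obtain ⟨n, hn, h⟩ := Div.exists_extd (delta_Cst_mem_Div (K := K) c)
    refine ⟨-n, ?_, by rw [h, map_neg, add_neg_cancel]⟩
    rw [Forms_eq_Bi, hD']
    exact Submodule.neg_mem _ hn
  · rw [Forms_eq_Bi] at ha
    obtain ⟨c, m, hm, n, hn, h⟩ := exists_Cst_add_delta_add_extd hD ha fun z => by
      rw [eq_neg_of_add_eq_zero_left hab, map_neg, EL_extd, neg_zero]
    refine ⟨c, ⟨m, ?_, n, ?_, h⟩, fun c' ⟨m', _, n', _, h'⟩ => ?_⟩
    · rw [Forms_eq_Bi]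
      exact hm
    · rw [Forms_eq_Bi, hD']
      exact hn
    -- The difference of two trivializations of `a` trivializes the combination with coefficients
    -- `c' - c`.
    · refine sub_eq_zero.1 (Cst_eq_zero_of_eq_delta_add_extd (K := K) (m := m - m') (n := n - n') ?_)
      simp only [Pi.sub_apply, sub_smul, Finset.sum_sub_distrib, sub_mul]
      rw [map_sub, map_sub, sub_add_sub_comm, ← h, ← h', sub_sub_sub_cancel_left]
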